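/- **Setting.** Let $A_1,B_1,A_2,B_2$ be complex polynomials, $B_i\neq0$, $d_i:=\deg A_i\ge \deg B_i+1$, such that the common zeros of $A_i$ and $B_i$ are simple zeros of $B_i$. Put $V_i'=(A_i+B_i')/B_i$, $q_2=\deg B_2$, $\widehat V_2'=A_2/B_2$. An admissible contour for $e^{-V_i}dz$ is an oriented curve avoiding the zeros of $B_i$ (piecewise smooth, of finite length in bounded regions and at most polynomially growing length at infinity), with a continuous branch of $e^{-V_i}$ along it, which either is a closed loop on which the branch is single-valued, or each of whose ends tends (a) to $\infty$ inside a sector where $\Re V_i\to+\infty$, or (b) to a multiple zero of $B_i$ inside a sector where $\Re V_i\to+\infty$, or (c) to a simple zero $b$ of $B_i$ where $e^{-V_i}\sim \mathrm{const}\,(z-b)^k$, $k\in\{0,1,2,\dots\}$ (a hard edge if $k=0$). Dual admissible contours are defined in the same way for the weight $e^{\widehat V_2}$, i.e. with $A_2$ replaced by $-A_2-B_2'$. Fix admissible contours $\Gamma_{x,\mu}$ ($1\le\mu\le d_1$) for $e^{-V_1}$ and $\Gamma_{y,\nu}$ ($1\le\nu\le d_2$) for $e^{-V_2}$, dual contours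 $\widehat\Gamma_{y,\nu}$ ($1\le\nu\le d_2$), and constants $\varkappa_{\mu\nu}\in\mathbb C$. Write $\iint_\varkappa=\sum_{\mu,\nu}\varkappa_{\mu\nu}\int_{\Gamma_{x,\mu}}\int_{\Gamma_{y,\nu}}$ and $$\mathcal L(p|q)=\iint_\varkappa p(\xi)q(y)e^{-V_1(\xi)-V_2(y)+\xi y}\,d\xi\,dy,\qquad \widehat{\mathcal L}(p|q)=\mathcal L(p|B_2q)$$ (if $\deg A_i=\deg B_i+1$ for both $i$, the integrals for polynomial $p,q$ are assumed to converge absolutely; otherwise they do). The first formula is also used when $p$ is rational in $\xi$. Assume that biorthogonal polynomials exist for $\mathcal L$ and $\widehat{\mathcal L}$: polynomials $p_n,s_n,\widehat p_n,\widehat s_n$ of exact degree $n\ge0$ with $\mathcal L(p_n|s_m)=\delta_{nm}=\widehat{\mathcal L}(\widehat p_n|\widehat s_m)$, normalized so that $p_n,s_n,\widehat p_n$ have the same leading coefficient. Define matrices $\widehat L$ (strictly lower triangular) and $\widehat A$ by $$B_2\widehat s_k=s_k+\sum_{j>k}\widehat L_{jk}s_j,\qquad A_2\widehat s_k-B_2\widehat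 s_k'=\sum_{j}\widehat A_{jk}s_j ,$$ put $\widehat\ell_j(n)=\widehat L_{n,n-j}$, $\widehat\alpha_j(n)=\widehat A_{n,n-j}$, and let $\widehat{\mathbf a}_m(x)$ be the ladder matrix of size $d_2+1$: the upper shift matrix plus the matrix whose only nonzero row is the last one, equal to $$\frac1{\widehat\alpha_{-1}(m)}\big(x[0,\dots,0,\widehat\ell_{q_2}(m),\dots,\widehat\ell_1(m),1]-[\widehat\alpha_{d_2}(m),\dots,\widehat\alpha_0(m)]\big).$$ Let $\Pi_n$ be the projector on the indices $0,\dots,n-1$, and $\widehat{\mathbb A}(x)$ the block of $[\widehat A-x\widehat L,\Pi_n]$ with rows $n-1,\dots,n+d_2-1$ and columns $n-d_2,\dots,n$. Let $\widehat\psi_m^{(0)}=\widehat\psi_m=\widehat p_m e^{-V_1}$, $\phi_m=s_me^{-V_2}$, and for $1\le\nu\le d_2$ $$\widehat\psi^{(\nu)}_m(x)=\frac1{2\pi i}\int_{\widehat\Gamma_{y,\nu}}\!\!ds\iint_\varkappa d\xi\,dy\;\mathcal B_2(x;y,s)\,e^{\xi y-xs-V_2(y)+\widehat V_2(s)}\,\frac{\widehat\psi_m(\xi)}{x-\xi},$$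 $$\mathcal B_2(x;y,s)=\frac{B_2(y)-B_2(s)}{y-s}\Big(x-\frac1{y-s}\Big)-\frac{A_2(y)-B_2'(s)-A_2(s)}{y-s}.$$ **Theorem.** Let $n\ge d_2+1$ and $\widehat{\boldsymbol\Psi}_n(x)=\big[\widehat\psi^{(\nu)}_{n-d_2+a}(x)\big]_{a,\nu=0,\dots,d_2}$. On every open set that contains no zero of $B_1$, does not meet the closure of the contours $\Gamma_{x,\mu}$, and on which a branch of $e^{-V_1}$ is chosen (for column $0$), $\widehat{\mathbf a}_{n-1}(x)$ is invertible, $\widehat{\boldsymbol\Psi}_n=\widehat{\mathbf a}_{n-1}\widehat{\boldsymbol\Psi}_{n-1}$, and $$\widehat{\boldsymbol\Psi}_n'(x)=\mathcal C_n(x)\,\widehat{\boldsymbol\Psi}_n(x),$$ $$\mathcal C_n(x)=-\mathcal H_n(x)-\mathrm{diag}\big(\widehat P_{n-d_2,n-d_2-1},0,\dots,0\big)\,\widehat{\mathbf a}_{n-1}(x)^{-1}+\mathcal E_n(x)\,\widehat{\mathbb A}(x)+W(x)\,\widehat{\mathbb A}(x).$$ Here $\widehat P_{jk}=\widehat{\mathcal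 L}(\widehat p_j|y\widehat s_k)$; $\mathcal H_n$ is the matrix with rows and columns labelled by $n-d_2,\dots,n$ with $(j,k)$ entry $\widehat P_{jk}$ if $k<n$ and $j\le k+1$, with $(n,n)$ entry $V_1'(x)$, and zero otherwise; $$W_{ab}(x)=\mathcal L\Big(\widehat p_{n-d_2+a}(\rho)\,\frac{V_1'(\rho)-V_1'(x)}{\rho-x}\,\Big|\,s_{n-1+b}(y)\Big),\qquad a,b=0,\dots,d_2;$$ and $\mathcal E_n$ is the matrix of hard-edge boundary terms $$(\mathcal E_n)_{ab}(x)=\sum_{\mu=1}^{d_1}\bigg[\frac{\widehat\psi_{n-d_2+a}(\xi)}{\xi-x}\sum_{\nu=1}^{d_2}\varkappa_{\mu\nu}\int_{\Gamma_{y,\nu}}e^{\xi y}\phi_{n-1+b}(y)\,dy\bigg]_{\xi\in\partial\Gamma_{x,\mu}},$$ the evaluation being the limit along $\Gamma_{x,\mu}$ at its final end minus the limit at its initial end. Moreover $\widehat{\boldsymbol\Psi}_n(x)$ is invertible (a fundamental system) if and only if the functions $g_\nu(x)=\int_{\widehat\Gamma_{y,\nu}}e^{\widehat V_2(s)-xs}ds$,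 $1\le\nu\le d_2$, are linearly independent, i.e. the dual contours form a basis; in that case $\widehat{\boldsymbol\Psi}_n'\,\widehat{\boldsymbol\Psi}_n^{-1}=\mathcal C_n$. -/

import Mathlib

open Polynomial MeasureTheory Set Filter Topology

noncomputable section

namespace TwoMatrix

/-- Derivative of the potential attached to a pair of polynomials: `V' = (A + B') / B`. -/
def potDeriv (A B : ℂ[X]) (z : ℂ) : ℂ :=
  (A.eval z + (derivative B).eval z) / B.eval z

/-- `A` and `B` are reduced: their common zeros are simple zeros of `B`. -/
def IsReduced (A B : ℂ[X]) : Prop :=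
  ∀ b : ℂ, A.IsRoot b → B.IsRoot b → B.rootMultiplicity b = 1

/-- Along `l` the curve `γ` goes to infinity inside a sector in which `Re V → +∞`
(here `V ∼ (a / b) z ^ k / k` at infinity, `k = deg A - deg B + 1`, with `a`, `b` the leading
coefficients; the constant `c` is the opening `ε` of the sector). -/
def EndAtInfinity (A B : ℂ[X]) (γ : ℝ → ℂ) (l : Filter ℝ) : Prop :=
  Tendsto (fun t => ‖γ t‖) l atTop ∧
    ∃ c : ℝ, 0 < c ∧ ∀ᶠ t in l,
      c * ‖γ t‖ ^ (A.natDegree - B.natDegree + 1) ≤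
        (A.leadingCoeff / B.leadingCoeff * γ t ^ (A.natDegree - B.natDegree + 1)).re

/-- Along `l` the curve `γ` goes to a multiple zero `b` of `B` (an essential singularity of
`exp (-V)`) inside a sector in which `Re V → +∞`. With `r` the multiplicity of `b` and
`B = (X - b) ^ r * B₀` one has `V ∼ τ / ((r - 1) (z - b) ^ (r - 1))`, `τ = - A(b) / B₀(b)`. -/
def EndAtEssential (A B : ℂ[X]) (γ : ℝ → ℂ) (l : Filter ℝ) : Prop :=
  ∃ b : ℂ, 2 ≤ B.rootMultiplicity b ∧ Tendsto γ l (𝓝 b) ∧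
    ∃ c : ℝ, 0 < c ∧ ∀ᶠ t in l,
      c / ‖γ t - b‖ ^ (B.rootMultiplicity b - 1) ≤
        (-(A.eval b) / (B /ₘ (X - C b) ^ B.rootMultiplicity b).eval b /
          (γ t - b) ^ (B.rootMultiplicity b - 1)).re

/-- Along `l` the curve `γ` goes to a simple zero `b` of `B` at which `exp (-V)` is regular, that
is, `exp (-V) ∼ const * (z - b) ^ k` with `k` a natural number (`k = 0`: a hard edge). -/
def EndAtRegular (A B : ℂ[X]) (γ : ℝ → ℂ) (l : Filter ℝ) : Prop :=
  ∃ b : ℂ, B.rootMultiplicity b = 1 ∧ Tendsto γ l (𝓝 b) ∧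
    ∃ k : ℕ, A.eval b + (derivative B).eval b = -(k * (derivative B).eval b)

/-- The three ways in which an admissible contour may end. -/
def AdmissibleEnd (A B : ℂ[X]) (γ : ℝ → ℂ) (l : Filter ℝ) : Prop :=
  EndAtInfinity A B γ l ∨ EndAtEssential A B γ l ∨ EndAtRegular A B γ l

/-- An admissible contour for the differential `exp (-V(z)) dz`, `V' = (A + B') / B`: an oriented
curve parametrized by `(0, 1)`, away from the zeros of `B`, together with a continuous branch `w`
of `exp (-V)` along it. Either both ends are admissible ends, or it is a closed loop on which the
branch is single valued. (As `deriv γ` may vanish, piecewise smooth curves are included.)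
Lassos around branch points, circles around poles, lines from regular points (such as hard edges)
to infinity, petals and stems at the essential singularities and petals at infinity are all
of this form. -/
structure Contour (A B : ℂ[X]) where
  /-- the parametrized curve -/
  γ : ℝ → ℂ
  /-- the branch of `exp (-V)` along the curve -/
  w : ℝ → ℂ
  smooth : ContDiffOn ℝ 1 γ (Ioo 0 1)
  avoids : ∀ t ∈ Ioo (0 : ℝ) 1, B.eval (γ t) ≠ 0
  w_ne_zero : ∀ t ∈ Ioo (0 : ℝ) 1, w t ≠ 0
  w_deriv : ∀ t ∈ Ioo (0 : ℝ) 1, HasDerivAt w (-(potDeriv A B (γ t)) * deriv γ t * w t) t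
  /-- finite length in bounded regions and at most polynomial growth of the length at infinity -/
  tame : ∃ N : ℕ, IntegrableOn (fun t => ‖deriv γ t‖ / (1 + ‖γ t‖) ^ N) (Ioo 0 1)
  ends : (AdmissibleEnd A B γ (𝓝[>] 0) ∧ AdmissibleEnd A B γ (𝓝[<] 1)) ∨
    ∃ z w₀ : ℂ, B.eval z ≠ 0 ∧ Tendsto γ (𝓝[>] 0) (𝓝 z) ∧ Tendsto γ (𝓝[<] 1) (𝓝 z) ∧
      Tendsto w (𝓝[>] 0) (𝓝 w₀) ∧ Tendsto w (𝓝[<] 1) (𝓝 w₀)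

namespace Contour

variable {A B : ℂ[X]}

/-- The weighted contour integral `∫_Γ f(z) exp (-V(z)) dz`. -/
def integral (Γ : Contour A B) (f : ℂ → ℂ) : ℂ :=
  ∫ t in Ioo (0 : ℝ) 1, f (Γ.γ t) * Γ.w t * deriv Γ.γ t

/-- The points of the contour. -/
def carrier (Γ : Contour A B) : Set ℂ := Γ.γ '' Ioo 0 1

/-- The boundary evaluation of `f(z) exp (-V(z))` on `∂Γ`: the limit along the contour at its final
end minus the limit along the contour at its initial end. -/
def boundary (Γ : Contour A B) (f : ℂ → ℂ) : ℂ :=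
  limUnder (𝓝[<] (1 : ℝ)) (fun t => f (Γ.γ t) * Γ.w t) -
    limUnder (𝓝[>] (0 : ℝ)) (fun t => f (Γ.γ t) * Γ.w t)

end Contour

/-- A dual admissible contour for `(A, B)`: an admissible contour for `exp (V̂(s)) ds` with
`V̂' = A / B`. This is an admissible contour, in the above sense, for the pair `(-A - B', B)`,
because `(-A - B' + B') / B = - A / B = - V̂'`. -/
abbrev DualContour (A B : ℂ[X]) : Type := Contour (-A - derivative B) B

/-- The data of a reduced semiclassical bilinear moment functional of type BB. -/
structure Data where
  A₁ : ℂ[X]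
  B₁ : ℂ[X]
  A₂ : ℂ[X]
  B₂ : ℂ[X]
  B₁_ne_zero : B₁ ≠ 0
  B₂_ne_zero : B₂ ≠ 0
  deg₁ : B₁.natDegree + 1 ≤ A₁.natDegree
  deg₂ : B₂.natDegree + 1 ≤ A₂.natDegree
  reduced₁ : IsReduced A₁ B₁
  reduced₂ : IsReduced A₂ B₂
  /-- the contours `Γ_{x,μ}` -/
  Γx : Fin A₁.natDegree → Contour A₁ B₁
  /-- the contours `Γ_{y,ν}` -/
  Γy : Fin A₂.natDegree → Contour A₂ B₂
  /-- the dual contours `Γ̂_{y,ν}` -/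
  Γs : Fin A₂.natDegree → DualContour A₂ B₂
  /-- the coefficients of the moment functional -/
  κ : Fin A₁.natDegree → Fin A₂.natDegree → ℂ

namespace Data

variable (D : Data)

/-- `d₂ = deg A₂`. -/
abbrev d₂ : ℕ := D.A₂.natDegree

/-- Absolute convergence of the integrals defining the bimoments. -/
def MomentsConverge : Prop :=
  ∀ μ ν, D.κ μ ν ≠ 0 → ∀ i j : ℕ,
    Integrable (fun q : ℝ × ℝ =>
      ((D.Γx μ).γ q.1 ^ i * (D.Γy ν).γ q.2 ^ j *
          Complex.exp ((D.Γx μ).γ q.1 * (D.Γy ν).γ q.2)) *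
        ((D.Γx μ).w q.1 * deriv (D.Γx μ).γ q.1) * ((D.Γy ν).w q.2 * deriv (D.Γy ν).γ q.2))
      ((volume.restrict (Ioo 0 1)).prod (volume.restrict (Ioo 0 1)))

/-- `∫∫_κ f(ξ, y) exp (-V₁(ξ) - V₂(y) + ξ y) dξ dy`, the combination with coefficients `κ` of the
double integrals over `Γ_{x,μ} × Γ_{y,ν}`. -/
def dblIntegral (f : ℂ → ℂ → ℂ) : ℂ :=
  ∑ μ, ∑ ν, D.κ μ ν *
    (D.Γx μ).integral fun ξ => (D.Γy ν).integral fun y => f ξ y * Complex.exp (ξ * y)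

/-- The bimoment functional `𝓛(p | q)`. -/
def L (p q : ℂ[X]) : ℂ := D.dblIntegral fun ξ y => p.eval ξ * q.eval y

/-- The associated bimoment functional `𝓛̂(p | q) = 𝓛(p | B₂ q)`. -/
def Lhat (p q : ℂ[X]) : ℂ := D.L p (D.B₂ * q)

/-- `V₁'`. -/
def dV₁ (z : ℂ) : ℂ := potDeriv D.A₁ D.B₁ z

/-- The kernel of the bilinear concomitant,
`((B₂(y) - B₂(s)) / (y - s)) (x - 1 / (y - s)) - (A₂(y) - B₂'(s) - A₂(s)) / (y - s)`,
which is a polynomial in `x`, `y`, `s`; written with divided differences, so that its value on the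
diagonal `y = s` is the right one. See `concomitantKernel_of_ne`. -/
def concomitantKernel (x y s : ℂ) : ℂ :=
  x * dslope (fun z => D.B₂.eval z) s y
    - dslope (dslope (fun z => D.B₂.eval z) s) s y - dslope (fun z => D.A₂.eval z) s y

theorem concomitantKernel_of_ne (x : ℂ) {y s : ℂ} (h : y ≠ s) :
    D.concomitantKernel x y s =
      (D.B₂.eval y - D.B₂.eval s) / (y - s) * (x - 1 / (y - s))
        - (D.A₂.eval y - (derivative D.B₂).eval s - D.A₂.eval s) / (y - s) := by
  have h' : y - s ≠ 0 := sub_ne_zero.mpr h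
  simp only [concomitantKernel, dslope_of_ne _ h, dslope_same, Polynomial.deriv, slope_def_field]
  field_simp
  ring

/-- The solution `g_ν(x) = ∫_{Γ̂_{y,ν}} exp (V̂₂(s) - x s) ds` of the adjoint equation
`(A₂(-∂) - B₂(-∂) x) g = 0` attached to a dual contour. -/
def adjointSolution (ν : Fin D.d₂) (x : ℂ) : ℂ :=
  (D.Γs ν).integral fun s => Complex.exp (-(x * s))

end Data

/-- `p`, `q` are sequences of polynomials of exact degrees `0, 1, 2, …`, biorthonormal for `L`. -/
structure IsBiorthonormal (L : ℂ[X] → ℂ[X] → ℂ) (p q : ℕ → ℂ[X]) : Prop where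
  degree_left : ∀ n, (p n).degree = n
  degree_right : ∀ n, (q n).degree = n
  pairing : ∀ n m, L (p n) (q m) = if n = m then 1 else 0

/-- Biorthogonal polynomials `p, s` for `𝓛` and `p̂, ŝ` for `𝓛̂`. The normalization of `p, s` is
`p_n = π_n / √h_n`, `s_n = σ_n / √h_n` with `π_n, σ_n` monic, so that the leading coefficients agree;
that of `p̂, ŝ` is the one coming from `p̂ = (1 + L̂)⁻¹ p` with `L̂` strictly lower triangular, so that
`p̂_n` and `p_n` have the same leading coefficient. -/
structure BOPs (D : Data) where
  p : ℕ → ℂ[X]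
  s : ℕ → ℂ[X]
  pHat : ℕ → ℂ[X]
  sHat : ℕ → ℂ[X]
  biorth : IsBiorthonormal D.L p s
  biorthHat : IsBiorthonormal D.Lhat pHat sHat
  normalized : ∀ n, (p n).leadingCoeff = (s n).leadingCoeff
  normalizedHat : ∀ n, (pHat n).leadingCoeff = (p n).leadingCoeff

namespace BOPs

variable {D : Data} (P : BOPs D)

/-- The entries of the strictly lower triangular matrix `L̂`: `(1 + L̂)_{jk}` is the coefficient of
`s_j` in `B₂ ŝ_k`, that is, `B₂ ŝ = (1 + L̂)ᵗ s`. One has `L̂_{jk} = ℓ̂_{j-k}(j)`. -/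
def matL (j k : ℕ) : ℂ := D.L (P.p j) (D.B₂ * P.sHat k) - if j = k then 1 else 0

/-- The entries of the matrix `Â`: `Â_{jk}` is the coefficient of `s_j` in
`- (∂_y - V₂') (B₂ ŝ_k) = A₂ ŝ_k - B₂ ŝ_k'`, that is, `(∂_y - V₂') (1 + L̂)ᵗ s = - Âᵗ s`. One has
`Â_{jk} = α̂_{j-k}(j)`. -/
def matA (j k : ℕ) : ℂ := D.L (P.p j) (D.A₂ * P.sHat k - D.B₂ * derivative (P.sHat k))

/-- `P̂_{jk} = 𝓛̂(p̂_j | y ŝ_k)`. -/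
def matP (j k : ℕ) : ℂ := D.Lhat (P.pHat j) (X * P.sHat k)

/-- The auxiliary transforms
`ψ̂_m^{(ν)}(x) = (1 / 2πi) ∫_{Γ̂_{y,ν}} ds ∫∫_κ dξ dy 𝓑₂(x; y, s) exp (ξ y - x s - V₂(y) + V̂₂(s))`
`ψ̂_m(ξ) / (x - ξ)` of the quasipolynomial `ψ̂_m(ξ) = p̂_m(ξ) exp (-V₁(ξ))`. -/
def psiAux (ν : Fin D.d₂) (m : ℕ) (x : ℂ) : ℂ :=
  1 / (2 * Real.pi * Complex.I) *
    (D.Γs ν).integral fun s =>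
      D.dblIntegral fun ξ y =>
        D.concomitantKernel x y s * Complex.exp (-(x * s)) * ((P.pHat m).eval ξ / (x - ξ))

/-- The direct system `Ψ̂_n(x)`, with rows `n - d₂, …, n`: the column `0` is the window of the
quasipolynomials `ψ̂_m(x) = p̂_m(x) exp (-V₁(x))` (`E` being a branch of `exp (-V₁)`), the column `ν`
is the window of the `ψ̂_m^{(ν)}(x)`. -/
def direct (E : ℂ → ℂ) (n : ℕ) (x : ℂ) : Matrix (Fin (D.d₂ + 1)) (Fin (D.d₂ + 1)) ℂ :=
  Matrix.of fun a r =>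
    Fin.cases ((P.pHat (n - D.d₂ + a)).eval x * E x)
      (fun ν => P.psiAux ν (n - D.d₂ + a) x) r

/-- The hat ladder matrix `â_m(x)`: upper shift in the first rows, and last row
`(x [0, …, ℓ̂_{q₂}(m), …, ℓ̂_1(m), 1] - [α̂_{d₂}(m), …, α̂_0(m)]) / α̂_{-1}(m)`. -/
def ladder (m : ℕ) (x : ℂ) : Matrix (Fin (D.d₂ + 1)) (Fin (D.d₂ + 1)) ℂ :=
  Matrix.of fun a b =>
    if a = Fin.last D.d₂ then
      (x * ((if b = Fin.last D.d₂ then 1 else 0) + P.matL m (m - D.d₂ + b))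
        - P.matA m (m - D.d₂ + b)) / P.matA m (m + 1)
    else if (b : ℕ) = a + 1 then 1 else 0

/-- The Christoffel–Darboux matrix: the block of the commutator `[Â - x L̂, Π_n]` with rows
`n - 1, …, n + d₂ - 1` and columns `n - d₂, …, n`, where `Π_n` is the projector on the indices
`0, …, n - 1`. -/
def cdMatrix (n : ℕ) (x : ℂ) : Matrix (Fin (D.d₂ + 1)) (Fin (D.d₂ + 1)) ℂ :=
  Matrix.of fun a b =>
    (P.matA (n - 1 + a) (n - D.d₂ + b) - x * P.matL (n - 1 + a) (n - D.d₂ + b)) *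
      ((if n - D.d₂ + (b : ℕ) < n then 1 else 0) - (if n - 1 + (a : ℕ) < n then 1 else 0))

/-- The matrix with rows and columns labelled by `n - d₂, …, n` whose `(j, k)` entry is `P̂_{jk}` for
`j ≤ k + 1`, `k < n`, whose `(n, n)` entry is `V₁'(x)`, and whose other entries are `0`. -/
def hessenberg (n : ℕ) (x : ℂ) : Matrix (Fin (D.d₂ + 1)) (Fin (D.d₂ + 1)) ℂ :=
  Matrix.of fun a b =>
    if b = Fin.last D.d₂ then (if a = Fin.last D.d₂ then D.dV₁ x else 0)
    else if (a : ℕ) ≤ b + 1 then P.matP (n - D.d₂ + a) (n - D.d₂ + b) else 0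

/-- The hard-edge boundary terms `[ψ̂_{n-d₂+a}(ξ) φ_{n-1+b}^{(κ)}(ξ) / (ξ - x)]_{ξ ∈ ∂_x κ}`, that is
`∑_μ [exp (-V₁(ξ)) p̂_{n-d₂+a}(ξ) / (ξ - x) ∑_ν κ_{μν} ∫_{Γ_{y,ν}} exp (ξ y) φ_{n-1+b}(y) dy]` evaluated
at the boundary of `Γ_{x,μ}`, with `φ_m = s_m exp (-V₂)`. -/
def boundaryMatrix (n : ℕ) (x : ℂ) : Matrix (Fin (D.d₂ + 1)) (Fin (D.d₂ + 1)) ℂ :=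
  Matrix.of fun a b =>
    ∑ μ, (D.Γx μ).boundary fun ξ =>
      (P.pHat (n - D.d₂ + a)).eval ξ / (ξ - x) *
        ∑ ν, D.κ μ ν *
          (D.Γy ν).integral fun y => Complex.exp (ξ * y) * (P.s (n - 1 + b)).eval y

/-- `W_{ab}(x) = 𝓛(p̂_{n-d₂+a}(ρ) (V₁'(ρ) - V₁'(x)) / (ρ - x) | s_{n-1+b}(y))`. -/
def matW (n : ℕ) (x : ℂ) : Matrix (Fin (D.d₂ + 1)) (Fin (D.d₂ + 1)) ℂ :=
  Matrix.of fun a b =>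
    D.dblIntegral fun ρ y =>
      (P.pHat (n - D.d₂ + a)).eval ρ * ((D.dV₁ ρ - D.dV₁ x) / (ρ - x)) * (P.s (n - 1 + b)).eval y

/-- The diagonal matrix `diag (P̂_{n-d₂,n-d₂-1}, 0, …, 0)`. -/
def cornerMatrix (n : ℕ) : Matrix (Fin (D.d₂ + 1)) (Fin (D.d₂ + 1)) ℂ :=
  Matrix.diagonal fun a => if a = 0 then P.matP (n - D.d₂) (n - D.d₂ - 1) else 0

/-- The coefficient matrix of the differential equation of the direct system. -/
def odeMatrix (n : ℕ) (x : ℂ) : Matrix (Fin (D.d₂ + 1)) (Fin (D.d₂ + 1)) ℂ :=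
  -P.hessenberg n x - P.cornerMatrix n * (P.ladder (n - 1) x)⁻¹
    + P.boundaryMatrix n x * P.cdMatrix n x + P.matW n x * P.cdMatrix n x

end BOPs

end TwoMatrix

end

noncomputable section

namespace TwoMatrix

/-! Fix `x` off the contours. Every column of the system is a window of values `F(p̂_m)` of one kind
of functional, `F(p) = e p(x) - ∬ p(ξ) β(y) / (ξ - x)` (`colFun`) with `deg β < d₂`. Column `0` has
`e = E x`, `β = 0`. Column `ν` has `e = 0` and `β = β_ν` (`betaPoly`), the concomitant kernel
integrated against the dual weight (`psiAux_eq_colFun`). The recurrence and the action of the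
coefficient matrix are proved for a general `F`.

Integration by parts in `y` gives `𝓛(p | T q) = 𝓛̂((ξ - x) p | q)` for `T q = A₂ q - B₂ q' - x B₂ q`
(`adjointOp`). Hence a single banded matrix, `Â - x (1 + L̂)` (`pencil`), expands both `(X - x) p_j`
in the `p̂_k` and `T ŝ_k` in the `s_j`. Since `F((X - x) p) = -𝓛(p | β)`, its rows `j ≥ d₂`
annihilate the values `F(p̂_k)`. This is the ladder recurrence, and the ladder is invertible because
the two extreme diagonals never vanish. Commuting with `Π_n` gives the Christoffel–Darboux identity
`sum_cdMatrix`: the window of `F`, multiplied by the Christoffel–Darboux matrix and summed against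
the `s_j`, is `T K + β`, where `K = ∑_{k<n} F(p̂_k) ŝ_k`.

Integration by parts in `ξ` merges the boundary term and `W` into one functional of the polynomial
in `y` (`sourceLM`). On `T K` it equals `𝓛̂(p' | K) - V₁'(x) 𝓛̂(p | K) + 𝓛̂(p | y K)`. Here `𝓛̂(f |
K) = F(f)` when `deg f < n`, and the last term is the `P̂` sum removed by the Hessenberg and corner
matrices. So the coefficient matrix sends the column to `e (p' - V₁' p)(x) - ∬ p β / (ξ - x)² + ∬ p
y β / (ξ - x)` (`odeMatrix_mulVec_colFun`). This is visibly the derivative of column `0`. It is the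
derivative of column `ν` because `y β_ν + ∂_x β_ν` is a multiple of `T 1`
(`X_mul_betaPoly_add_deriv`), which pairs with `p̂_m / (ξ - x)` to `𝓛̂(p̂_m | 1) = 0` for `m ≥ 1`.

For invertibility, a combination of columns is again a window of some `F`. If it vanishes, the
ladders propagate the zeros to all `p̂_k`, which forces `e = 0` and `β = 0`. A combination of the
`β_ν` vanishes exactly when the same combination of dual moment functionals does: the kernel
coefficients have degrees `0, …, d₂ - 1` in `s`, and integration by parts supplies annihilated
polynomials of every degree from `d₂` on. The moments are, up to sign, the derivatives at `x` of the
combination of the entire functions `g_ν`. The analysis of the contour ends justifies the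
integrations by parts and the differentiations under the integral. -/

/-! ### Primitives with a pole-type singularity on a sector. -/

/-- The sector in which `Re (τ / u ^ m) > 0`. -/
def sector (τ : ℂ) (m : ℕ) : Set ℂ := {u | 0 < (τ / u ^ m).re}

theorem sector_ne_zero {τ : ℂ} {m : ℕ} (hm : 1 ≤ m) {u : ℂ} (hu : u ∈ sector τ m) : u ≠ 0 := by
  rintro rfl
  simp [sector, zero_pow (by omega : m ≠ 0)] at hu

theorem exists_primitive {f : ℂ → ℂ} (hf : AnalyticAt ℂ f 0) :
    ∃ R : ℂ → ℂ, ∀ᶠ u in 𝓝 0, HasDerivAt R (f u) u := by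
  obtain ⟨ε, hε, hε'⟩ := Metric.eventually_nhds_iff_ball.mp hf.eventually_analyticAt
  obtain ⟨R, hR⟩ := DifferentiableOn.isExactOn_ball (f := f) (c := 0) (r := ε)
    fun u hu => (hε' u hu).differentiableAt.differentiableWithinAt
  exact ⟨R, Metric.eventually_nhds_iff_ball.mpr ⟨ε, hε, hR⟩⟩

/-- This is a branch of `log u` up to constants. On the sector, which has several components, `τ / u
^ m` stays in the right half-plane, so the principal logarithm serves on all of them at once. -/
theorem hasDerivAt_sectorLog {τ : ℂ} {m : ℕ} (hm : 1 ≤ m) {u : ℂ} (hu : u ∈ sector τ m) :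
    HasDerivAt (fun u => -Complex.log (τ / u ^ m) / m) (1 / u) u := by
  have h0 := sector_ne_zero hm hu
  have hτ : τ ≠ 0 := by rintro rfl; simp [sector] at hu
  have hm' : (m : ℂ) ≠ 0 := by exact_mod_cast (by omega : m ≠ 0)
  obtain ⟨k, rfl⟩ : ∃ k, m = k + 1 := ⟨m - 1, by omega⟩
  have h1 : HasDerivAt (fun u : ℂ => τ / u ^ (k + 1))
      ((0 * u ^ (k + 1) - τ * (((k + 1 : ℕ) : ℂ) * u ^ k)) / (u ^ (k + 1)) ^ 2) u :=
    (hasDerivAt_const u τ).div (by simpa using hasDerivAt_pow (k + 1) u) (pow_ne_zero _ h0)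
  have h2 := (h1.clog (Or.inl hu)).neg.div_const (((k + 1 : ℕ) : ℂ))
  refine h2.congr_deriv ?_
  field_simp
  ring

theorem tendsto_mul_sectorLog {τ : ℂ} {m : ℕ} (hm : 1 ≤ m) :
    Tendsto (fun u => u * (-Complex.log (τ / u ^ m) / m)) (𝓝[sector τ m] 0) (𝓝 0) := by
  have hbound : ∀ u ∈ sector τ m, ‖u * (-Complex.log (τ / u ^ m) / m)‖ ≤
      ‖u‖ * (|Real.log ‖τ‖| + Real.pi) + m * (‖u‖ * |Real.log ‖u‖|) := by
    intro u hu
    have h0 := sector_ne_zero hm hu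
    have hτ : τ ≠ 0 := by rintro rfl; simp [sector] at hu
    have hlog : ‖Complex.log (τ / u ^ m)‖ ≤
        (|Real.log ‖τ‖| + Real.pi) + m * |Real.log ‖u‖| := by
      refine (Complex.norm_le_abs_re_add_abs_im _).trans ?_
      rw [Complex.log_re, Complex.log_im, norm_div, norm_pow,
        Real.log_div (norm_ne_zero_iff.mpr hτ) (pow_ne_zero _ (norm_ne_zero_iff.mpr h0)),
        Real.log_pow]
      have h1 := abs_sub (Real.log ‖τ‖) (m * Real.log ‖u‖)
      have h2 := Complex.abs_arg_le_pi (τ / u ^ m)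
      rw [abs_mul, Nat.abs_cast] at h1
      linarith
    rw [norm_mul, norm_div, norm_neg, Complex.norm_natCast]
    have hm' : (1 : ℝ) ≤ m := by exact_mod_cast hm
    calc ‖u‖ * (‖Complex.log (τ / u ^ m)‖ / m) ≤ ‖u‖ * ‖Complex.log (τ / u ^ m)‖ := by
          gcongr
          exact div_le_self (norm_nonneg _) hm'
      _ ≤ ‖u‖ * ((|Real.log ‖τ‖| + Real.pi) + m * |Real.log ‖u‖|) := by gcongr
      _ = _ := by ring
  refine squeeze_zero_norm' (eventually_nhdsWithin_of_forall hbound) ?_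
  have hn : Tendsto (fun u : ℂ => ‖u‖) (𝓝[sector τ m] 0) (𝓝 0) := by
    simpa using (continuous_norm.tendsto (0 : ℂ)).mono_left nhdsWithin_le_nhds
  have hl : Tendsto (fun r : ℝ => r * |Real.log r|) (𝓝 0) (𝓝 0) := by
    have h := (Real.continuous_mul_log.tendsto 0).abs
    simp only [zero_mul, abs_zero] at h
    refine squeeze_zero_norm (fun r => ?_) h
    simp [abs_mul]
  simpa using (hn.mul_const (|Real.log ‖τ‖| + Real.pi)).add ((hl.comp hn).const_mul (m : ℝ))

/-- Primitive of `f u / u ^ (r + 1)`, `f` analytic at `0`, near `0` in a sector, with its leading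
behaviour at `0`. -/
theorem exists_sector_primitive {τ : ℂ} {m : ℕ} (hm : 1 ≤ m) (r : ℕ) {f : ℂ → ℂ}
    (hf : AnalyticAt ℂ f 0) :
    ∃ G : ℂ → ℂ, (∀ᶠ u in 𝓝[sector τ m] 0, HasDerivAt G (f u / u ^ (r + 1)) u) ∧
      Tendsto (fun u => u ^ (r + 1) * G u) (𝓝[sector τ m] 0) (𝓝 0) ∧
      (1 ≤ r → Tendsto (fun u => u ^ r * G u) (𝓝[sector τ m] 0) (𝓝 (-f 0 / r))) := by
  have hid : Tendsto (fun u : ℂ => u) (𝓝[sector τ m] 0) (𝓝 0) :=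
    tendsto_id.mono_left nhdsWithin_le_nhds
  have hds : ∀ {f : ℂ → ℂ}, AnalyticAt ℂ f 0 → AnalyticAt ℂ (dslope f 0) 0 := by
    intro f hf
    obtain ⟨p, hp⟩ := hf
    exact ⟨_, hp.has_fpower_series_dslope_fslope⟩
  have hsplit : ∀ {f : ℂ → ℂ} {u : ℂ}, f u = f 0 + u * dslope f 0 u := by
    intro f u
    have := sub_smul_dslope f 0 u
    simp only [sub_zero, smul_eq_mul] at this
    rw [this]; ring
  have hmem : ∀ᶠ u in 𝓝[sector τ m] 0, u ∈ sector τ m := self_mem_nhdsWithin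
  -- Write `f u = f 0 + u * dslope f 0 u`: the constant part is integrated explicitly and the
  -- remainder has one power less in the denominator. For `r = 0` a logarithm appears, so the sharp
  -- asymptotics is claimed only for `1 ≤ r`, while the weaker limit is the one that passes through
  -- the induction.
  induction r generalizing f with
  | zero =>
    obtain ⟨R, hR⟩ := exists_primitive (hds hf)
    refine ⟨fun u => f 0 * (-Complex.log (τ / u ^ m) / m) + R u, ?_, ?_, by simp⟩
    · filter_upwards [hR.filter_mono nhdsWithin_le_nhds, hmem] with u hu hu'
      refine (((hasDerivAt_sectorLog hm hu').const_mul (f 0)).add hu).congr_deriv ?_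
      have h0 := sector_ne_zero hm hu'
      rw [hsplit (f := f) (u := u), zero_add, pow_one]
      field_simp
    · have h1 := (tendsto_mul_sectorLog (τ := τ) hm).const_mul (f 0)
      have h2 : Tendsto (fun u => u * R u) (𝓝[sector τ m] 0) (𝓝 (0 * R 0)) :=
        hid.mul (hR.self_of_nhds.continuousAt.tendsto.mono_left nhdsWithin_le_nhds)
      have h3 := h1.add h2
      simp only [mul_zero, zero_mul, add_zero] at h3
      refine h3.congr fun u => ?_
      ring
  | succ r ih =>
    obtain ⟨G, hG, hG', -⟩ := ih (hds hf)
    have hr : ((r : ℂ) + 1) ≠ 0 := by exact_mod_cast r.succ_ne_zero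
    have key : Tendsto (fun u => u ^ (r + 1) * (f 0 * (-1 / ((r + 1) * u ^ (r + 1))) + G u))
        (𝓝[sector τ m] 0) (𝓝 (-f 0 / ((r + 1 : ℕ) : ℂ))) := by
      have h := (tendsto_const_nhds (x := -f 0 / ((r + 1 : ℕ) : ℂ))).add hG'
      rw [add_zero] at h
      refine h.congr' ?_
      filter_upwards [hmem] with u hu
      have h0 := sector_ne_zero hm hu
      push_cast
      field_simp
    refine ⟨fun u => f 0 * (-1 / ((r + 1) * u ^ (r + 1))) + G u, ?_, ?_, fun _ => key⟩
    · filter_upwards [hG, hmem] with u hu hu'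
      have h0 := sector_ne_zero hm hu'
      have h1 : HasDerivAt (fun u : ℂ => -1 / (((r : ℂ) + 1) * u ^ (r + 1)))
          ((0 * (((r : ℂ) + 1) * u ^ (r + 1)) - (-1) * (((r : ℂ) + 1) * (((r + 1 : ℕ) : ℂ) * u ^ r)))
            / (((r : ℂ) + 1) * u ^ (r + 1)) ^ 2) u :=
        (hasDerivAt_const u (-1 : ℂ)).div
          ((by simpa using hasDerivAt_pow (r + 1) u :
            HasDerivAt (fun u : ℂ => u ^ (r + 1)) (((r + 1 : ℕ) : ℂ) * u ^ r) u).const_mul _)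
          (mul_ne_zero hr (pow_ne_zero _ h0))
      refine ((h1.const_mul (f 0)).add hu).congr_deriv ?_
      rw [hsplit (f := f) (u := u)]
      push_cast
      field_simp
      ring
    · have h := hid.mul key
      rw [zero_mul] at h
      refine h.congr fun u => ?_
      ring

/-! ### The weight along one end, in a local coordinate. -/

/-- Filters with arbitrarily small preconnected open sets. -/
def IsEnd (l : Filter ℝ) : Prop :=
  ∀ s ∈ l, ∃ t ∈ l, t ⊆ s ∧ IsOpen t ∧ IsPreconnected t

theorem isEnd_nhdsGT (a : ℝ) : IsEnd (𝓝[>] a) := fun s hs => by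
  obtain ⟨b, hb, hb'⟩ := (mem_nhdsGT_iff_exists_Ioo_subset).mp hs
  exact ⟨Ioo a b, Ioo_mem_nhdsGT hb, hb', isOpen_Ioo, isPreconnected_Ioo⟩

theorem isEnd_nhdsLT (a : ℝ) : IsEnd (𝓝[<] a) := fun s hs => by
  obtain ⟨b, hb, hb'⟩ := (mem_nhdsLT_iff_exists_Ioo_subset).mp hs
  exact ⟨Ioo b a, Ioo_mem_nhdsLT hb, hb', isOpen_Ioo, isPreconnected_Ioo⟩

theorem IsEnd.exists_eventually_eq_const {l : Filter ℝ} (hl : IsEnd l) {g : ℝ → ℂ}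
    (hg : ∀ᶠ t in l, HasDerivAt g 0 t) : ∃ K, ∀ᶠ t in l, g t = K := by
  obtain ⟨s, hs, hsub, ho, hp⟩ := hl _ hg
  obtain ⟨K, hK⟩ := ho.exists_is_const_of_deriv_eq_zero (𝕜 := ℝ) hp
    (fun t ht => (hsub ht).differentiableAt.differentiableWithinAt) (fun t ht => (hsub ht).deriv)
  exact ⟨K, mem_of_superset hs hK⟩

/-- Along an end, the solution of `w' = -G'(u) u' w` is a multiple of `exp (-G(u))`. -/
theorem IsEnd.exists_eq_mul_exp {l : Filter ℝ} (hl : IsEnd l) {G f : ℂ → ℂ} {u u' w : ℝ → ℂ}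
    (hu : ∀ᶠ t in l, HasDerivAt u (u' t) t) (hG : ∀ᶠ t in l, HasDerivAt G (f (u t)) (u t))
    (hw : ∀ᶠ t in l, HasDerivAt w (-(f (u t)) * u' t * w t) t) :
    ∃ K, ∀ᶠ t in l, w t = K * Complex.exp (-G (u t)) := by
  obtain ⟨K, hK⟩ := hl.exists_eventually_eq_const (g := fun t => w t * Complex.exp (G (u t))) (by
    filter_upwards [hu, hG, hw] with t h1 h2 h3
    refine (h3.mul (HasDerivAt.comp t h2 h1).cexp).congr_deriv ?_
    ring)
  refine ⟨K, hK.mono fun t ht => ?_⟩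
  rw [← ht, mul_assoc, ← Complex.exp_add]
  simp

/-- Exponential decay at an essential singularity, in local form. -/
theorem IsEnd.exists_le_exp {l : Filter ℝ} (hl : IsEnd l) {f : ℂ → ℂ} (hf : AnalyticAt ℂ f 0)
    {m : ℕ} (hm : 1 ≤ m) {u u' w : ℝ → ℂ} (hu0 : Tendsto u l (𝓝 0)) (hne : ∀ᶠ t in l, u t ≠ 0)
    (hu : ∀ᶠ t in l, HasDerivAt u (u' t) t)
    (hw : ∀ᶠ t in l, HasDerivAt w (-(f (u t) / u t ^ (m + 1)) * u' t * w t) t)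
    {c : ℝ} (hc : 0 < c) (hre : ∀ᶠ t in l, c / ‖u t‖ ^ m ≤ (-f 0 / u t ^ m).re) :
    ∃ C c' : ℝ, 0 < c' ∧ ∀ᶠ t in l, ‖w t‖ ≤ C * Real.exp (-(c' / ‖u t‖ ^ m)) := by
  obtain ⟨G, hG, -, hlim⟩ := exists_sector_primitive (τ := -f 0) hm m hf
  specialize hlim hm
  have hmem : ∀ᶠ t in l, u t ∈ sector (-f 0) m := by
    filter_upwards [hre, hne] with t h1 h2
    exact lt_of_lt_of_le (div_pos hc (pow_pos (norm_pos_iff.mpr h2) _)) h1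
  have hu0' : Tendsto u l (𝓝[sector (-f 0) m] 0) := tendsto_nhdsWithin_iff.mpr ⟨hu0, hmem⟩
  obtain ⟨K, hK⟩ := hl.exists_eq_mul_exp (f := fun z => f z / z ^ (m + 1)) hu (hu0'.eventually hG) hw
  have hmpos : (0 : ℝ) < m := by exact_mod_cast hm
  -- The leading part of `Re G` is at least `c / (m ‖u‖ ^ m)`; half of it is given up to absorb the
  -- error `hnear`.
  refine ⟨‖K‖, c / (2 * m), by positivity, ?_⟩
  have hnear := (hlim.comp hu0').eventually (Metric.ball_mem_nhds _ (show 0 < c / (2 * m) by positivity))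
  filter_upwards [hK, hre, hne, hnear] with t h1 h2 h3 h4
  rw [h1, norm_mul, Complex.norm_exp]
  gcongr
  have hpos : 0 < ‖u t‖ ^ m := pow_pos (norm_pos_iff.mpr h3) _
  have hm0 : (m : ℂ) ≠ 0 := by exact_mod_cast hmpos.ne'
  have h5 : ‖G (u t) - (-f 0 / u t ^ m) / m‖ ≤ c / (2 * m) / ‖u t‖ ^ m := by
    rw [le_div_iff₀ hpos, ← norm_pow, ← norm_mul]
    have : (G (u t) - (-f 0 / u t ^ m) / m) * u t ^ m = u t ^ m * G (u t) - -f 0 / m := by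
      field_simp
    rw [this, ← dist_eq_norm]
    exact le_of_lt h4
  have h6 := (abs_le.mp ((Complex.abs_re_le_norm _).trans h5)).1
  have h7 : (-f 0 / u t ^ m / (m : ℂ)).re = (-f 0 / u t ^ m).re / m := by
    rw [← Complex.ofReal_natCast, Complex.div_ofReal_re]
  rw [Complex.sub_re, h7] at h6
  have h8 : c / ‖u t‖ ^ m / m ≤ (-f 0 / u t ^ m).re / m := by gcongr
  have h9 : c / ‖u t‖ ^ m / m = c / (2 * m) / ‖u t‖ ^ m + c / (2 * m) / ‖u t‖ ^ m := by
    field_simp; ring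
  rw [Complex.neg_re]
  linarith

/-- Behaviour at a regular point, in local form. -/
theorem IsEnd.exists_le_pow {l : Filter ℝ} (hl : IsEnd l) {f : ℂ → ℂ} (hf : AnalyticAt ℂ f 0)
    {k : ℕ} (hk : f 0 = -k) {u u' w : ℝ → ℂ} (hu0 : Tendsto u l (𝓝 0)) (hne : ∀ᶠ t in l, u t ≠ 0)
    (hu : ∀ᶠ t in l, HasDerivAt u (u' t) t)
    (hw : ∀ᶠ t in l, HasDerivAt w (-(f (u t) / u t) * u' t * w t) t) :
    ∃ C : ℝ, ∀ᶠ t in l, ‖w t‖ ≤ C ∧ ‖f (u t) / u t * w t‖ ≤ C := by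
  obtain ⟨p, hp⟩ := hf
  have hρ : AnalyticAt ℂ (dslope f 0) 0 := ⟨_, hp.has_fpower_series_dslope_fslope⟩
  obtain ⟨R, hR⟩ := exists_primitive hρ
  have hsplit : ∀ v : ℂ, v ≠ 0 → f v / v = -k / v + dslope f 0 v := by
    intro v hv
    have := sub_smul_dslope f 0 v
    simp only [sub_zero, smul_eq_mul, hk] at this
    field_simp
    linear_combination -this
  -- The logarithmic derivative of `w` is `k / u` minus an analytic term, so `w` is a constant times
  -- `u ^ k * exp (-R u)`; the quotient is shown to have zero derivative.
  obtain ⟨K, hK⟩ := hl.exists_eventually_eq_const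
    (g := fun t => w t * Complex.exp (R (u t)) / u t ^ k) (by
    filter_upwards [hu, hu0.eventually hR, hw, hne] with t h1 h2 h3 h4
    have h5 : HasDerivAt (fun t => u t ^ k) (k * u t ^ (k - 1) * u' t) t := h1.pow k
    refine ((h3.mul (HasDerivAt.comp t h2 h1).cexp).div h5 (pow_ne_zero _ h4)).congr_deriv ?_
    rw [hsplit _ h4]
    rcases k with _ | k
    · simp only [Pi.mul_apply, Function.comp, Nat.cast_zero, pow_zero]
      ring
    · simp only [Nat.add_sub_cancel, Function.comp, Pi.mul_apply]
      push_cast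
      field_simp
      ring)
  have hw' : ∀ᶠ t in l, w t = K * u t ^ k * Complex.exp (-R (u t)) := by
    filter_upwards [hK, hne] with t h1 h2
    rw [← h1, div_mul_cancel₀ _ (pow_ne_zero _ h2), mul_assoc, ← Complex.exp_add]
    simp
  have hRc : Tendsto (fun t => Complex.exp (-R (u t))) l (𝓝 (Complex.exp (-R 0))) :=
    (Complex.continuous_exp.tendsto _).comp
      (hR.self_of_nhds.continuousAt.tendsto.comp hu0).neg
  have hwlim : Tendsto (fun t => K * u t ^ k * Complex.exp (-R (u t))) l
      (𝓝 (K * 0 ^ k * Complex.exp (-R 0))) := ((hu0.pow k).const_mul K).mul hRc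
  -- The simple pole of `V'` is cancelled by one factor of `u ^ k`. For `k = 0` the truncated
  -- exponent `k - 1` is harmless because the coefficient `-k` is zero.
  have hfw : ∃ z : ℂ, Tendsto (fun t => (-k * u t ^ (k - 1) * K * Complex.exp (-R (u t)) +
      dslope f 0 (u t) * (K * u t ^ k * Complex.exp (-R (u t))))) l (𝓝 z) :=
    ⟨_, ((((hu0.pow (k - 1)).const_mul (-(k : ℂ))).mul_const K).mul hRc).add
      ((hρ.continuousAt.tendsto.comp hu0).mul hwlim)⟩
  obtain ⟨z, hz⟩ := hfw
  obtain ⟨C₁, hC₁⟩ := hwlim.norm.isBoundedUnder_le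
  obtain ⟨C₂, hC₂⟩ := hz.norm.isBoundedUnder_le
  refine ⟨max C₁ C₂, ?_⟩
  filter_upwards [hC₁, hC₂, hw', hne] with t h1 h2 h3 h4
  constructor
  · rw [h3]
    exact le_max_of_le_left h1
  · rw [hsplit _ h4, h3]
    refine le_max_of_le_right (le_trans (le_of_eq ?_) h2)
    congr 1
    rcases k with _ | k
    · simp
    · simp only [Nat.add_sub_cancel]
      field_simp
      ring

/-! ### The three kinds of admissible ends. -/

theorem eval_eq_pow_mul_reverse (p : ℂ[X]) {z : ℂ} (hz : z ≠ 0) :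
    p.eval z = z ^ p.natDegree * p.reverse.eval z⁻¹ := by
  let _ := invertibleOfNonzero hz
  have h := eval₂_reverse_mul_pow (RingHom.id ℂ) z p
  rw [invOf_eq_inv] at h
  rw [mul_comm]
  exact h.symm

theorem degree_derivative_lt_of_natDegree_lt {A B : ℂ[X]} (hdeg : B.natDegree + 1 ≤ A.natDegree) :
    (derivative B).degree < A.degree := by
  have hA : A ≠ 0 := by rintro rfl; simp at hdeg
  rw [degree_eq_natDegree hA]
  refine lt_of_le_of_lt degree_le_natDegree ?_
  have := natDegree_derivative_le B
  exact_mod_cast (by omega : (derivative B).natDegree < A.natDegree)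

theorem natDegree_add_derivative {A B : ℂ[X]} (hdeg : B.natDegree + 1 ≤ A.natDegree) :
    (A + derivative B).natDegree = A.natDegree :=
  natDegree_add_eq_left_of_degree_lt (degree_derivative_lt_of_natDegree_lt hdeg)

theorem leadingCoeff_add_derivative {A B : ℂ[X]} (hdeg : B.natDegree + 1 ≤ A.natDegree) :
    (A + derivative B).leadingCoeff = A.leadingCoeff :=
  leadingCoeff_add_of_degree_lt' (degree_derivative_lt_of_natDegree_lt hdeg)

theorem analyticAt_eval (p : ℂ[X]) (z : ℂ) : AnalyticAt ℂ (fun u => p.eval u) z :=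
  p.differentiable.analyticAt z

/-- In the coordinate `u = 1 / z` infinity becomes an essential singularity: `V' dz = f(u) / u ^ (j
+ 2) du` with `f` analytic, built from the reversed polynomials, and `-f 0` the ratio of leading
coefficients. Then `IsEnd.exists_le_exp` applies with `m = j + 1`. -/
theorem EndAtInfinity.exists_bound {A B : ℂ[X]} (hB : B ≠ 0)
    (hdeg : B.natDegree + 1 ≤ A.natDegree) {γ w : ℝ → ℂ} {l : Filter ℝ} (hl : IsEnd l)
    (h : EndAtInfinity A B γ l) (hγ : ∀ᶠ t in l, HasDerivAt γ (deriv γ t) t)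
    (hw : ∀ᶠ t in l, HasDerivAt w (-(potDeriv A B (γ t)) * deriv γ t * w t) t) :
    ∃ C c : ℝ, 0 < c ∧ ∀ᶠ t in l,
      ‖w t‖ ≤ C * Real.exp (-(c * ‖γ t‖ ^ (A.natDegree - B.natDegree + 1))) ∧
      ‖potDeriv A B (γ t)‖ ≤ C * ‖γ t‖ ^ (A.natDegree - B.natDegree) := by
  obtain ⟨hinf, c, hc, hre⟩ := h
  obtain ⟨j, hj⟩ : ∃ j, A.natDegree = B.natDegree + j := ⟨A.natDegree - B.natDegree, by omega⟩
  have hj' : A.natDegree - B.natDegree = j := by omega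
  simp only [hj'] at hre ⊢
  set N := A + derivative B with hN
  have hNd : N.natDegree = A.natDegree := natDegree_add_derivative hdeg
  have hNl : N.leadingCoeff = A.leadingCoeff := leadingCoeff_add_derivative hdeg
  set f : ℂ → ℂ := fun u => -(N.reverse.eval u / B.reverse.eval u) with hf
  have hB0 : B.reverse.eval 0 ≠ 0 := by
    rw [← coeff_zero_eq_eval_zero, coeff_zero_reverse]
    exact leadingCoeff_ne_zero.mpr hB
  have hfa : AnalyticAt ℂ f 0 :=
    ((analyticAt_eval _ 0).div (analyticAt_eval _ 0) hB0).neg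
  have hf0 : -f 0 = A.leadingCoeff / B.leadingCoeff := by
    simp only [hf, neg_neg]
    rw [← coeff_zero_eq_eval_zero, ← coeff_zero_eq_eval_zero, coeff_zero_reverse,
      coeff_zero_reverse, hNl]
  have hne : ∀ᶠ t in l, γ t ≠ 0 := (hinf.eventually_gt_atTop 0).mono fun t ht => norm_pos_iff.mp ht
  have hu0 : Tendsto (fun t => (γ t)⁻¹) l (𝓝 0) :=
    tendsto_inv₀_cobounded.comp (tendsto_norm_atTop_iff_cobounded.mp hinf)
  have hV : ∀ z : ℂ, z ≠ 0 → potDeriv A B z = -f z⁻¹ * z ^ j := by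
    intro z hz
    have h1 : A.eval z + (derivative B).eval z = N.eval z := by rw [hN, eval_add]
    rw [potDeriv, h1, eval_eq_pow_mul_reverse N hz, eval_eq_pow_mul_reverse B hz, hNd, hj, pow_add]
    simp only [hf, neg_neg]
    rw [mul_assoc, mul_div_mul_left _ _ (pow_ne_zero _ hz)]
    ring
  obtain ⟨C, c', hc', hC⟩ := hl.exists_le_exp hfa (m := j + 1) (by omega) hu0
    (hne.mono fun t ht => inv_ne_zero ht) (u' := fun t => -deriv γ t / γ t ^ 2) (w := w)
    (by filter_upwards [hγ, hne] with t h1 h2 using h1.inv h2)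
    (by
      filter_upwards [hw, hne] with t h1 h2
      refine h1.congr_deriv ?_
      rw [hV _ h2, inv_pow]
      field_simp
      ring)
    hc
    (by
      filter_upwards [hre] with t h1
      rw [hf0, norm_inv, inv_pow, div_inv_eq_mul, inv_pow, div_inv_eq_mul]
      exact h1)
  obtain ⟨C₂, hC₂⟩ := (hfa.continuousAt.tendsto.comp hu0).norm.isBoundedUnder_le
  refine ⟨max C C₂, c', hc', ?_⟩
  filter_upwards [hC, hC₂, hne] with t h1 h2 h3
  constructor
  · refine h1.trans ?_
    rw [norm_inv, inv_pow, div_inv_eq_mul]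
    gcongr
    exact le_max_left _ _
  · rw [hV _ h3, norm_mul, norm_neg, norm_pow]
    gcongr
    exact le_trans h2 (le_max_right _ _)

/-- The analytic factor of `V' = (A + B') / B` at a zero `b` of `B`, in the coordinate `z - b`. -/
def localFactor (A B : ℂ[X]) (b u : ℂ) : ℂ :=
  (A.eval (b + u) + (derivative B).eval (b + u)) /
    (B /ₘ (X - C b) ^ B.rootMultiplicity b).eval (b + u)

theorem potDeriv_eq_localFactor (A B : ℂ[X]) {b : ℂ} {r : ℕ} (hr : B.rootMultiplicity b = r)
    (z : ℂ) : potDeriv A B z = localFactor A B b (z - b) / (z - b) ^ r := by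
  subst hr
  have h := congrArg (eval z) (B.pow_mul_divByMonic_rootMultiplicity_eq b)
  rw [eval_mul, eval_pow, eval_sub, eval_X, eval_C] at h
  rw [potDeriv, localFactor, add_sub_cancel, div_div, ← h, mul_comm]

theorem analyticAt_localFactor (A : ℂ[X]) {B : ℂ[X]} (hB : B ≠ 0) (b : ℂ) :
    AnalyticAt ℂ (localFactor A B b) 0 := by
  have h : AnalyticAt ℂ (fun u : ℂ => b + u) 0 := by fun_prop
  have hp : ∀ p : ℂ[X], AnalyticAt ℂ (fun u => p.eval (b + u)) 0 := fun p =>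
    (analyticAt_eval p (b + 0)).fun_comp h
  refine ((hp _).add (hp _)).div (hp _) ?_
  rw [add_zero]
  exact eval_divByMonic_pow_rootMultiplicity_ne_zero b hB

/-- At a simple zero `B / (X - b)` takes the value `B'(b)`, so the residue of `V'` is `-k` and
`IsEnd.exists_le_pow` applies. -/
theorem EndAtRegular.exists_bound {A B : ℂ[X]} (hB : B ≠ 0) {γ w : ℝ → ℂ} {l : Filter ℝ}
    (hl : IsEnd l) (h : EndAtRegular A B γ l) (hne : ∀ᶠ t in l, B.eval (γ t) ≠ 0)
    (hγ : ∀ᶠ t in l, HasDerivAt γ (deriv γ t) t)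
    (hw : ∀ᶠ t in l, HasDerivAt w (-(potDeriv A B (γ t)) * deriv γ t * w t) t) :
    ∃ (b : ℂ) (C : ℝ), B.IsRoot b ∧ Tendsto γ l (𝓝 b) ∧
      ∀ᶠ t in l, ‖w t‖ ≤ C ∧ ‖potDeriv A B (γ t) * w t‖ ≤ C := by
  obtain ⟨b, hb, hlim, k, hk⟩ := h
  have hroot : B.IsRoot b := (rootMultiplicity_pos hB).mp (by omega)
  refine ⟨b, ?_⟩
  have hB0 : (B /ₘ (X - C b) ^ B.rootMultiplicity b).eval b = (derivative B).eval b := by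
    have h1 := B.pow_mul_divByMonic_rootMultiplicity_eq b
    rw [hb, pow_one] at *
    conv_rhs => rw [← h1]
    simp
  have hd : (derivative B).eval b ≠ 0 := hB0 ▸ eval_divByMonic_pow_rootMultiplicity_ne_zero b hB
  obtain ⟨C, hC⟩ := hl.exists_le_pow (analyticAt_localFactor A hB b) (k := k) (u := fun t => γ t - b)
    (u' := fun t => deriv γ t) (w := w)
    (by simp only [localFactor, add_zero]; rw [hB0, hk]; field_simp)
    (by simpa using hlim.sub_const b)
    (by
      filter_upwards [hne] with t ht h0
      rw [sub_eq_zero.mp h0] at ht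
      exact ht hroot)
    (hγ.mono fun t ht => ht.sub_const b)
    (hw.mono fun t ht => by rwa [potDeriv_eq_localFactor A B hb, pow_one] at ht)
  refine ⟨C, hroot, hlim, hC.mono fun t ht => ⟨ht.1, ?_⟩⟩
  have h2 := ht.2
  rwa [potDeriv_eq_localFactor A B hb, pow_one]

/-- At a multiple zero `B'(b) = 0`, so the leading coefficient of `V'` is the one in the sector
condition. The resulting exponential decay beats the pole of `V'`. -/
theorem EndAtEssential.exists_bound {A B : ℂ[X]} (hB : B ≠ 0) {γ w : ℝ → ℂ} {l : Filter ℝ}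
    (hl : IsEnd l) (h : EndAtEssential A B γ l) (hne : ∀ᶠ t in l, B.eval (γ t) ≠ 0)
    (hγ : ∀ᶠ t in l, HasDerivAt γ (deriv γ t) t)
    (hw : ∀ᶠ t in l, HasDerivAt w (-(potDeriv A B (γ t)) * deriv γ t * w t) t) :
    ∃ (b : ℂ) (C : ℝ), B.IsRoot b ∧ Tendsto γ l (𝓝 b) ∧
      ∀ᶠ t in l, ‖w t‖ ≤ C ∧ ‖potDeriv A B (γ t) * w t‖ ≤ C := by
  obtain ⟨b, hb, hlim, c, hc, hre⟩ := h
  have hroot : B.IsRoot b := (rootMultiplicity_pos hB).mp (by omega)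
  obtain ⟨m, hm⟩ : ∃ m, B.rootMultiplicity b = m + 1 := ⟨B.rootMultiplicity b - 1, by omega⟩
  have hd : (derivative B).eval b = 0 :=
    ((one_lt_rootMultiplicity_iff_isRoot hB (t := b)).mp (by omega)).2
  have hfa := analyticAt_localFactor A hB b
  have hu0 : Tendsto (fun t => γ t - b) l (𝓝 0) := by simpa using hlim.sub_const b
  have hne' : ∀ᶠ t in l, γ t - b ≠ 0 := by
    filter_upwards [hne] with t ht h0
    rw [sub_eq_zero.mp h0] at ht
    exact ht hroot
  obtain ⟨C, c', hc', hC⟩ := hl.exists_le_exp hfa (m := m) (by omega) hu0 hne'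
    (u' := fun t => deriv γ t) (w := w) (hγ.mono fun t ht => ht.sub_const b)
    (hw.mono fun t ht => by rwa [potDeriv_eq_localFactor A B hm] at ht) hc
    (by
      filter_upwards [hre] with t ht
      rw [hm, Nat.add_sub_cancel, ← hm] at ht
      rwa [localFactor, add_zero, hd, add_zero, ← neg_div])
  obtain ⟨C₂, hC₂⟩ := (hfa.continuousAt.tendsto.comp hu0).norm.isBoundedUnder_le
  refine ⟨b, max C (C₂ * (C * (2 / c' ^ 2))), hroot, hlim, ?_⟩
  filter_upwards [hC, hC₂, hne', hu0.eventually (Metric.ball_mem_nhds _ one_pos)] with t h1 h2 h3 h4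
  have hpos : 0 < ‖γ t - b‖ := norm_pos_iff.mpr h3
  have hC0 : 0 ≤ C := by
    by_contra hneg
    have := (norm_nonneg (w t)).trans h1
    nlinarith [Real.exp_pos (-(c' / ‖γ t - b‖ ^ m))]
  constructor
  · refine (h1.trans ?_).trans (le_max_left _ _)
    refine mul_le_of_le_one_right hC0 (Real.exp_le_one_iff.mpr ?_)
    rw [neg_nonpos]
    positivity
  · refine le_max_of_le_right ?_
    rw [potDeriv_eq_localFactor A B hm, norm_mul, norm_div, norm_pow, div_mul_eq_mul_div, mul_div_assoc]
    have hC₂0 : 0 ≤ C₂ := (norm_nonneg _).trans h2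
    refine mul_le_mul h2 ?_ (by positivity) hC₂0
    rw [div_le_iff₀ (by positivity)]
    refine h1.trans ?_
    rw [mul_assoc]
    gcongr
    have hle1 : ‖γ t - b‖ ≤ 1 := by
      have := mem_ball_zero_iff.mp h4
      exact this.le
    -- The factor `2 / c' ^ 2` comes from `y ^ 2 / 2 ≤ exp y` at `y = c' / ‖u‖ ^ m`; then `‖u‖ ^ (2
    -- m) ≤ ‖u‖ ^ (m + 1)` because `‖u‖ ≤ 1` and `m ≥ 1`.
    have hq := Real.quadratic_le_exp_of_nonneg (show 0 ≤ c' / ‖γ t - b‖ ^ m by positivity)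
    rw [Real.exp_neg]
    have hE := Real.exp_pos (c' / ‖γ t - b‖ ^ m)
    rw [inv_le_iff_one_le_mul₀ hE]
    have hy : 0 ≤ c' / ‖γ t - b‖ ^ m := by positivity
    have h5 : (c' / ‖γ t - b‖ ^ m) ^ 2 / 2 ≤ Real.exp (c' / ‖γ t - b‖ ^ m) := by linarith
    calc (1 : ℝ) ≤ ‖γ t - b‖ ^ (m + 1) / ‖γ t - b‖ ^ (m + m) := by
          rw [one_le_div (by positivity)]
          exact pow_le_pow_of_le_one hpos.le hle1 (by omega)
      _ = 2 / c' ^ 2 * ‖γ t - b‖ ^ (m + 1) * ((c' / ‖γ t - b‖ ^ m) ^ 2 / 2) := by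
          field_simp
          ring
      _ ≤ _ := by gcongr

/-! ### Uniform bounds for the weight along a whole contour. -/

namespace Contour

variable {A B : ℂ[X]}

theorem hasDerivAt (Γ : Contour A B) {t : ℝ} (ht : t ∈ Ioo (0 : ℝ) 1) :
    HasDerivAt Γ.γ (deriv Γ.γ t) t :=
  ((Γ.smooth.differentiableOn one_ne_zero).differentiableAt (isOpen_Ioo.mem_nhds ht)).hasDerivAt

theorem continuousOn_γ (Γ : Contour A B) : ContinuousOn Γ.γ (Ioo 0 1) := Γ.smooth.continuousOn

theorem continuousOn_deriv (Γ : Contour A B) : ContinuousOn (deriv Γ.γ) (Ioo 0 1) :=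
  Γ.smooth.continuousOn_deriv_of_isOpen isOpen_Ioo le_rfl

theorem continuousOn_w (Γ : Contour A B) : ContinuousOn Γ.w (Ioo 0 1) := fun t ht =>
  (Γ.w_deriv t ht).continuousAt.continuousWithinAt

theorem continuousOn_potDeriv (Γ : Contour A B) :
    ContinuousOn (fun t => potDeriv A B (Γ.γ t)) (Ioo 0 1) := by
  have hp : ∀ p : ℂ[X], ContinuousOn (fun t => p.eval (Γ.γ t)) (Ioo 0 1) := fun p =>
    p.continuous.comp_continuousOn Γ.continuousOn_γ
  exact ((hp _).add (hp _)).div (hp _) Γ.avoids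

theorem isEnd_eventually {l : Filter ℝ} (hl : l = 𝓝[>] 0 ∨ l = 𝓝[<] 1) :
    IsEnd l ∧ l.NeBot ∧ ∀ᶠ t in l, t ∈ Ioo (0 : ℝ) 1 := by
  rcases hl with rfl | rfl
  · exact ⟨isEnd_nhdsGT 0, inferInstance, Ioo_mem_nhdsGT one_pos⟩
  · exact ⟨isEnd_nhdsLT 1, inferInstance, Ioo_mem_nhdsLT one_pos⟩

/-- An admissible end is either at a zero of `B`, with `exp (-V)` and `V' exp (-V)` bounded, or at
infinity, with exponential decay. -/
theorem exists_bound_of_admissibleEnd (Γ : Contour A B) (hB : B ≠ 0)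
    (hdeg : B.natDegree + 1 ≤ A.natDegree) {l : Filter ℝ} (hl : l = 𝓝[>] 0 ∨ l = 𝓝[<] 1)
    (h : AdmissibleEnd A B Γ.γ l) :
    (∃ (b : ℂ) (C : ℝ), B.IsRoot b ∧ Tendsto Γ.γ l (𝓝 b) ∧
      ∀ᶠ t in l, ‖Γ.w t‖ ≤ C ∧ ‖potDeriv A B (Γ.γ t) * Γ.w t‖ ≤ C) ∨
    (Tendsto (fun t => ‖Γ.γ t‖) l atTop ∧ ∃ C c : ℝ, 0 < c ∧ ∀ᶠ t in l,
      ‖Γ.w t‖ ≤ C * Real.exp (-(c * ‖Γ.γ t‖ ^ (A.natDegree - B.natDegree + 1))) ∧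
      ‖potDeriv A B (Γ.γ t)‖ ≤ C * ‖Γ.γ t‖ ^ (A.natDegree - B.natDegree)) := by
  obtain ⟨hend, -, hev⟩ := isEnd_eventually hl
  have h1 := hev.mono fun t ht => Γ.avoids t ht
  have h2 := hev.mono fun t ht => Γ.hasDerivAt ht
  have h3 := hev.mono fun t ht => Γ.w_deriv t ht
  rcases h with h | h | h
  · exact Or.inr ⟨h.1, h.exists_bound hB hdeg hend h2 h3⟩
  · exact Or.inl (h.exists_bound hB hend h1 h2 h3)
  · exact Or.inl (h.exists_bound hB hend h1 h2 h3)

/-- The estimate, with constant `C`, of `exp (-V)` and of `V' exp (-V)` at a point of a contour. -/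
def BoundAt (Γ : Contour A B) (C : ℝ) (t : ℝ) : Prop :=
  0 < C ∧ ‖Γ.w t‖ ≤ C * Real.exp (-(‖Γ.γ t‖ ^ (A.natDegree - B.natDegree + 1) / C)) ∧
    (‖potDeriv A B (Γ.γ t)‖ ≤ C * ‖Γ.γ t‖ ^ (A.natDegree - B.natDegree) ∨
      ‖Γ.γ t‖ ≤ C ∧ ‖potDeriv A B (Γ.γ t) * Γ.w t‖ ≤ C)

theorem BoundAt.mono {Γ : Contour A B} {C C' t : ℝ} (h : Γ.BoundAt C t) (hC : C ≤ C') :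
    Γ.BoundAt C' t := by
  obtain ⟨h0, h1, h2⟩ := h
  have h0' := h0.le.trans hC
  refine ⟨h0.trans_le hC, h1.trans ?_, h2.imp (fun h => h.trans (by gcongr))
    fun h => ⟨h.1.trans hC, h.2.trans hC⟩⟩
  gcongr

/-- On a bounded piece the decay factor of `BoundAt` carries no information; the factor `exp (R ^
k)` in the constant compensates for it. -/
theorem boundAt_of_bounded (Γ : Contour A B) {R : ℝ} (hR : 1 ≤ R) {t : ℝ} (h1 : ‖Γ.γ t‖ ≤ R)
    (h2 : ‖Γ.w t‖ ≤ R) (h3 : ‖potDeriv A B (Γ.γ t) * Γ.w t‖ ≤ R) :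
    Γ.BoundAt (R * Real.exp (R ^ (A.natDegree - B.natDegree + 1))) t := by
  have hR0 : 0 < R := by linarith
  have hge : R ≤ R * Real.exp (R ^ (A.natDegree - B.natDegree + 1)) :=
    le_mul_of_one_le_right hR0.le (Real.one_le_exp (by positivity))
  refine ⟨by positivity, ?_, Or.inr ⟨h1.trans hge, h3.trans hge⟩⟩
  rw [mul_assoc, ← Real.exp_add]
  refine h2.trans (le_mul_of_one_le_right hR0.le (Real.one_le_exp ?_))
  have h4 : ‖Γ.γ t‖ ^ (A.natDegree - B.natDegree + 1) /
      (R * Real.exp (R ^ (A.natDegree - B.natDegree + 1))) ≤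
        ‖Γ.γ t‖ ^ (A.natDegree - B.natDegree + 1) :=
    div_le_self (by positivity) (hR.trans hge)
  have h5 : ‖Γ.γ t‖ ^ (A.natDegree - B.natDegree + 1) ≤ R ^ (A.natDegree - B.natDegree + 1) := by
    gcongr
  linarith

theorem exists_boundAt_of_tendsto (Γ : Contour A B) {l : Filter ℝ} {b : ℂ} {C : ℝ}
    (hb : Tendsto Γ.γ l (𝓝 b))
    (hC : ∀ᶠ t in l, ‖Γ.w t‖ ≤ C ∧ ‖potDeriv A B (Γ.γ t) * Γ.w t‖ ≤ C) :
    ∃ C, ∀ᶠ t in l, Γ.BoundAt C t := by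
  obtain ⟨C₂, hC₂⟩ := hb.norm.isBoundedUnder_le
  set R := max 1 (max C C₂) with hR
  refine ⟨R * Real.exp (R ^ (A.natDegree - B.natDegree + 1)), ?_⟩
  filter_upwards [hC, hC₂] with t h1 h2
  exact Γ.boundAt_of_bounded (R := R) (le_max_left _ _)
    (le_trans h2 (by simp [hR])) (le_trans h1.1 (by simp [hR])) (le_trans h1.2 (by simp [hR]))

theorem exists_boundAt_of_admissibleEnd (Γ : Contour A B) (hB : B ≠ 0)
    (hdeg : B.natDegree + 1 ≤ A.natDegree) {l : Filter ℝ} (hl : l = 𝓝[>] 0 ∨ l = 𝓝[<] 1)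
    (h : AdmissibleEnd A B Γ.γ l) : ∃ C, ∀ᶠ t in l, Γ.BoundAt C t := by
  rcases Γ.exists_bound_of_admissibleEnd hB hdeg hl h with ⟨b, C, -, hb, hC⟩ | ⟨-, C, c, hc, hC⟩
  · exact Γ.exists_boundAt_of_tendsto hb hC
  · refine ⟨max 1 (max C (1 / c)), ?_⟩
    filter_upwards [hC] with t ht
    have hpos : 0 < max 1 (max C (1 / c)) := lt_of_lt_of_le one_pos (le_max_left _ _)
    refine ⟨hpos, ht.1.trans ?_, Or.inl (ht.2.trans ?_)⟩
    · have h2 : ‖Γ.γ t‖ ^ (A.natDegree - B.natDegree + 1) / max 1 (max C (1 / c)) ≤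
          c * ‖Γ.γ t‖ ^ (A.natDegree - B.natDegree + 1) := by
        rw [div_le_iff₀ hpos]
        have h3 : 1 ≤ c * max 1 (max C (1 / c)) := by
          calc (1 : ℝ) = c * (1 / c) := by field_simp
            _ ≤ _ := by gcongr; simp
        nlinarith [show 0 ≤ ‖Γ.γ t‖ ^ (A.natDegree - B.natDegree + 1) by positivity]
      gcongr
      simp
    · gcongr
      simp

theorem exists_boundAt (Γ : Contour A B) (hB : B ≠ 0) (hdeg : B.natDegree + 1 ≤ A.natDegree) :
    ∃ C, ∀ t ∈ Ioo (0 : ℝ) 1, Γ.BoundAt C t := by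
  have hends : (∃ C, ∀ᶠ t in 𝓝[>] 0, Γ.BoundAt C t) ∧ ∃ C, ∀ᶠ t in 𝓝[<] 1, Γ.BoundAt C t := by
    rcases Γ.ends with ⟨h0, h1⟩ | ⟨z, w₀, hz, hγ0, hγ1, hw0, hw1⟩
    · exact ⟨Γ.exists_boundAt_of_admissibleEnd hB hdeg (Or.inl rfl) h0,
        Γ.exists_boundAt_of_admissibleEnd hB hdeg (Or.inr rfl) h1⟩
    · have key : ∀ l : Filter ℝ, Tendsto Γ.γ l (𝓝 z) → Tendsto Γ.w l (𝓝 w₀) →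
          ∃ C, ∀ᶠ t in l, Γ.BoundAt C t := by
        intro l hγ hw
        have hp : ∀ p : ℂ[X], Tendsto (fun t => p.eval (Γ.γ t)) l (𝓝 (p.eval z)) := fun p =>
          (p.continuous.tendsto z).comp hγ
        obtain ⟨C₁, hC₁⟩ := hw.norm.isBoundedUnder_le
        obtain ⟨C₂, hC₂⟩ := (((((hp A).add (hp (derivative B))).div (hp B) hz)).mul
          hw).norm.isBoundedUnder_le
        refine Γ.exists_boundAt_of_tendsto (C := max C₁ C₂) hγ ?_
        filter_upwards [hC₁, hC₂] with t h1 h2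
        exact ⟨le_trans h1 (le_max_left _ _), le_trans h2 (le_max_right _ _)⟩
      exact ⟨key _ hγ0 hw0, key _ hγ1 hw1⟩
  obtain ⟨⟨C₀, h0⟩, C₁, h1⟩ := hends
  obtain ⟨a, ha, ha'⟩ := (mem_nhdsGT_iff_exists_Ioo_subset).mp h0
  obtain ⟨b, hb, hb'⟩ := (mem_nhdsLT_iff_exists_Ioo_subset).mp h1
  -- The truncations keep this interval compact in `(0, 1)` even if `a > 1` or `b < 0`, and it
  -- contains every `t` with `a ≤ t ≤ b`.
  have hsub : Icc (min a 1 / 2) (max b ((1 + 0) / 2)) ⊆ Ioo (0 : ℝ) 1 := by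
    intro t ht
    have ha0 : (0 : ℝ) < a := ha
    have hb1 : b < 1 := hb
    have h3 : 0 < min a 1 / 2 := by have := lt_min ha0 one_pos; linarith
    have h4 : max b ((1 + 0) / 2) < 1 := max_lt hb1 (by norm_num)
    exact ⟨h3.trans_le ht.1, ht.2.trans_lt h4⟩
  have hcpt := isCompact_Icc (a := min a 1 / 2) (b := max b ((1 + 0) / 2))
  obtain ⟨K₁, hK₁⟩ := hcpt.exists_bound_of_continuousOn (Γ.continuousOn_γ.mono hsub)
  obtain ⟨K₂, hK₂⟩ := hcpt.exists_bound_of_continuousOn (Γ.continuousOn_w.mono hsub)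
  obtain ⟨K₃, hK₃⟩ := hcpt.exists_bound_of_continuousOn
    ((Γ.continuousOn_potDeriv.mul Γ.continuousOn_w).mono hsub)
  set R := max 1 (max K₁ (max K₂ K₃)) with hR
  refine ⟨max C₀ (max C₁ (R * Real.exp (R ^ (A.natDegree - B.natDegree + 1)))), fun t ht => ?_⟩
  by_cases hta : t < a
  · have := ha' ⟨ht.1, hta⟩
    exact BoundAt.mono this (le_max_left _ _)
  by_cases htb : b < t
  · have := hb' ⟨htb, ht.2⟩
    exact BoundAt.mono this (by simp)
  have htm : t ∈ Icc (min a 1 / 2) (max b ((1 + 0) / 2)) := by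
    refine ⟨?_, le_max_of_le_left (not_lt.mp htb)⟩
    have := min_le_left a 1
    have h5 : 0 < min a 1 := lt_min ha one_pos
    linarith [not_lt.mp hta]
  exact (Γ.boundAt_of_bounded (R := R) (le_max_left _ _) ((hK₁ t htm).trans (by simp [hR]))
    ((hK₂ t htm).trans (by simp [hR])) ((hK₃ t htm).trans (by simp [hR]))).mono (by simp)

end Contour

/-! ### Elementary growth inequalities. -/

theorem exists_eval_le_exp (p : ℂ[X]) : ∃ K : ℝ, 0 ≤ K ∧ ∀ z : ℂ, ‖p.eval z‖ ≤ K * Real.exp ‖z‖ := by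
  induction p using Polynomial.induction_on' with
  | add p q hp hq =>
    obtain ⟨K, hK, hp⟩ := hp
    obtain ⟨L, hL, hq⟩ := hq
    refine ⟨K + L, by positivity, fun z => ?_⟩
    rw [eval_add, add_mul]
    exact (norm_add_le _ _).trans (add_le_add (hp z) (hq z))
  | monomial n a =>
    refine ⟨‖a‖ * n.factorial, by positivity, fun z => ?_⟩
    have h := Real.pow_div_factorial_le_exp ‖z‖ (norm_nonneg z) n
    rw [div_le_iff₀ (by positivity)] at h
    rw [eval_monomial, norm_mul, norm_pow, mul_assoc]
    gcongr
    linarith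

theorem exists_eval_le_pow (p : ℂ[X]) :
    ∃ (K : ℝ) (N : ℕ), 0 ≤ K ∧ ∀ z : ℂ, ‖p.eval z‖ ≤ K * (1 + ‖z‖) ^ N := by
  induction p using Polynomial.induction_on' with
  | add p q hp hq =>
    obtain ⟨K, N, hK, hp⟩ := hp
    obtain ⟨L, M, hL, hq⟩ := hq
    refine ⟨K + L, max N M, by positivity, fun z => ?_⟩
    rw [eval_add, add_mul]
    have h1 : 1 ≤ 1 + ‖z‖ := by linarith [norm_nonneg z]
    refine (norm_add_le _ _).trans (add_le_add ((hp z).trans ?_) ((hq z).trans ?_)) <;>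
      gcongr <;> simp
  | monomial n a =>
    refine ⟨‖a‖, n, by positivity, fun z => ?_⟩
    rw [eval_monomial, norm_mul, norm_pow]
    gcongr
    linarith

theorem sq_le_pow_add_one {r : ℝ} (hr : 0 ≤ r) {j k : ℕ} (hk : j ≤ k) : r ^ j ≤ r ^ k + 1 := by
  rcases le_total 1 r with h | h
  · have := pow_le_pow_right₀ h hk
    linarith
  · have := pow_le_one₀ hr h (n := j)
    have := pow_nonneg hr k
    linarith

/-- The power costs `N! * exp (1 + r)`, `r ^ k` is at least `r ^ 2 - 1`, and `(a + 1) * r - c * r ^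
2` is maximised by completing the square. -/
theorem exists_pow_mul_exp_le (N : ℕ) (a : ℝ) {c : ℝ} (hc : 0 < c) {k : ℕ} (hk : 2 ≤ k) :
    ∃ C : ℝ, ∀ r : ℝ, 0 ≤ r → (1 + r) ^ N * Real.exp (a * r - c * r ^ k) ≤ C := by
  refine ⟨N.factorial * Real.exp (1 + c + (a + 1) ^ 2 / (4 * c)), fun r hr => ?_⟩
  have h := Real.pow_div_factorial_le_exp (1 + r) (by linarith) N
  rw [div_le_iff₀ (by positivity)] at h
  calc (1 + r) ^ N * Real.exp (a * r - c * r ^ k)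
      ≤ (Real.exp (1 + r) * N.factorial) * Real.exp (a * r - c * r ^ k) := by gcongr
    _ = N.factorial * Real.exp (1 + r + (a * r - c * r ^ k)) := by rw [Real.exp_add (1 + r)]; ring
    _ ≤ _ := by
      refine mul_le_mul_of_nonneg_left (Real.exp_le_exp.mpr ?_) (by positivity)
      have h1 := sq_le_pow_add_one hr hk
      have h2 : (a + 1) * r - c * r ^ 2 ≤ (a + 1) ^ 2 / (4 * c) := by
        rw [le_div_iff₀ (by positivity)]
        nlinarith [sq_nonneg (2 * c * r - (a + 1))]
      have h3 := mul_le_mul_of_nonneg_left h1 hc.le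
      linarith

theorem exists_sq_sub_pow_le {a c : ℝ} (hc : 0 < c) {k : ℕ} (hk : 3 ≤ k) :
    ∃ C : ℝ, ∀ r : ℝ, 0 ≤ r → a * r ^ 2 - c * r ^ k ≤ C := by
  refine ⟨c + |a| * (|a| / c) ^ 2, fun r hr => ?_⟩
  have h1 := sq_le_pow_add_one hr hk
  have h2 : a * r ^ 2 - c * r ^ 3 ≤ |a| * (|a| / c) ^ 2 := by
    have h3 : a * r ^ 2 ≤ |a| * r ^ 2 := by gcongr; exact le_abs_self a
    rcases le_total r (|a| / c) with h | h
    · have : |a| * r ^ 2 ≤ |a| * (|a| / c) ^ 2 := by gcongr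
      have : 0 ≤ c * r ^ 3 := by positivity
      linarith
    · rw [div_le_iff₀ hc] at h
      have : 0 ≤ |a| * (|a| / c) ^ 2 := by positivity
      nlinarith [sq_nonneg r]
  nlinarith

/-- If one of the two exponents is larger than `2`, the product of the two decay rates dominates
the exponential coupling. -/
theorem exists_exp_mul_le {c₁ c₂ : ℝ} (h₁ : 0 < c₁) (h₂ : 0 < c₂) {k₁ k₂ : ℕ} (hk₁ : 2 ≤ k₁)
    (hk₂ : 2 ≤ k₂) (h : 3 ≤ k₁ ∨ 3 ≤ k₂) :
    ∃ C c : ℝ, 0 < c ∧ ∀ r s : ℝ, 0 ≤ r → 0 ≤ s →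
      r * s - c₁ * r ^ k₁ - c₂ * s ^ k₂ ≤ C - c * r ^ 2 - c * s ^ 2 := by
  have key : ∀ {c₁ c₂ : ℝ}, 0 < c₁ → 0 < c₂ → ∀ {k₁ k₂ : ℕ}, 3 ≤ k₁ → 2 ≤ k₂ →
      ∃ C c : ℝ, 0 < c ∧ ∀ r s : ℝ, 0 ≤ r → 0 ≤ s →
        r * s - c₁ * r ^ k₁ - c₂ * s ^ k₂ ≤ C - c * r ^ 2 - c * s ^ 2 := by
    intro c₁ c₂ h₁ h₂ k₁ k₂ hk₁ hk₂
    -- By Young's inequality `r s ≤ r ^ 2 / (2 c₂) + c₂ s ^ 2 / 2`. Half of the quadratic decay in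
    -- `s` survives, and the power `k₁ ≥ 3` absorbs `r ^ 2 / (2 c₂)` with `c₂ / 2 * r ^ 2` to spare.
    obtain ⟨C, hC⟩ := exists_sq_sub_pow_le (a := 1 / (2 * c₂) + c₂ / 2) h₁ hk₁
    refine ⟨C + c₂, c₂ / 2, by positivity, fun r s hr hs => ?_⟩
    have h1 := hC r hr
    have h2 := sq_le_pow_add_one hs hk₂
    have h3 : r * s ≤ 1 / (2 * c₂) * r ^ 2 + c₂ / 2 * s ^ 2 := by
      have : 1 / (2 * c₂) * r ^ 2 + c₂ / 2 * s ^ 2 - r * s = (r - c₂ * s) ^ 2 / (2 * c₂) := by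
        field_simp; ring
      have : 0 ≤ (r - c₂ * s) ^ 2 / (2 * c₂) := by positivity
      linarith
    nlinarith
  rcases h with h | h
  · exact key h₁ h₂ h hk₂
  · obtain ⟨C, c, hc, H⟩ := key h₂ h₁ h hk₁
    exact ⟨C, c, hc, fun r s hr hs => by have := H s r hs hr; linarith⟩

/-! ### Calculus on the parameter interval. -/

/-- The fundamental theorem of calculus on `(0, 1)`: when the derivative is integrable, the boundary
limits exist. -/
theorem integral_deriv_eq_limUnder_sub {H H' : ℝ → ℂ}
    (hd : ∀ t ∈ Ioo (0 : ℝ) 1, HasDerivAt H (H' t) t) (hi : IntegrableOn H' (Ioo 0 1)) :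
    ∫ t in Ioo (0 : ℝ) 1, H' t = limUnder (𝓝[<] (1 : ℝ)) H - limUnder (𝓝[>] (0 : ℝ)) H := by
  have hii : IntervalIntegrable H' volume 0 1 :=
    (intervalIntegrable_iff_integrableOn_Ioo_of_le zero_le_one).mpr hi
  have hcont := intervalIntegral.continuousOn_primitive_interval' hii
    (show (1 / 2 : ℝ) ∈ uIcc 0 1 by rw [uIcc_of_le zero_le_one]; constructor <;> norm_num)
  rw [uIcc_of_le zero_le_one] at hcont
  -- The values of `H` at `0` and `1` are arbitrary, so the primitive is based at the interior point
  -- `1 / 2`.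
  have hH : ∀ t ∈ Ioo (0 : ℝ) 1, H t = H (1 / 2) + ∫ s in (1 / 2)..t, H' s := by
    intro t ht
    have hsub : uIcc (1 / 2) t ⊆ Ioo (0 : ℝ) 1 :=
      ordConnected_Ioo.uIcc_subset (show (1 / 2 : ℝ) ∈ Ioo (0 : ℝ) 1 by constructor <;> norm_num) ht
    rw [intervalIntegral.integral_eq_sub_of_hasDerivAt (fun s hs => hd s (hsub hs))
      (hii.mono_set (hsub.trans (by rw [uIcc_of_le zero_le_one]; exact Ioo_subset_Icc_self)))]
    ring
  have hlim : ∀ {l : Filter ℝ} {a : ℝ}, a ∈ Icc (0 : ℝ) 1 → l ≤ 𝓝 a → (∀ᶠ t in l, t ∈ Ioo (0 : ℝ) 1) →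
      Tendsto H l (𝓝 (H (1 / 2) + ∫ s in (1 / 2)..a, H' s)) := by
    intro l a ha hl hev
    have h1 : Tendsto (fun t => ∫ s in (1 / 2)..t, H' s) l (𝓝 (∫ s in (1 / 2)..a, H' s)) :=
      (hcont a ha).mono_left
        (le_inf hl (le_principal_iff.mpr (hev.mono fun t ht => Ioo_subset_Icc_self ht)))
    exact (h1.const_add _).congr' (hev.mono fun t ht => (hH t ht).symm)
  have h0 := hlim (left_mem_Icc.mpr zero_le_one) nhdsWithin_le_nhds
    (Ioo_mem_nhdsGT (one_pos : (0 : ℝ) < 1))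
  have h1 := hlim (right_mem_Icc.mpr zero_le_one) nhdsWithin_le_nhds
    (Ioo_mem_nhdsLT (one_pos : (0 : ℝ) < 1))
  rw [h0.limUnder_eq, h1.limUnder_eq, ← integral_Ioc_eq_integral_Ioo,
    ← intervalIntegral.integral_of_le zero_le_one]
  exact intervalIntegral.integral_eq_sub_of_hasDerivAt_of_tendsto one_pos hd hii h0 h1

/-- Differentiation under the integral sign on `(0, 1)`. -/
theorem hasDerivAt_integral_Ioo {F F' : ℂ → ℝ → ℂ} {bound : ℝ → ℝ} {ξ : ℂ} {s : Set ℂ}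
    (hs : s ∈ 𝓝 ξ)
    (hF : ∀ ζ ∈ s, IntegrableOn (F ζ) (Ioo 0 1))
    (hF' : AEStronglyMeasurable (F' ξ) (volume.restrict (Ioo 0 1)))
    (hb : ∀ t ∈ Ioo (0 : ℝ) 1, ∀ ζ ∈ s, ‖F' ζ t‖ ≤ bound t)
    (hbi : IntegrableOn bound (Ioo 0 1))
    (hd : ∀ t ∈ Ioo (0 : ℝ) 1, ∀ ζ ∈ s, HasDerivAt (fun ζ => F ζ t) (F' ζ t) ζ) :
    HasDerivAt (fun ζ => ∫ t in Ioo (0 : ℝ) 1, F ζ t) (∫ t in Ioo (0 : ℝ) 1, F' ξ t) ξ :=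
  (hasDerivAt_integral_of_dominated_loc_of_deriv_le hs
    (eventually_of_mem hs fun ζ hζ => (hF ζ hζ).aestronglyMeasurable) (hF ξ (mem_of_mem_nhds hs)) hF'
    ((ae_restrict_mem measurableSet_Ioo).mono hb) hbi
    ((ae_restrict_mem measurableSet_Ioo).mono hd)).2

/-! ### Laplace transforms of polynomials along a contour. -/

namespace Contour

variable {A B : ℂ[X]}

/-- The field `tame` makes `‖γ'‖ / (1 + ‖γ‖) ^ N` integrable for some unknown `N`, so decay faster
than every power suffices. -/
theorem integrableOn_mul_deriv (Γ : Contour A B) {F : ℝ → ℂ} (hF : ContinuousOn F (Ioo 0 1))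
    (hb : ∀ N : ℕ, ∃ C, ∀ t ∈ Ioo (0 : ℝ) 1, (1 + ‖Γ.γ t‖) ^ N * ‖F t‖ ≤ C) :
    IntegrableOn (fun t => F t * deriv Γ.γ t) (Ioo 0 1) := by
  obtain ⟨N, hN⟩ := Γ.tame
  obtain ⟨C, hC⟩ := hb N
  refine (hN.const_mul C).mono'
    ((hF.mul Γ.continuousOn_deriv).aestronglyMeasurable measurableSet_Ioo) ?_
  filter_upwards [ae_restrict_mem measurableSet_Ioo] with t ht
  have hpos : 0 < (1 + ‖Γ.γ t‖) ^ N := by positivity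
  rw [norm_mul, mul_div_assoc', le_div_iff₀ hpos]
  calc ‖F t‖ * ‖deriv Γ.γ t‖ * (1 + ‖Γ.γ t‖) ^ N
      = ((1 + ‖Γ.γ t‖) ^ N * ‖F t‖) * ‖deriv Γ.γ t‖ := by ring
    _ ≤ _ := by gcongr; exact hC t ht

/-- Functions of exponential type are integrable against the weight. -/
theorem integrableOn_of_le_exp (Γ : Contour A B) (hB : B ≠ 0)
    (hdeg : B.natDegree + 1 ≤ A.natDegree) {g : ℂ → ℂ} (hg : Continuous g) {K a : ℝ} (hK : 0 ≤ K)
    (hgb : ∀ z, ‖g z‖ ≤ K * Real.exp (a * ‖z‖)) :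
    IntegrableOn (fun t => g (Γ.γ t) * Γ.w t * deriv Γ.γ t) (Ioo 0 1) := by
  obtain ⟨C, hC⟩ := Γ.exists_boundAt hB hdeg
  refine Γ.integrableOn_mul_deriv ((hg.comp_continuousOn Γ.continuousOn_γ).mul Γ.continuousOn_w)
    fun N => ?_
  have hC0 : 0 < C := (hC (1 / 2) ⟨by norm_num, by norm_num⟩).1
  obtain ⟨D, hD⟩ := exists_pow_mul_exp_le N a (c := 1 / C) (by positivity)
    (k := A.natDegree - B.natDegree + 1) (by omega)
  refine ⟨K * C * D, fun t ht => ?_⟩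
  have h1 := (hC t ht).2.1
  have h2 := hD ‖Γ.γ t‖ (norm_nonneg _)
  calc (1 + ‖Γ.γ t‖) ^ N * ‖g (Γ.γ t) * Γ.w t‖
      ≤ (1 + ‖Γ.γ t‖) ^ N * ((K * Real.exp (a * ‖Γ.γ t‖)) *
        (C * Real.exp (-(‖Γ.γ t‖ ^ (A.natDegree - B.natDegree + 1) / C)))) := by
        rw [norm_mul]
        gcongr
        exact hgb _
    _ = K * C * ((1 + ‖Γ.γ t‖) ^ N * Real.exp (a * ‖Γ.γ t‖ -
        1 / C * ‖Γ.γ t‖ ^ (A.natDegree - B.natDegree + 1))) := by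
        rw [sub_eq_add_neg, Real.exp_add, one_div_mul_eq_div]
        ring
    _ ≤ _ := by gcongr

theorem norm_exp_mul_le (ξ z : ℂ) : ‖Complex.exp (ξ * z)‖ ≤ Real.exp (‖ξ‖ * ‖z‖) := by
  rw [Complex.norm_exp, ← norm_mul]
  exact Real.exp_le_exp.mpr (Complex.re_le_norm _)

theorem exists_eval_mul_exp_le (q : ℂ[X]) (ξ : ℂ) : ∃ K : ℝ, 0 ≤ K ∧
    ∀ z, ‖q.eval z * Complex.exp (ξ * z)‖ ≤ K * Real.exp ((1 + ‖ξ‖) * ‖z‖) := by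
  obtain ⟨K, hK, h⟩ := exists_eval_le_exp q
  refine ⟨K, hK, fun z => ?_⟩
  rw [norm_mul, add_mul, one_mul, Real.exp_add, ← mul_assoc]
  exact mul_le_mul (h z) (norm_exp_mul_le ξ z) (norm_nonneg _) (by positivity)

/-- The Fourier–Laplace transform `∫_Γ q(z) exp (ξ z - V(z)) dz` of a polynomial. -/
def laplace (Γ : Contour A B) (q : ℂ[X]) (ξ : ℂ) : ℂ :=
  Γ.integral fun z => q.eval z * Complex.exp (ξ * z)

theorem integrableOn_laplace (Γ : Contour A B) (hB : B ≠ 0)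
    (hdeg : B.natDegree + 1 ≤ A.natDegree) (q : ℂ[X]) (ξ : ℂ) :
    IntegrableOn (fun t => q.eval (Γ.γ t) * Complex.exp (ξ * Γ.γ t) * Γ.w t * deriv Γ.γ t)
      (Ioo 0 1) := by
  obtain ⟨K, hK, h⟩ := exists_eval_mul_exp_le q ξ
  exact Γ.integrableOn_of_le_exp hB hdeg (g := fun z => q.eval z * Complex.exp (ξ * z))
    (q.continuous.mul (by fun_prop)) hK h

theorem laplace_add (Γ : Contour A B) (hB : B ≠ 0) (hdeg : B.natDegree + 1 ≤ A.natDegree)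
    (p q : ℂ[X]) (ξ : ℂ) : Γ.laplace (p + q) ξ = Γ.laplace p ξ + Γ.laplace q ξ := by
  rw [laplace, laplace, laplace, integral, integral, integral,
    ← integral_add (Γ.integrableOn_laplace hB hdeg p ξ) (Γ.integrableOn_laplace hB hdeg q ξ)]
  congr 1
  ext t
  rw [eval_add]
  ring

theorem laplace_C_mul (Γ : Contour A B) (c : ℂ) (q : ℂ[X]) (ξ : ℂ) :
    Γ.laplace (C c * q) ξ = c * Γ.laplace q ξ := by
  rw [laplace, laplace, integral, integral, ← integral_const_mul]
  congr 1
  ext t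
  rw [eval_mul, eval_C]
  ring

/-- `laplace` as a linear functional. -/
def laplaceLM (Γ : Contour A B) (hB : B ≠ 0) (hdeg : B.natDegree + 1 ≤ A.natDegree) (ξ : ℂ) :
    ℂ[X] →ₗ[ℂ] ℂ where
  toFun q := Γ.laplace q ξ
  map_add' p q := Γ.laplace_add hB hdeg p q ξ
  map_smul' c q := by rw [smul_eq_C_mul, laplace_C_mul]; rfl

/-- For parameters in the unit ball around `ξ` the differentiated integrand is dominated by one
function of exponential type `2 + ‖ξ‖`, integrable against the weight. -/
theorem hasDerivAt_laplace (Γ : Contour A B) (hB : B ≠ 0) (hdeg : B.natDegree + 1 ≤ A.natDegree)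
    (q : ℂ[X]) (ξ : ℂ) : HasDerivAt (Γ.laplace q) (Γ.laplace (X * q) ξ) ξ := by
  obtain ⟨K, hK, hq⟩ := exists_eval_le_exp (X * q)
  have hint := (Γ.integrableOn_of_le_exp hB hdeg
    (g := fun z => ((K * Real.exp ((1 + (‖ξ‖ + 1)) * ‖z‖) : ℝ) : ℂ)) (by fun_prop) hK
    (a := 1 + (‖ξ‖ + 1)) (fun z => by
      rw [Complex.norm_real, Real.norm_of_nonneg (by positivity)])).norm
  have hcont : ∀ (p : ℂ[X]) (ζ : ℂ), AEStronglyMeasurable (fun t => p.eval (Γ.γ t) *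
      Complex.exp (ζ * Γ.γ t) * Γ.w t * deriv Γ.γ t) (volume.restrict (Ioo 0 1)) :=
    fun p ζ => (Γ.integrableOn_laplace hB hdeg p ζ).aestronglyMeasurable
  have hbound : ∀ t : ℝ, ∀ ζ ∈ Metric.ball ξ 1,
      ‖(X * q).eval (Γ.γ t) * Complex.exp (ζ * Γ.γ t) * Γ.w t * deriv Γ.γ t‖ ≤
        ‖((K * Real.exp ((1 + (‖ξ‖ + 1)) * ‖Γ.γ t‖) : ℝ) : ℂ) * Γ.w t * deriv Γ.γ t‖ := by
    intro t ζ hζ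
    rw [norm_mul _ (deriv Γ.γ t), norm_mul _ (Γ.w t), norm_mul _ (deriv Γ.γ t), norm_mul _ (Γ.w t),
      Complex.norm_real, Real.norm_of_nonneg (by positivity)]
    gcongr
    rw [norm_mul, add_mul, one_mul, Real.exp_add, ← mul_assoc]
    refine mul_le_mul (hq _) ((norm_exp_mul_le _ _).trans ?_) (norm_nonneg _) (by positivity)
    gcongr
    have h1 : ‖ζ - ξ‖ < 1 := by rwa [← dist_eq_norm]
    have h2 := norm_add_le (ζ - ξ) ξ
    rw [sub_add_cancel] at h2
    linarith
  have hdiff : ∀ t : ℝ, ∀ ζ ∈ Metric.ball ξ 1,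
      HasDerivAt (fun ζ => q.eval (Γ.γ t) * Complex.exp (ζ * Γ.γ t) * Γ.w t * deriv Γ.γ t)
        ((X * q).eval (Γ.γ t) * Complex.exp (ζ * Γ.γ t) * Γ.w t * deriv Γ.γ t) ζ := by
    intro t ζ _
    have h1 : HasDerivAt (fun ζ : ℂ => Complex.exp (ζ * Γ.γ t))
        (Complex.exp (ζ * Γ.γ t) * (1 * Γ.γ t)) ζ := ((hasDerivAt_id ζ).mul_const _).cexp
    refine (((h1.const_mul (q.eval (Γ.γ t))).mul_const (Γ.w t)).mul_const (deriv Γ.γ t)).congr_deriv ?_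
    rw [eval_mul, eval_X]
    ring
  exact hasDerivAt_integral_Ioo (Metric.ball_mem_nhds ξ one_pos)
    (fun ζ _ => Γ.integrableOn_laplace hB hdeg q ζ) (hcont _ ξ) (fun t _ => hbound t) hint
    (fun t _ => hdiff t)

theorem continuous_laplace (Γ : Contour A B) (hB : B ≠ 0) (hdeg : B.natDegree + 1 ≤ A.natDegree)
    (q : ℂ[X]) : Continuous (Γ.laplace q) :=
  continuous_iff_continuousAt.mpr fun ξ => (Γ.hasDerivAt_laplace hB hdeg q ξ).continuousAt

/-- At a finite end the weight is bounded and `B` vanishes, which also removes hard edges; at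
infinity the exponential decay wins. -/
theorem tendsto_zero_of_admissibleEnd (Γ : Contour A B) (hB : B ≠ 0)
    (hdeg : B.natDegree + 1 ≤ A.natDegree) {l : Filter ℝ} (hl : l = 𝓝[>] 0 ∨ l = 𝓝[<] 1)
    (h : AdmissibleEnd A B Γ.γ l) (q : ℂ[X]) (ξ : ℂ) :
    Tendsto (fun t => (B * q).eval (Γ.γ t) * Complex.exp (ξ * Γ.γ t) * Γ.w t) l (𝓝 0) := by
  rcases Γ.exists_bound_of_admissibleEnd hB hdeg hl h with
    ⟨b, C, hb, hlim, hC⟩ | ⟨hinf, C, c, hc, hC⟩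
  · have hg : Continuous fun z => (B * q).eval z * Complex.exp (ξ * z) :=
      (B * q).continuous.mul (by fun_prop)
    have h1 := (hg.tendsto b).comp hlim
    simp only [eval_mul, hb.eq_zero, zero_mul] at h1
    refine (h1.zero_mul_isBoundedUnder_le ⟨C, eventually_map.mpr (hC.mono fun t ht => ht.1)⟩).congr
      fun t => ?_
    simp
  · obtain ⟨K, hK, hg⟩ := exists_eval_mul_exp_le (B * q) ξ
    obtain ⟨D, hD⟩ := exists_pow_mul_exp_le 1 (1 + ‖ξ‖) hc
      (k := A.natDegree - B.natDegree + 1) (by omega)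
    have h1 : Tendsto (fun t => K * (|C| * D) * (1 + ‖Γ.γ t‖)⁻¹) l (𝓝 0) := by
      have := (tendsto_inv_atTop_zero.comp (tendsto_atTop_add_const_left _ 1 hinf)).const_mul
        (K * (|C| * D))
      simpa using this
    refine squeeze_zero_norm' ?_ h1
    filter_upwards [hC] with t ht
    rw [norm_mul, ← div_eq_mul_inv, le_div_iff₀ (by positivity)]
    calc ‖(B * q).eval (Γ.γ t) * Complex.exp (ξ * Γ.γ t)‖ * ‖Γ.w t‖ * (1 + ‖Γ.γ t‖)
        ≤ (K * Real.exp ((1 + ‖ξ‖) * ‖Γ.γ t‖)) *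
          (|C| * Real.exp (-(c * ‖Γ.γ t‖ ^ (A.natDegree - B.natDegree + 1)))) *
            (1 + ‖Γ.γ t‖) := by
          gcongr
          · exact hg _
          · refine ht.1.trans ?_
            gcongr
            exact le_abs_self C
      _ = K * (|C| * ((1 + ‖Γ.γ t‖) ^ 1 * Real.exp ((1 + ‖ξ‖) * ‖Γ.γ t‖ -
          c * ‖Γ.γ t‖ ^ (A.natDegree - B.natDegree + 1)))) := by
          rw [sub_eq_add_neg, Real.exp_add]
          ring
      _ ≤ _ := by
          rw [← mul_assoc K, ← mul_assoc K]
          gcongr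
          exact hD _ (norm_nonneg _)

/-- Integration by parts: the integral of the derivative of `B q exp (ξ z - V)` vanishes. -/
theorem laplace_integration_by_parts (Γ : Contour A B) (hB : B ≠ 0)
    (hdeg : B.natDegree + 1 ≤ A.natDegree) (q : ℂ[X]) (ξ : ℂ) :
    Γ.laplace (A * q - B * derivative q) ξ = ξ * Γ.laplace (B * q) ξ := by
  -- The factor `B` clears the denominator of `V'`, so the derivative of `B q exp (ξ z - V)` is this
  -- polynomial times the weight; the two `B'` terms cancel.
  set p : ℂ[X] := B * derivative q - A * q + C ξ * (B * q) with hp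
  have hlims : ∃ v : ℂ,
      Tendsto (fun t => (B * q).eval (Γ.γ t) * Complex.exp (ξ * Γ.γ t) * Γ.w t) (𝓝[>] 0) (𝓝 v) ∧
      Tendsto (fun t => (B * q).eval (Γ.γ t) * Complex.exp (ξ * Γ.γ t) * Γ.w t) (𝓝[<] 1) (𝓝 v) := by
    rcases Γ.ends with ⟨h0, h1⟩ | ⟨z, w₀, hz, hγ0, hγ1, hw0, hw1⟩
    · exact ⟨0, Γ.tendsto_zero_of_admissibleEnd hB hdeg (Or.inl rfl) h0 q ξ,
        Γ.tendsto_zero_of_admissibleEnd hB hdeg (Or.inr rfl) h1 q ξ⟩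
    · have hg : Continuous fun z => (B * q).eval z * Complex.exp (ξ * z) :=
        (B * q).continuous.mul (by fun_prop)
      exact ⟨_, ((hg.tendsto z).comp hγ0).mul hw0, ((hg.tendsto z).comp hγ1).mul hw1⟩
  obtain ⟨v, hv0, hv1⟩ := hlims
  have hd : ∀ t ∈ Ioo (0 : ℝ) 1,
      HasDerivAt (fun t => (B * q).eval (Γ.γ t) * Complex.exp (ξ * Γ.γ t) * Γ.w t)
        (p.eval (Γ.γ t) * Complex.exp (ξ * Γ.γ t) * Γ.w t * deriv Γ.γ t) t := by
    intro t ht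
    have h1 : HasDerivAt (fun t => (B * q).eval (Γ.γ t))
        ((derivative (B * q)).eval (Γ.γ t) * deriv Γ.γ t) t :=
      HasDerivAt.comp t ((B * q).hasDerivAt _) (Γ.hasDerivAt ht)
    have h2 := ((Γ.hasDerivAt ht).const_mul ξ).cexp
    refine ((h1.mul h2).mul (Γ.w_deriv t ht)).congr_deriv ?_
    have hBt := Γ.avoids t ht
    simp only [hp, potDeriv, derivative_mul, eval_add, eval_sub, eval_mul, eval_C, Pi.mul_apply]
    field_simp
    ring
  have hi := Γ.integrableOn_laplace hB hdeg p ξ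
  have hzero : Γ.laplace p ξ = 0 := by
    rw [laplace, integral, integral_deriv_eq_limUnder_sub hd hi, hv0.limUnder_eq, hv1.limUnder_eq,
      sub_self]
  have hsplit : p = C ξ * (B * q) + C (-1) * (A * q - B * derivative q) := by
    rw [hp, C_neg, C_1]; ring
  rw [hsplit, laplace_add _ hB hdeg, laplace_C_mul, laplace_C_mul] at hzero
  linear_combination -hzero

end Contour

/-! ### Polynomial growth, and decay of the coupled weights. -/

namespace Contour

variable {A B : ℂ[X]}

/-- Continuous functions of polynomial growth along a contour. -/
def PolyGrowth (Γ : Contour A B) (h : ℂ → ℂ) : Prop :=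
  ContinuousOn (fun t => h (Γ.γ t)) (Ioo 0 1) ∧
    ∃ (K : ℝ) (N : ℕ), 0 ≤ K ∧ ∀ t ∈ Ioo (0 : ℝ) 1, ‖h (Γ.γ t)‖ ≤ K * (1 + ‖Γ.γ t‖) ^ N

theorem polyGrowth_eval (Γ : Contour A B) (p : ℂ[X]) : Γ.PolyGrowth fun z => p.eval z := by
  obtain ⟨K, N, hK, h⟩ := exists_eval_le_pow p
  exact ⟨p.continuous.comp_continuousOn Γ.continuousOn_γ, K, N, hK, fun t _ => h _⟩

theorem PolyGrowth.mul {Γ : Contour A B} {f g : ℂ → ℂ} (hf : Γ.PolyGrowth f) (hg : Γ.PolyGrowth g) :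
    Γ.PolyGrowth fun z => f z * g z := by
  obtain ⟨hf, K, N, hK, hfb⟩ := hf
  obtain ⟨hg, L, M, hL, hgb⟩ := hg
  refine ⟨hf.mul hg, K * L, N + M, by positivity, fun t ht => ?_⟩
  rw [norm_mul, pow_add, mul_mul_mul_comm]
  exact mul_le_mul (hfb t ht) (hgb t ht) (norm_nonneg _) (by positivity)

theorem exists_le_norm_sub (Γ : Contour A B) {x : ℂ} (hx : x ∉ closure Γ.carrier) :
    ∃ ε > 0, ∀ t ∈ Ioo (0 : ℝ) 1, ε ≤ ‖Γ.γ t - x‖ := by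
  rw [Metric.mem_closure_iff] at hx
  push Not at hx
  obtain ⟨ε, hε, h⟩ := hx
  refine ⟨ε, hε, fun t ht => ?_⟩
  rw [← dist_eq_norm, dist_comm]
  exact h _ ⟨t, ht, rfl⟩

theorem sub_ne_zero_of_notMem (Γ : Contour A B) {x : ℂ} (hx : x ∉ closure Γ.carrier) {t : ℝ}
    (ht : t ∈ Ioo (0 : ℝ) 1) : Γ.γ t - x ≠ 0 :=
  sub_ne_zero.mpr fun h => hx (subset_closure ⟨t, ht, h⟩)

theorem polyGrowth_inv (Γ : Contour A B) {x : ℂ} (hx : x ∉ closure Γ.carrier) :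
    Γ.PolyGrowth fun z => (z - x)⁻¹ := by
  obtain ⟨ε, hε, h⟩ := Γ.exists_le_norm_sub hx
  refine ⟨(Γ.continuousOn_γ.sub continuousOn_const).inv₀ fun t ht => Γ.sub_ne_zero_of_notMem hx ht,
    ε⁻¹, 0, by positivity, fun t ht => ?_⟩
  rw [norm_inv, pow_zero, mul_one]
  exact inv_anti₀ hε (h t ht)

/-- Decay of the Laplace transform along another contour, when one of the two potentials has growth
more than quadratic. -/
theorem exists_laplace_mul_le {A' B' : ℂ[X]} (Γ : Contour A B) (Γ' : Contour A' B') (hB : B ≠ 0)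
    (hdeg : B.natDegree + 1 ≤ A.natDegree) (hB' : B' ≠ 0) (hdeg' : B'.natDegree + 1 ≤ A'.natDegree)
    (h : A.natDegree ≠ B.natDegree + 1 ∨ A'.natDegree ≠ B'.natDegree + 1) (q : ℂ[X]) :
    ∃ C c : ℝ, 0 < c ∧ ∀ t ∈ Ioo (0 : ℝ) 1,
      ‖Γ'.laplace q (Γ.γ t) * Γ.w t‖ ≤ C * Real.exp (-(c * ‖Γ.γ t‖ ^ 2)) := by
  obtain ⟨C₁, h₁⟩ := Γ.exists_boundAt hB hdeg
  obtain ⟨C₂, h₂⟩ := Γ'.exists_boundAt hB' hdeg'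
  have hC₁ : 0 < C₁ := (h₁ (1 / 2) ⟨by norm_num, by norm_num⟩).1
  have hC₂ : 0 < C₂ := (h₂ (1 / 2) ⟨by norm_num, by norm_num⟩).1
  obtain ⟨C, c, hc, hC⟩ := exists_exp_mul_le (c₁ := 1 / C₁) (c₂ := 1 / C₂) (by positivity)
    (by positivity) (k₁ := A.natDegree - B.natDegree + 1) (k₂ := A'.natDegree - B'.natDegree + 1)
    (by omega) (by omega) (by omega)
  have hF : IntegrableOn (fun s => (q.eval (Γ'.γ s) * (Real.exp (-(c * ‖Γ'.γ s‖ ^ 2)) : ℂ)) *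
      deriv Γ'.γ s) (Ioo 0 1) := by
    refine Γ'.integrableOn_mul_deriv ?_ fun N => ?_
    · exact (q.continuous.comp_continuousOn Γ'.continuousOn_γ).mul
        ((show Continuous fun z : ℂ => (Real.exp (-(c * ‖z‖ ^ 2)) : ℂ) by fun_prop).comp_continuousOn
          Γ'.continuousOn_γ)
    · obtain ⟨K, M, hK, hq⟩ := exists_eval_le_pow q
      obtain ⟨D, hD⟩ := exists_pow_mul_exp_le (N + M) 0 hc le_rfl
      refine ⟨K * D, fun t _ => ?_⟩
      rw [norm_mul, Complex.norm_real, Real.norm_of_nonneg (Real.exp_pos _).le]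
      calc (1 + ‖Γ'.γ t‖) ^ N * (‖q.eval (Γ'.γ t)‖ * Real.exp (-(c * ‖Γ'.γ t‖ ^ 2)))
          ≤ (1 + ‖Γ'.γ t‖) ^ N * ((K * (1 + ‖Γ'.γ t‖) ^ M) * Real.exp (-(c * ‖Γ'.γ t‖ ^ 2))) := by
            gcongr
            exact hq _
        _ = K * ((1 + ‖Γ'.γ t‖) ^ (N + M) *
            Real.exp (0 * ‖Γ'.γ t‖ - c * ‖Γ'.γ t‖ ^ 2)) := by rw [pow_add, zero_mul, zero_sub]; ring
        _ ≤ _ := by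
            gcongr
            exact hD _ (norm_nonneg _)
  refine ⟨C₁ * C₂ * Real.exp C *
    ∫ s in Ioo (0 : ℝ) 1, ‖(q.eval (Γ'.γ s) * (Real.exp (-(c * ‖Γ'.γ s‖ ^ 2)) : ℂ)) *
      deriv Γ'.γ s‖, c, hc, fun t ht => ?_⟩
  rw [laplace, integral, ← integral_mul_const, mul_right_comm, ← integral_const_mul]
  refine norm_integral_le_of_norm_le (hF.norm.const_mul _) ?_
  filter_upwards [ae_restrict_mem measurableSet_Ioo] with s hs
  have e1 := (h₁ t ht).2.1
  have e2 := (h₂ s hs).2.1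
  have e3 := hC ‖Γ.γ t‖ ‖Γ'.γ s‖ (norm_nonneg _) (norm_nonneg _)
  have e4 := norm_exp_mul_le (Γ.γ t) (Γ'.γ s)
  simp only [norm_mul]
  rw [Complex.norm_real, Real.norm_of_nonneg (Real.exp_pos _).le]
  have e5 : ‖Complex.exp (Γ.γ t * Γ'.γ s)‖ * ‖Γ.w t‖ * ‖Γ'.w s‖ ≤
      C₁ * C₂ * Real.exp C * Real.exp (-(c * ‖Γ.γ t‖ ^ 2)) * Real.exp (-(c * ‖Γ'.γ s‖ ^ 2)) := by
    calc ‖Complex.exp (Γ.γ t * Γ'.γ s)‖ * ‖Γ.w t‖ * ‖Γ'.w s‖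
        ≤ Real.exp (‖Γ.γ t‖ * ‖Γ'.γ s‖) *
          (C₁ * Real.exp (-(‖Γ.γ t‖ ^ (A.natDegree - B.natDegree + 1) / C₁))) *
          (C₂ * Real.exp (-(‖Γ'.γ s‖ ^ (A'.natDegree - B'.natDegree + 1) / C₂))) := by gcongr
      _ = C₁ * C₂ * Real.exp (‖Γ.γ t‖ * ‖Γ'.γ s‖ -
          1 / C₁ * ‖Γ.γ t‖ ^ (A.natDegree - B.natDegree + 1) -
          1 / C₂ * ‖Γ'.γ s‖ ^ (A'.natDegree - B'.natDegree + 1)) := by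
          rw [sub_eq_add_neg, sub_eq_add_neg, Real.exp_add, Real.exp_add, one_div_mul_eq_div,
            one_div_mul_eq_div]
          ring
      _ ≤ C₁ * C₂ * Real.exp (C - c * ‖Γ.γ t‖ ^ 2 - c * ‖Γ'.γ s‖ ^ 2) := by gcongr
      _ = _ := by
          rw [sub_eq_add_neg, sub_eq_add_neg, Real.exp_add, Real.exp_add]
          ring
  calc ‖q.eval (Γ'.γ s)‖ * ‖Complex.exp (Γ.γ t * Γ'.γ s)‖ * ‖Γ'.w s‖ * ‖deriv Γ'.γ s‖ * ‖Γ.w t‖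
      = (‖Complex.exp (Γ.γ t * Γ'.γ s)‖ * ‖Γ.w t‖ * ‖Γ'.w s‖) *
        (‖q.eval (Γ'.γ s)‖ * ‖deriv Γ'.γ s‖) := by ring
    _ ≤ (C₁ * C₂ * Real.exp C * Real.exp (-(c * ‖Γ.γ t‖ ^ 2)) *
        Real.exp (-(c * ‖Γ'.γ s‖ ^ 2))) * (‖q.eval (Γ'.γ s)‖ * ‖deriv Γ'.γ s‖) := by gcongr
    _ = _ := by ring

end Contour

/-! ### The double functional for general functions of `ξ`. -/

namespace Data

variable (D : Data)

/-- The convergence hypothesis: when both potentials have quadratic growth the bimoments are assumed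
to converge absolutely. -/
def Convergent : Prop :=
  D.A₁.natDegree = D.B₁.natDegree + 1 → D.A₂.natDegree = D.B₂.natDegree + 1 → D.MomentsConverge

variable {D}

theorem continuous_laplace (D : Data) (ν : Fin D.d₂) (q : ℂ[X]) : Continuous ((D.Γy ν).laplace q) :=
  (D.Γy ν).continuous_laplace D.B₂_ne_zero D.deg₂ q

theorem continuousOn_laplace_comp (D : Data) (μ : Fin D.A₁.natDegree) (ν : Fin D.d₂) (q : ℂ[X]) :
    ContinuousOn (fun t => (D.Γy ν).laplace q ((D.Γx μ).γ t)) (Ioo 0 1) :=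
  (D.continuous_laplace ν q).comp_continuousOn (D.Γx μ).continuousOn_γ

/-- In the doubly quadratic case this follows from the convergence hypothesis by Fubini on
monomials. Otherwise `Contour.exists_laplace_mul_le` gives Gaussian decay. -/
theorem integrableOn_pow_mul (hD : D.Convergent) {μ : Fin D.A₁.natDegree} {ν : Fin D.d₂}
    (hκ : D.κ μ ν ≠ 0) (q : ℂ[X]) (i : ℕ) :
    IntegrableOn (fun t => (D.Γx μ).γ t ^ i * (D.Γy ν).laplace q ((D.Γx μ).γ t) * (D.Γx μ).w t *
      deriv (D.Γx μ).γ t) (Ioo 0 1) := by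
  by_cases h : D.A₁.natDegree = D.B₁.natDegree + 1 ∧ D.A₂.natDegree = D.B₂.natDegree + 1
  · have hm := hD h.1 h.2 μ ν hκ
    induction q using Polynomial.induction_on' with
    | add p q hp hq =>
      refine (hp.add hq).congr (ae_of_all _ fun t => ?_)
      simp only [Pi.add_apply]
      rw [(D.Γy ν).laplace_add D.B₂_ne_zero D.deg₂]
      ring
    | monomial j a =>
      refine ((hm i j).integral_prod_left.const_mul a).congr (ae_of_all _ fun t => ?_)
      simp only
      rw [← C_mul_X_pow_eq_monomial, Contour.laplace_C_mul, Contour.laplace, Contour.integral]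
      simp only [eval_pow, eval_X]
      rw [show ∀ a b c d e : ℂ, a * (b * c) * d * e = b * (a * d * e * c) by intros; ring]
      congr 1
      rw [← integral_const_mul]
      congr 1
      ext s
      ring
  · obtain ⟨C, c, hc, hC⟩ := (D.Γx μ).exists_laplace_mul_le (D.Γy ν) D.B₁_ne_zero D.deg₁
      D.B₂_ne_zero D.deg₂ (by tauto) q
    refine (D.Γx μ).integrableOn_mul_deriv ((((D.Γx μ).continuousOn_γ.pow i).mul
      (D.continuousOn_laplace_comp μ ν q)).mul (D.Γx μ).continuousOn_w) fun N => ?_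
    obtain ⟨K, hK⟩ := exists_pow_mul_exp_le (N + i) 0 hc le_rfl
    refine ⟨|C| * K, fun t ht => ?_⟩
    rw [mul_assoc, norm_mul, norm_pow]
    calc (1 + ‖(D.Γx μ).γ t‖) ^ N * (‖(D.Γx μ).γ t‖ ^ i *
          ‖(D.Γy ν).laplace q ((D.Γx μ).γ t) * (D.Γx μ).w t‖)
        ≤ (1 + ‖(D.Γx μ).γ t‖) ^ N * ((1 + ‖(D.Γx μ).γ t‖) ^ i *
          (|C| * Real.exp (-(c * ‖(D.Γx μ).γ t‖ ^ 2)))) := by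
          gcongr
          · linarith
          · refine (hC t ht).trans ?_
            gcongr
            exact le_abs_self C
      _ = |C| * ((1 + ‖(D.Γx μ).γ t‖) ^ (N + i) *
          Real.exp (0 * ‖(D.Γx μ).γ t‖ - c * ‖(D.Γx μ).γ t‖ ^ 2)) := by
          rw [pow_add, zero_mul, zero_sub]; ring
      _ ≤ _ := by
          gcongr
          exact hK _ (norm_nonneg _)

theorem integrableOn_growth_mul (hD : D.Convergent) {μ : Fin D.A₁.natDegree} {ν : Fin D.d₂}
    (hκ : D.κ μ ν ≠ 0) (q : ℂ[X]) (N : ℕ) :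
    IntegrableOn (fun t => (1 + ‖(D.Γx μ).γ t‖) ^ N * ‖(D.Γy ν).laplace q ((D.Γx μ).γ t) *
      (D.Γx μ).w t * deriv (D.Γx μ).γ t‖) (Ioo 0 1) := by
  have h : ∀ i : ℕ, IntegrableOn (fun t => ‖(D.Γx μ).γ t‖ ^ i *
      ‖(D.Γy ν).laplace q ((D.Γx μ).γ t) * (D.Γx μ).w t * deriv (D.Γx μ).γ t‖) (Ioo 0 1) := by
    intro i
    refine (integrableOn_pow_mul hD hκ q i).norm.congr (ae_of_all _ fun t => ?_)
    simp only
    rw [← norm_pow, ← norm_mul, mul_assoc, mul_assoc, mul_assoc]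
  have hsum : IntegrableOn (fun t => ∑ i ∈ Finset.range (N + 1), (N.choose i : ℝ) *
      (‖(D.Γx μ).γ t‖ ^ i * ‖(D.Γy ν).laplace q ((D.Γx μ).γ t) *
      (D.Γx μ).w t * deriv (D.Γx μ).γ t‖)) (Ioo 0 1) :=
    integrable_finsetSum _ fun i _ => (h i).const_mul _
  refine hsum.congr (ae_of_all _ fun t => ?_)
  simp only
  rw [add_comm (1 : ℝ), add_pow, Finset.sum_mul]
  refine Finset.sum_congr rfl fun i _ => ?_
  rw [one_pow]
  ring

variable (D) in
/-- Functions of `ξ` which can be paired with every polynomial in `y`. -/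
def Pairable (h : ℂ → ℂ) : Prop :=
  ∀ μ ν, D.κ μ ν ≠ 0 → ∀ q : ℂ[X],
    IntegrableOn (fun t => h ((D.Γx μ).γ t) * (D.Γy ν).laplace q ((D.Γx μ).γ t) * (D.Γx μ).w t *
      deriv (D.Γx μ).γ t) (Ioo 0 1)

theorem pairable_of_polyGrowth (hD : D.Convergent) {h : ℂ → ℂ}
    (hh : ∀ μ, (D.Γx μ).PolyGrowth h) : D.Pairable h := by
  intro μ ν hκ q
  obtain ⟨hc, K, N, hK, hb⟩ := hh μ
  refine ((integrableOn_growth_mul hD hκ q N).const_mul K).mono'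
    ((((hc.mul (D.continuousOn_laplace_comp μ ν q)).mul (D.Γx μ).continuousOn_w).mul
      (D.Γx μ).continuousOn_deriv).aestronglyMeasurable measurableSet_Ioo) ?_
  filter_upwards [ae_restrict_mem measurableSet_Ioo] with t ht
  rw [mul_assoc, mul_assoc, norm_mul, ← mul_assoc K, mul_assoc (Contour.laplace _ _ _)]
  gcongr
  exact hb t ht

/-- `V₁'` may blow up where a contour ends at a zero of `B₁`. By the dichotomy in `BoundAt`, either
it has polynomial growth at the point, or the point is in a fixed ball and `V₁' exp (-V₁)` is
bounded. -/
theorem pairable_dV₁_mul (hD : D.Convergent) {h : ℂ → ℂ}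
    (hh : ∀ μ, (D.Γx μ).PolyGrowth h) : D.Pairable fun ξ => D.dV₁ ξ * h ξ := by
  intro μ ν hκ q
  obtain ⟨hc, K, N, hK, hb⟩ := hh μ
  set Γ := D.Γx μ with hΓ
  obtain ⟨C, hC⟩ := Γ.exists_boundAt D.B₁_ne_zero D.deg₁
  have hC0 : 0 < C := (hC (1 / 2) ⟨by norm_num, by norm_num⟩).1
  obtain ⟨M, hM⟩ := (isCompact_closedBall (0 : ℂ) C).exists_bound_of_continuousOn
    (D.continuous_laplace ν q).continuousOn
  obtain ⟨N₀, hN₀⟩ := Γ.tame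
  set j := D.A₁.natDegree - D.B₁.natDegree with hj
  refine (((integrableOn_growth_mul hD hκ q (N + j)).const_mul (K * C)).add
    (hN₀.const_mul (K * (1 + C) ^ N * (|M| * C * (1 + C) ^ N₀)))).mono'
    ((((Γ.continuousOn_potDeriv.mul hc |>.mul (D.continuousOn_laplace_comp μ ν q)).mul
      Γ.continuousOn_w).mul Γ.continuousOn_deriv).aestronglyMeasurable measurableSet_Ioo) ?_
  filter_upwards [ae_restrict_mem measurableSet_Ioo] with t ht
  obtain ⟨-, -, h3⟩ := hC t ht
  simp only [Pi.add_apply, ← hΓ]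
  have hnn1 : 0 ≤ K * C * ((1 + ‖Γ.γ t‖) ^ (N + j) * ‖(D.Γy ν).laplace q (Γ.γ t) *
      Γ.w t * deriv Γ.γ t‖) := by positivity
  have hnn2 : 0 ≤ K * (1 + C) ^ N * (|M| * C * (1 + C) ^ N₀) *
      (‖deriv Γ.γ t‖ / (1 + ‖Γ.γ t‖) ^ N₀) := by positivity
  have hht := hb t ht
  rcases h3 with h3 | ⟨h3, h4⟩
  · refine le_trans ?_ (le_add_of_nonneg_right hnn2)
    calc ‖D.dV₁ (Γ.γ t) * h (Γ.γ t) * (D.Γy ν).laplace q (Γ.γ t) * Γ.w t * deriv Γ.γ t‖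
        = ‖potDeriv D.A₁ D.B₁ (Γ.γ t)‖ * ‖h (Γ.γ t)‖ * ‖(D.Γy ν).laplace q (Γ.γ t) *
            Γ.w t * deriv Γ.γ t‖ := by simp only [dV₁, norm_mul]; ring
      _ ≤ (C * (1 + ‖Γ.γ t‖) ^ j) * (K * (1 + ‖Γ.γ t‖) ^ N) * ‖(D.Γy ν).laplace q (Γ.γ t) *
            Γ.w t * deriv Γ.γ t‖ := by
          gcongr
          refine h3.trans ?_
          gcongr
          linarith
      _ = _ := by rw [pow_add]; ring
  · refine le_trans ?_ (le_add_of_nonneg_left hnn1)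
    have hMt : ‖(D.Γy ν).laplace q (Γ.γ t)‖ ≤ |M| :=
      (hM _ (mem_closedBall_zero_iff.mpr h3)).trans (le_abs_self M)
    have hγ' : ‖deriv Γ.γ t‖ ≤ (1 + C) ^ N₀ * (‖deriv Γ.γ t‖ / (1 + ‖Γ.γ t‖) ^ N₀) := by
      rw [mul_div_assoc', le_div_iff₀ (by positivity), mul_comm]
      gcongr
    calc ‖D.dV₁ (Γ.γ t) * h (Γ.γ t) * (D.Γy ν).laplace q (Γ.γ t) * Γ.w t * deriv Γ.γ t‖
        = ‖h (Γ.γ t)‖ * (‖(D.Γy ν).laplace q (Γ.γ t)‖ * ‖potDeriv D.A₁ D.B₁ (Γ.γ t) * Γ.w t‖ *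
            ‖deriv Γ.γ t‖) := by simp only [dV₁, norm_mul]; ring
      _ ≤ (K * (1 + C) ^ N) * (|M| * C *
            ((1 + C) ^ N₀ * (‖deriv Γ.γ t‖ / (1 + ‖Γ.γ t‖) ^ N₀))) := by
          gcongr
          refine hht.trans ?_
          gcongr
      _ = _ := by ring

theorem Pairable.const_mul {f : ℂ → ℂ} (hf : D.Pairable f) (c : ℂ) :
    D.Pairable fun ξ => c * f ξ := by
  intro μ ν hκ q
  refine ((hf μ ν hκ q).const_mul c).congr (ae_of_all _ fun t => ?_)
  simp only
  ring

theorem Pairable.congr {f g : ℂ → ℂ} (hf : D.Pairable f)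
    (h : ∀ μ, ∀ t ∈ Ioo (0 : ℝ) 1, f ((D.Γx μ).γ t) = g ((D.Γx μ).γ t)) : D.Pairable g := by
  intro μ ν hκ q
  refine (hf μ ν hκ q).congr ?_
  filter_upwards [ae_restrict_mem measurableSet_Ioo] with t ht
  rw [h μ t ht]

variable (D) in
/-- The functional `∫∫_κ h(ξ) q(y) exp (-V₁(ξ) - V₂(y) + ξ y) dξ dy`. -/
def pair (h : ℂ → ℂ) (q : ℂ[X]) : ℂ := D.dblIntegral fun ξ y => h ξ * q.eval y

/-- The inner integral is a Laplace transform, entire in `ξ`. What remains are single integrals over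
the `Γ_{x,μ}`, and no exchange of integrals is needed. -/
theorem pair_eq_sum (h : ℂ → ℂ) (q : ℂ[X]) :
    D.pair h q = ∑ μ, ∑ ν, D.κ μ ν *
      (D.Γx μ).integral fun ξ => h ξ * (D.Γy ν).laplace q ξ := by
  rw [pair, dblIntegral]
  refine Finset.sum_congr rfl fun μ _ => Finset.sum_congr rfl fun ν _ => ?_
  congr 2
  ext ξ
  rw [Contour.laplace, Contour.integral, Contour.integral, ← integral_const_mul]
  congr 1
  ext t
  ring

theorem L_eq_pair (p q : ℂ[X]) : D.L p q = D.pair (fun ξ => p.eval ξ) q := rfl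

theorem pair_congr {f g : ℂ → ℂ}
    (h : ∀ μ, ∀ t ∈ Ioo (0 : ℝ) 1, f ((D.Γx μ).γ t) = g ((D.Γx μ).γ t)) (q : ℂ[X]) :
    D.pair f q = D.pair g q := by
  simp only [pair_eq_sum]
  refine Finset.sum_congr rfl fun μ _ => Finset.sum_congr rfl fun ν _ => ?_
  congr 1
  refine setIntegral_congr_fun measurableSet_Ioo fun t ht => ?_
  simp only [h μ t ht]

theorem pair_add_left {f g : ℂ → ℂ} (hf : D.Pairable f) (hg : D.Pairable g) (q : ℂ[X]) :
    D.pair (fun ξ => f ξ + g ξ) q = D.pair f q + D.pair g q := by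
  simp only [pair_eq_sum, ← Finset.sum_add_distrib]
  refine Finset.sum_congr rfl fun μ _ => Finset.sum_congr rfl fun ν _ => ?_
  by_cases hκ : D.κ μ ν = 0
  · simp [hκ]
  rw [← mul_add, Contour.integral, Contour.integral, Contour.integral,
    ← integral_add (hf μ ν hκ q) (hg μ ν hκ q)]
  congr 2
  ext t
  ring

theorem pair_const_mul_left (c : ℂ) (f : ℂ → ℂ) (q : ℂ[X]) :
    D.pair (fun ξ => c * f ξ) q = c * D.pair f q := by
  simp only [pair_eq_sum, Finset.mul_sum]
  refine Finset.sum_congr rfl fun μ _ => Finset.sum_congr rfl fun ν _ => ?_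
  rw [mul_left_comm]
  congr 1
  rw [Contour.integral, Contour.integral, ← integral_const_mul]
  congr 1
  ext t
  ring

theorem pair_add_right {f : ℂ → ℂ} (hf : D.Pairable f) (p q : ℂ[X]) :
    D.pair f (p + q) = D.pair f p + D.pair f q := by
  simp only [pair_eq_sum, ← Finset.sum_add_distrib]
  refine Finset.sum_congr rfl fun μ _ => Finset.sum_congr rfl fun ν _ => ?_
  by_cases hκ : D.κ μ ν = 0
  · simp [hκ]
  rw [← mul_add, Contour.integral, Contour.integral, Contour.integral,
    ← integral_add (hf μ ν hκ p) (hf μ ν hκ q)]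
  congr 2
  ext t
  rw [(D.Γy ν).laplace_add D.B₂_ne_zero D.deg₂]
  ring

theorem pair_C_mul_right (f : ℂ → ℂ) (c : ℂ) (q : ℂ[X]) :
    D.pair f (C c * q) = c * D.pair f q := by
  simp only [pair_eq_sum, Finset.mul_sum]
  refine Finset.sum_congr rfl fun μ _ => Finset.sum_congr rfl fun ν _ => ?_
  rw [mul_left_comm]
  congr 1
  rw [Contour.integral, Contour.integral, ← integral_const_mul]
  congr 1
  ext t
  rw [Contour.laplace_C_mul]
  ring

/-- `pair` as a linear functional of the polynomial. -/
def pairLM {f : ℂ → ℂ} (hf : D.Pairable f) : ℂ[X] →ₗ[ℂ] ℂ where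
  toFun q := D.pair f q
  map_add' := pair_add_right hf
  map_smul' c q := by rw [smul_eq_C_mul, pair_C_mul_right]; rfl

/-- Integration by parts in `y`. -/
theorem pair_integration_by_parts_right (f : ℂ → ℂ) (q : ℂ[X]) :
    D.pair f (D.A₂ * q - D.B₂ * derivative q) = D.pair (fun ξ => ξ * f ξ) (D.B₂ * q) := by
  simp only [pair_eq_sum]
  refine Finset.sum_congr rfl fun μ _ => Finset.sum_congr rfl fun ν _ => ?_
  congr 2
  ext ξ
  rw [(D.Γy ν).laplace_integration_by_parts D.B₂_ne_zero D.deg₂]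
  ring

variable (D) in
/-- The point `x` lies off the closures of the contours in `ξ`. -/
def OffContours (x : ℂ) : Prop := ∀ μ, x ∉ closure (D.Γx μ).carrier

theorem OffContours.ne {x : ℂ} (hx : D.OffContours x) {μ : Fin D.A₁.natDegree} {t : ℝ}
    (ht : t ∈ Ioo (0 : ℝ) 1) : (D.Γx μ).γ t - x ≠ 0 :=
  (D.Γx μ).sub_ne_zero_of_notMem (hx μ) ht

theorem pairable_eval (hD : D.Convergent) (p : ℂ[X]) : D.Pairable fun ξ => p.eval ξ :=
  pairable_of_polyGrowth hD fun μ => (D.Γx μ).polyGrowth_eval p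

theorem pairable_eval_div (hD : D.Convergent) (p : ℂ[X]) {x : ℂ} (hx : D.OffContours x) :
    D.Pairable fun ξ => p.eval ξ / (ξ - x) :=
  pairable_of_polyGrowth hD fun μ =>
    ((D.Γx μ).polyGrowth_eval p).mul ((D.Γx μ).polyGrowth_inv (hx μ))

theorem pairable_eval_div_sq (hD : D.Convergent) (p : ℂ[X]) {x : ℂ} (hx : D.OffContours x) :
    D.Pairable fun ξ => p.eval ξ / (ξ - x) ^ 2 :=
  (pairable_of_polyGrowth hD fun μ =>
    ((D.Γx μ).polyGrowth_eval p).mul (((D.Γx μ).polyGrowth_inv (hx μ)).mul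
      ((D.Γx μ).polyGrowth_inv (hx μ)))).congr fun μ t _ => by
        rw [div_eq_mul_inv, pow_two, mul_inv]

theorem pairable_dV₁_mul_eval_div (hD : D.Convergent) (p : ℂ[X]) {x : ℂ} (hx : D.OffContours x) :
    D.Pairable fun ξ => D.dV₁ ξ * (p.eval ξ / (ξ - x)) :=
  pairable_dV₁_mul hD fun μ =>
    ((D.Γx μ).polyGrowth_eval p).mul ((D.Γx μ).polyGrowth_inv (hx μ))

/-- Integration by parts in `ξ`. -/
theorem sum_boundary_eq (hD : D.Convergent) (p q : ℂ[X]) {x : ℂ} (hx : D.OffContours x) :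
    (∑ μ, (D.Γx μ).boundary fun ξ => p.eval ξ / (ξ - x) * ∑ ν, D.κ μ ν *
      (D.Γy ν).integral fun y => Complex.exp (ξ * y) * q.eval y) =
    D.pair (fun ξ => (derivative p).eval ξ / (ξ - x)) q -
      D.pair (fun ξ => D.dV₁ ξ * (p.eval ξ / (ξ - x))) q -
      D.pair (fun ξ => p.eval ξ / (ξ - x) ^ 2) q +
      D.pair (fun ξ => p.eval ξ / (ξ - x)) (X * q) := by
  simp only [pair_eq_sum, ← Finset.sum_add_distrib, ← Finset.sum_sub_distrib]
  refine Finset.sum_congr rfl fun μ _ => ?_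
  set Γ := D.Γx μ with hΓ
  have hlap : ∀ (ν : Fin D.d₂) (ξ : ℂ),
      ((D.Γy ν).integral fun y => Complex.exp (ξ * y) * q.eval y) = (D.Γy ν).laplace q ξ := by
    intro ν ξ
    rw [Contour.laplace]
    congr 1
    ext y
    ring
  simp only [hlap]
  set F : Fin D.d₂ → ℝ → ℂ := fun ν t =>
    (derivative p).eval (Γ.γ t) / (Γ.γ t - x) * (D.Γy ν).laplace q (Γ.γ t) * Γ.w t * deriv Γ.γ t -
    D.dV₁ (Γ.γ t) * (p.eval (Γ.γ t) / (Γ.γ t - x)) * (D.Γy ν).laplace q (Γ.γ t) * Γ.w t *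
      deriv Γ.γ t -
    p.eval (Γ.γ t) / (Γ.γ t - x) ^ 2 * (D.Γy ν).laplace q (Γ.γ t) * Γ.w t * deriv Γ.γ t +
    p.eval (Γ.γ t) / (Γ.γ t - x) * (D.Γy ν).laplace (X * q) (Γ.γ t) * Γ.w t * deriv Γ.γ t with hF
  have i1 := fun ν hκ => pairable_eval_div hD (derivative p) hx μ ν hκ q
  have i2 := fun ν hκ => pairable_dV₁_mul_eval_div hD p hx μ ν hκ q
  have i3 := fun ν hκ => pairable_eval_div_sq hD p hx μ ν hκ q
  have i4 := fun ν hκ => pairable_eval_div hD p hx μ ν hκ (X * q)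
  -- Integrability is known only for pairs with `κ ≠ 0`; keeping the weight inside makes it hold for
  -- every `ν`, so the boundary value of the whole sum over `ν` exists.
  have hFi : ∀ ν, IntegrableOn (fun t => D.κ μ ν * F ν t) (Ioo 0 1) := by
    intro ν
    by_cases hκ : D.κ μ ν = 0
    · simp [hκ]
    exact ((((i1 ν hκ).sub (i2 ν hκ)).sub (i3 ν hκ)).add (i4 ν hκ)).const_mul _
  have hFe : ∀ ν, ∫ t in Ioo (0 : ℝ) 1, D.κ μ ν * F ν t =
      D.κ μ ν * Γ.integral (fun ξ => (derivative p).eval ξ / (ξ - x) * (D.Γy ν).laplace q ξ) -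
      D.κ μ ν * Γ.integral (fun ξ => D.dV₁ ξ * (p.eval ξ / (ξ - x)) * (D.Γy ν).laplace q ξ) -
      D.κ μ ν * Γ.integral (fun ξ => p.eval ξ / (ξ - x) ^ 2 * (D.Γy ν).laplace q ξ) +
      D.κ μ ν * Γ.integral (fun ξ => p.eval ξ / (ξ - x) * (D.Γy ν).laplace (X * q) ξ) := by
    intro ν
    by_cases hκ : D.κ μ ν = 0
    · simp [hκ]
    have e1 := integral_add (((i1 ν hκ).sub (i2 ν hκ)).sub (i3 ν hκ)) (i4 ν hκ)
    have e2 := integral_sub ((i1 ν hκ).sub (i2 ν hκ)) (i3 ν hκ)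
    have e3 := integral_sub (i1 ν hκ) (i2 ν hκ)
    simp only [Pi.sub_apply, ← hΓ] at e1 e2 e3
    rw [integral_const_mul]
    simp only [hF, Contour.integral]
    linear_combination D.κ μ ν * (e1 + e2 + e3)
  rw [Contour.boundary, ← integral_deriv_eq_limUnder_sub (H' := fun t => ∑ ν, D.κ μ ν * F ν t),
    integral_finsetSum _ fun ν _ => hFi ν]
  · exact Finset.sum_congr rfl fun ν _ => hFe ν
  · intro t ht
    have h0 := hx.ne (μ := μ) ht
    have hγ := Γ.hasDerivAt ht
    have h1 : HasDerivAt (fun t => p.eval (Γ.γ t)) ((derivative p).eval (Γ.γ t) * deriv Γ.γ t) t :=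
      HasDerivAt.comp t (p.hasDerivAt _) hγ
    have h2 : ∀ ν, HasDerivAt (fun t => (D.Γy ν).laplace q (Γ.γ t))
        ((D.Γy ν).laplace (X * q) (Γ.γ t) * deriv Γ.γ t) t := fun ν =>
      HasDerivAt.comp t ((D.Γy ν).hasDerivAt_laplace D.B₂_ne_zero D.deg₂ q _) hγ
    have h3 := HasDerivAt.fun_sum (u := Finset.univ) fun ν _ => (h2 ν).const_mul (D.κ μ ν)
    refine (((h1.div (hγ.sub_const x) h0).mul h3).mul (Γ.w_deriv t ht)).congr_deriv ?_
    simp only [Pi.mul_apply, Pi.div_apply, Finset.mul_sum, Finset.sum_mul, ← Finset.sum_add_distrib,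
      hF, dV₁]
    refine Finset.sum_congr rfl fun ν _ => ?_
    field_simp
    ring
  · exact integrable_finsetSum _ fun ν _ => hFi ν

/-- Differentiation of the Cauchy-type transforms. -/
theorem hasDerivAt_pair (hD : D.Convergent) (p q : ℂ[X]) {x : ℂ} (hx : D.OffContours x) :
    HasDerivAt (fun z => D.pair (fun ξ => p.eval ξ / (ξ - z)) q)
      (D.pair (fun ξ => p.eval ξ / (ξ - x) ^ 2) q) x := by
  simp only [pair_eq_sum]
  refine HasDerivAt.fun_sum fun μ _ => HasDerivAt.fun_sum fun ν _ => ?_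
  by_cases hκ : D.κ μ ν = 0
  · simpa [hκ] using hasDerivAt_const x (0 : ℂ)
  refine HasDerivAt.const_mul _ ?_
  set Γ := D.Γx μ with hΓ
  obtain ⟨ε, hε, h⟩ := Γ.exists_le_norm_sub (hx μ)
  have hball : ∀ t ∈ Ioo (0 : ℝ) 1, ∀ z ∈ Metric.ball x (ε / 2), ε / 2 ≤ ‖Γ.γ t - z‖ := by
    intro t ht z hz
    have h1 := h t ht
    have h2 : ‖z - x‖ < ε / 2 := by rwa [← dist_eq_norm]
    have h3 := norm_add_le (Γ.γ t - z) (z - x)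
    rw [sub_add_sub_cancel] at h3
    linarith
  have hoff : ∀ z ∈ Metric.ball x (ε / 2), Γ.PolyGrowth fun ξ => (ξ - z)⁻¹ := by
    intro z hz
    refine ⟨(Γ.continuousOn_γ.sub continuousOn_const).inv₀ fun t ht h0 => ?_, (ε / 2)⁻¹, 0,
      by positivity, fun t ht => ?_⟩
    · have := hball t ht z hz
      change Γ.γ t - z = 0 at h0
      rw [h0, norm_zero] at this
      linarith
    · rw [norm_inv, pow_zero, mul_one]
      exact inv_anti₀ (by positivity) (hball t ht z hz)
  have hint : ∀ z ∈ Metric.ball x (ε / 2), IntegrableOn (fun t => p.eval (Γ.γ t) / (Γ.γ t - z) *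
      (D.Γy ν).laplace q (Γ.γ t) * Γ.w t * deriv Γ.γ t) (Ioo 0 1) := by
    intro z hz
    obtain ⟨hc, K, N, hK, hb⟩ := ((D.Γx μ).polyGrowth_eval p).mul (hoff z hz)
    refine ((integrableOn_growth_mul hD hκ q N).const_mul K).mono'
      ((((hc.mul (D.continuousOn_laplace_comp μ ν q)).mul Γ.continuousOn_w).mul
        Γ.continuousOn_deriv).aestronglyMeasurable measurableSet_Ioo) ?_
    filter_upwards [ae_restrict_mem measurableSet_Ioo] with t ht
    rw [mul_assoc, mul_assoc, norm_mul, ← mul_assoc K, mul_assoc (Contour.laplace _ _ _)]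
    gcongr
    exact hb t ht
  refine hasDerivAt_integral_Ioo
    (F := fun z t => p.eval (Γ.γ t) / (Γ.γ t - z) * (D.Γy ν).laplace q (Γ.γ t) * Γ.w t *
      deriv Γ.γ t)
    (F' := fun z t => p.eval (Γ.γ t) / (Γ.γ t - z) ^ 2 * (D.Γy ν).laplace q (Γ.γ t) * Γ.w t *
      deriv Γ.γ t)
    (bound := fun t => ((ε / 2) ^ 2)⁻¹ * ‖p.eval (Γ.γ t) * (D.Γy ν).laplace q (Γ.γ t) * Γ.w t *
      deriv Γ.γ t‖)
    (Metric.ball_mem_nhds x (half_pos hε)) hint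
    (pairable_eval_div_sq hD p hx μ ν hκ q).aestronglyMeasurable ?_
    ((pairable_eval hD p μ ν hκ q).norm.const_mul _) ?_
  · intro t ht z hz
    rw [show p.eval (Γ.γ t) / (Γ.γ t - z) ^ 2 * (D.Γy ν).laplace q (Γ.γ t) * Γ.w t *
      deriv Γ.γ t = ((Γ.γ t - z) ^ 2)⁻¹ * (p.eval (Γ.γ t) * (D.Γy ν).laplace q (Γ.γ t) * Γ.w t *
      deriv Γ.γ t) by ring, norm_mul, norm_inv, norm_pow]
    gcongr
    exact hball t ht z hz
  · intro t ht z hz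
    have h0 : Γ.γ t - z ≠ 0 := by
      intro h0
      have := hball t ht z hz
      rw [h0, norm_zero] at this
      linarith
    have h1 := ((((hasDerivAt_const z (p.eval (Γ.γ t))).div ((hasDerivAt_id z).const_sub (Γ.γ t))
      h0).mul_const ((D.Γy ν).laplace q (Γ.γ t))).mul_const (Γ.w t)).mul_const (deriv Γ.γ t)
    refine h1.congr_deriv ?_
    simp

end Data

/-! ### Biorthonormal sequences. -/

/-- A sequence of polynomials of degrees `0, 1, 2, …` spans the polynomials of bounded degree. -/
theorem exists_eq_sum_smul {p : ℕ → ℂ[X]} (hp : ∀ n, (p n).degree = n) {N : ℕ} {f : ℂ[X]}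
    (hf : f.degree < N) : ∃ c : ℕ → ℂ, f = ∑ k ∈ Finset.range N, c k • p k := by
  induction N generalizing f with
  | zero =>
    refine ⟨0, ?_⟩
    simpa using hf
  | succ N ih =>
    have hlc : (p N).coeff N ≠ 0 := by
      have h0 : p N ≠ 0 := by
        intro h0
        have := hp N
        rw [h0, degree_zero] at this
        exact WithBot.bot_ne_coe this
      have h1 := leadingCoeff_ne_zero.mpr h0
      rwa [leadingCoeff, natDegree_eq_of_degree_eq_some (hp N)] at h1
    have hg : (f - (f.coeff N / (p N).coeff N) • p N).degree < N := by
      rw [degree_lt_iff_coeff_zero]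
      intro m hm
      rw [coeff_sub, coeff_smul, smul_eq_mul]
      rcases hm.eq_or_lt with rfl | hm
      · rw [div_mul_cancel₀ _ hlc, sub_self]
      · have h1 : (p N).degree < (m : WithBot ℕ) := by rw [hp]; exact_mod_cast hm
        rw [(degree_lt_iff_coeff_zero f (N + 1)).mp (by exact_mod_cast hf) m hm,
          coeff_eq_zero_of_degree_lt h1, mul_zero, sub_self]
    obtain ⟨c, hc⟩ := ih hg
    refine ⟨fun k => if k = N then f.coeff N / (p N).coeff N else c k, ?_⟩
    simp only [Finset.sum_range_succ, if_true]
    rw [Finset.sum_congr rfl (g := fun k => c k • p k) fun k hk => by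
        rw [if_neg (Finset.mem_range.mp hk).ne], ← hc, sub_add_cancel]

namespace IsBiorthonormal

variable {L : ℂ[X] →ₗ[ℂ] ℂ[X] →ₗ[ℂ] ℂ} {p q : ℕ → ℂ[X]}
  (h : IsBiorthonormal (fun f g => L f g) p q)

include h

theorem coeff_left_ne_zero (n : ℕ) : (p n).coeff n ≠ 0 :=
  coeff_ne_zero_of_eq_degree (h.degree_left n)

theorem coeff_right_ne_zero (n : ℕ) : (q n).coeff n ≠ 0 :=
  coeff_ne_zero_of_eq_degree (h.degree_right n)

/-- Some expansion in the `p k` exists by degrees; pairing with `q k` identifies its coefficients.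
-/
theorem eq_sum_left {f : ℂ[X]} {N : ℕ} (hf : f.degree < N) :
    f = ∑ k ∈ Finset.range N, L f (q k) • p k := by
  obtain ⟨c, hc⟩ := exists_eq_sum_smul h.degree_left hf
  conv_lhs => rw [hc]
  refine Finset.sum_congr rfl fun k hk => ?_
  congr 1
  conv_rhs => rw [hc]
  simp only [map_sum, map_smul, LinearMap.sum_apply, LinearMap.smul_apply, smul_eq_mul]
  rw [Finset.sum_eq_single k]
  · rw [h.pairing, if_pos rfl, mul_one]
  · intro j _ hj
    rw [h.pairing, if_neg hj, mul_zero]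
  · exact fun hk' => absurd hk hk'

theorem eq_sum_right {f : ℂ[X]} {N : ℕ} (hf : f.degree < N) :
    f = ∑ k ∈ Finset.range N, L (p k) f • q k := by
  obtain ⟨c, hc⟩ := exists_eq_sum_smul h.degree_right hf
  conv_lhs => rw [hc]
  refine Finset.sum_congr rfl fun k hk => ?_
  congr 1
  conv_rhs => rw [hc]
  simp only [map_sum, map_smul, smul_eq_mul]
  rw [Finset.sum_eq_single k]
  · rw [h.pairing, if_pos rfl, mul_one]
  · intro j _ hj
    rw [h.pairing, if_neg (Ne.symm hj), mul_zero]
  · exact fun hk' => absurd hk hk'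

/-- Compare coefficients of `X ^ n` in the expansion of `f`: only `p n` reaches that degree. -/
theorem apply_right {f : ℂ[X]} {n : ℕ} (hf : f.degree ≤ n) :
    L f (q n) = f.coeff n / (p n).coeff n := by
  have h1 := congrArg (fun g => coeff g n)
    (h.eq_sum_left (f := f) (N := n + 1) (lt_of_le_of_lt hf (by exact_mod_cast n.lt_succ_self)))
  simp only [finsetSum_coeff, coeff_smul, smul_eq_mul] at h1
  rw [Finset.sum_range_succ, Finset.sum_eq_zero, zero_add] at h1
  · rw [h1, mul_div_cancel_right₀ _ (h.coeff_left_ne_zero n)]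
  · intro k hk
    rw [coeff_eq_zero_of_degree_lt, mul_zero]
    rw [h.degree_left]
    exact_mod_cast Finset.mem_range.mp hk

theorem apply_left {f : ℂ[X]} {n : ℕ} (hf : f.degree ≤ n) :
    L (p n) f = f.coeff n / (q n).coeff n := by
  have h1 := congrArg (fun g => coeff g n)
    (h.eq_sum_right (f := f) (N := n + 1) (lt_of_le_of_lt hf (by exact_mod_cast n.lt_succ_self)))
  simp only [finsetSum_coeff, coeff_smul, smul_eq_mul] at h1
  rw [Finset.sum_range_succ, Finset.sum_eq_zero, zero_add] at h1
  · rw [h1, mul_div_cancel_right₀ _ (h.coeff_right_ne_zero n)]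
  · intro k hk
    rw [coeff_eq_zero_of_degree_lt, mul_zero]
    rw [h.degree_right]
    exact_mod_cast Finset.mem_range.mp hk

theorem apply_right_eq_zero {f : ℂ[X]} {n : ℕ} (hf : f.degree < n) : L f (q n) = 0 := by
  rw [h.apply_right hf.le, coeff_eq_zero_of_degree_lt hf, zero_div]

theorem apply_left_eq_zero {f : ℂ[X]} {n : ℕ} (hf : f.degree < n) : L (p n) f = 0 := by
  rw [h.apply_left hf.le, coeff_eq_zero_of_degree_lt hf, zero_div]

end IsBiorthonormal

/-! ### The adjoint operator in `y`. -/

namespace Data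

variable {D : Data}

/-- The bimoment functional as a bilinear form. -/
def bilin (hD : D.Convergent) : ℂ[X] →ₗ[ℂ] ℂ[X] →ₗ[ℂ] ℂ :=
  LinearMap.mk₂ ℂ D.L
    (fun p p' q => by
      simp only [L_eq_pair, eval_add]
      exact pair_add_left (pairable_eval hD p) (pairable_eval hD p') q)
    (fun c p q => by
      simp only [L_eq_pair, eval_smul, smul_eq_mul]
      exact pair_const_mul_left c _ q)
    (fun p q q' => pair_add_right (pairable_eval hD p) q q')
    (fun c p q => by rw [smul_eq_C_mul, smul_eq_mul]; exact pair_C_mul_right _ c q)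

/-- The associated bimoment functional as a bilinear form. -/
def bilinHat (hD : D.Convergent) : ℂ[X] →ₗ[ℂ] ℂ[X] →ₗ[ℂ] ℂ :=
  (bilin hD).compl₂ (LinearMap.mulLeft ℂ D.B₂)

theorem bilin_apply (hD : D.Convergent) (p q : ℂ[X]) : bilin hD p q = D.L p q := rfl

theorem bilinHat_apply (hD : D.Convergent) (p q : ℂ[X]) : bilinHat hD p q = D.Lhat p q := rfl

variable (D) in
/-- The differential operator `q ↦ A₂ q - B₂ q' - x B₂ q`. -/
def adjointOp (x : ℂ) (q : ℂ[X]) : ℂ[X] := D.A₂ * q - D.B₂ * derivative q - C x * (D.B₂ * q)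

/-- Since `deg A₂ ≥ deg B₂ + 1`, the term `A₂ q` governs the degree, whatever `x` is. -/
theorem degree_adjointOp_sub_lt (D : Data) (x : ℂ) {q : ℂ[X]} {k : ℕ} (hq : q.degree = k) :
    (D.adjointOp x q - D.A₂ * q).degree < ((k + D.d₂ : ℕ) : WithBot ℕ) := by
  have hk := natDegree_eq_of_degree_eq_some hq
  have h1 : (D.B₂ * derivative q).natDegree ≤ D.B₂.natDegree + k :=
    natDegree_mul_le.trans (by have := natDegree_derivative_le q; omega)
  have h2 : (C x * (D.B₂ * q)).natDegree ≤ D.B₂.natDegree + k :=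
    (natDegree_C_mul_le _ _).trans (natDegree_mul_le.trans (by omega))
  have h3 : (D.adjointOp x q - D.A₂ * q).natDegree ≤ D.B₂.natDegree + k := by
    rw [adjointOp, show D.A₂ * q - D.B₂ * derivative q - C x * (D.B₂ * q) - D.A₂ * q =
      -(D.B₂ * derivative q + C x * (D.B₂ * q)) by ring, natDegree_neg]
    exact natDegree_add_le_of_degree_le h1 h2
  have h4 := D.deg₂
  refine lt_of_le_of_lt degree_le_natDegree ?_
  exact_mod_cast (by simp only [d₂]; omega)

theorem degree_adjointOp_lt (D : Data) (x : ℂ) {q : ℂ[X]} {k N : ℕ} (hq : q.degree = k)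
    (hN : k + D.d₂ < N) : (D.adjointOp x q).degree < N := by
  have h1 := degree_adjointOp_sub_lt D x hq
  have h2 : (D.A₂ * q).degree < (N : WithBot ℕ) := by
    refine lt_of_le_of_lt degree_le_natDegree ?_
    have := natDegree_mul_le (p := D.A₂) (q := q)
    have hk := natDegree_eq_of_degree_eq_some hq
    exact_mod_cast (by simp only [d₂] at hN; omega : (D.A₂ * q).natDegree < N)
  rw [← sub_add_cancel (D.adjointOp x q) (D.A₂ * q)]
  exact lt_of_le_of_lt (degree_add_le _ _)
    (max_lt (h1.trans (by exact_mod_cast hN)) h2)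

theorem A₂_ne_zero (D : Data) : D.A₂ ≠ 0 := by
  intro h
  have := D.deg₂
  simp [h] at this

theorem one_le_d₂ (D : Data) : 1 ≤ D.d₂ := le_trans (by omega) D.deg₂

theorem coeff_adjointOp_ne_zero (D : Data) (x : ℂ) {q : ℂ[X]} {k : ℕ} (hq : q.degree = k) :
    (D.adjointOp x q).coeff (k + D.d₂) ≠ 0 := by
  have h1 := coeff_eq_zero_of_degree_lt (degree_adjointOp_sub_lt D x hq)
  rw [coeff_sub, sub_eq_zero] at h1
  rw [h1]
  refine coeff_ne_zero_of_eq_degree ?_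
  rw [degree_mul, hq, degree_eq_natDegree D.A₂_ne_zero, add_comm]
  rfl

/-- Integration by parts in `y`, for the Cauchy-type transforms. -/
theorem pair_div_adjointOp (hD : D.Convergent) (p q : ℂ[X]) {x : ℂ} (hx : D.OffContours x) :
    D.pair (fun ξ => p.eval ξ / (ξ - x)) (D.adjointOp x q) = D.pair (fun ξ => p.eval ξ) (D.B₂ * q) := by
  have hp := pairable_eval_div hD p hx
  have h1 : D.adjointOp x q = (D.A₂ * q - D.B₂ * derivative q) + C (-x) * (D.B₂ * q) := by
    rw [adjointOp, C_neg]; ring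
  rw [h1, pair_add_right hp, pair_C_mul_right, pair_integration_by_parts_right,
    ← pair_const_mul_left, ← pair_add_left]
  · refine pair_congr (fun μ t ht => ?_) _
    have h0 := hx.ne (μ := μ) ht
    field_simp
    ring
  · refine (pairable_of_polyGrowth hD fun μ => ((D.Γx μ).polyGrowth_eval (X * p)).mul
      ((D.Γx μ).polyGrowth_inv (hx μ))).congr fun μ t _ => ?_
    rw [eval_mul, eval_X, div_eq_mul_inv, mul_assoc]
  · exact hp.const_mul _

/-- Under the functional, `adjointOp x` amounts to multiplication by `ξ - x` together with insertion
of `B₂`, so each application removes one power of the Cauchy denominator. -/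
theorem pair_div_sq_adjointOp (hD : D.Convergent) (p q : ℂ[X]) {x : ℂ} (hx : D.OffContours x) :
    D.pair (fun ξ => p.eval ξ / (ξ - x) ^ 2) (D.adjointOp x q) =
      D.pair (fun ξ => p.eval ξ / (ξ - x)) (D.B₂ * q) := by
  have hp := pairable_eval_div_sq hD p hx
  have h1 : D.adjointOp x q = (D.A₂ * q - D.B₂ * derivative q) + C (-x) * (D.B₂ * q) := by
    rw [adjointOp, C_neg]; ring
  rw [h1, pair_add_right hp, pair_C_mul_right, pair_integration_by_parts_right,
    ← pair_const_mul_left, ← pair_add_left]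
  · refine pair_congr (fun μ t ht => ?_) _
    have h0 := hx.ne (μ := μ) ht
    field_simp
    ring
  · refine (pairable_eval_div_sq hD (X * p) hx).congr fun μ t _ => ?_
    rw [eval_mul, eval_X, mul_div_assoc]
  · exact hp.const_mul _

/-- This duality is what makes the same matrix serve on both sides of the biorthogonality. -/
theorem L_adjointOp (hD : D.Convergent) (p q : ℂ[X]) (x : ℂ) :
    D.L p (D.adjointOp x q) = D.Lhat ((X - C x) * p) q := by
  have h1 : D.adjointOp x q = (D.A₂ * q - D.B₂ * derivative q) + C (-x) * (D.B₂ * q) := by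
    rw [adjointOp, C_neg]; ring
  rw [L_eq_pair, Lhat, L_eq_pair, h1, pair_add_right (pairable_eval hD p), pair_C_mul_right,
    pair_integration_by_parts_right, ← pair_const_mul_left, ← pair_add_left]
  · refine pair_congr (fun μ t ht => ?_) _
    simp only [eval_mul, eval_sub, eval_X, eval_C]
    ring
  · refine (pairable_eval hD (X * p)).congr fun μ t _ => ?_
    rw [eval_mul, eval_X]
  · exact (pairable_eval hD p).const_mul _

/-- The commutator of `y` with the operator is `B₂`, coming from the derivative of `X`; it supplies
the term that cancels the double pole in `sourceLM_adjointOp`. -/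
theorem X_mul_adjointOp (D : Data) (x : ℂ) (q : ℂ[X]) :
    X * D.adjointOp x q = D.adjointOp x (X * q) + D.B₂ * q := by
  simp only [adjointOp, derivative_mul, derivative_X]
  ring

end Data

/-! ### The banded pencil. -/

namespace BOPs

variable {D : Data} (P : BOPs D)

theorem biorth_bilin (hD : D.Convergent) :
    IsBiorthonormal (fun f g => Data.bilin hD f g) P.p P.s := P.biorth

theorem biorth_bilinHat (hD : D.Convergent) :
    IsBiorthonormal (fun f g => Data.bilinHat hD f g) P.pHat P.sHat := P.biorthHat

theorem coeff_pHat (n : ℕ) : (P.pHat n).coeff n = (P.p n).coeff n := by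
  have h := P.normalizedHat n
  rwa [leadingCoeff, leadingCoeff, natDegree_eq_of_degree_eq_some (P.biorthHat.degree_left n),
    natDegree_eq_of_degree_eq_some (P.biorth.degree_left n)] at h

/-- The entries of `Â - x (1 + L̂)`. -/
def pencil (x : ℂ) (j k : ℕ) : ℂ := D.L (P.p j) (D.adjointOp x (P.sHat k))

theorem pencil_eq (hD : D.Convergent) (x : ℂ) (j k : ℕ) :
    P.pencil x j k = P.matA j k - x * ((if j = k then 1 else 0) + P.matL j k) := by
  have h1 := (Data.bilin hD (P.p j)).map_sub (D.A₂ * P.sHat k - D.B₂ * derivative (P.sHat k))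
    (x • (D.B₂ * P.sHat k))
  rw [map_smul, smul_eq_C_mul] at h1
  simp only [Data.bilin_apply, smul_eq_mul] at h1
  rw [pencil, Data.adjointOp, h1, matA, matL]
  ring

theorem pencil_eq_hat (hD : D.Convergent) (x : ℂ) (j k : ℕ) :
    P.pencil x j k = D.Lhat ((X - C x) * P.p j) (P.sHat k) :=
  Data.L_adjointOp hD _ _ _

theorem degree_X_sub_C_mul (x : ℂ) (j : ℕ) :
    ((X - C x) * P.p j).degree = ((j + 1 : ℕ) : WithBot ℕ) := by
  rw [degree_mul, degree_X_sub_C, P.biorth.degree_left, add_comm]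
  rfl

/-- The two readings of the pencil give the two edges of the band: `(X - x) p_j` reaches only
`p̂_{j+1}`, and `adjointOp x ŝ_k` reaches only `s_{k+d₂}`. -/
theorem pencil_eq_zero_of_lt (hD : D.Convergent) (x : ℂ) {j k : ℕ} (h : j + 1 < k) :
    P.pencil x j k = 0 := by
  rw [P.pencil_eq_hat hD]
  refine (P.biorth_bilinHat hD).apply_right_eq_zero ?_
  rw [P.degree_X_sub_C_mul]
  exact_mod_cast h

theorem pencil_eq_zero_of_gt (hD : D.Convergent) (x : ℂ) {j k : ℕ} (h : k + D.d₂ < j) :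
    P.pencil x j k = 0 :=
  (P.biorth_bilin hD).apply_left_eq_zero (D.degree_adjointOp_lt x (P.biorthHat.degree_right k) h)

/-- This is the lowest diagonal of the band: a ratio of leading coefficients, nonzero for every `x`.
-/
theorem pencil_add_ne_zero (hD : D.Convergent) (x : ℂ) (k : ℕ) : P.pencil x (k + D.d₂) k ≠ 0 := by
  have h1 := (P.biorth_bilin hD).apply_left (n := k + D.d₂) (f := D.adjointOp x (P.sHat k))
    (Order.le_of_lt_succ (by
      have := D.degree_adjointOp_lt x (P.biorthHat.degree_right k) (Nat.lt_succ_self _)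
      exact_mod_cast this))
  rw [pencil, ← Data.bilin_apply hD, h1]
  exact div_ne_zero (D.coeff_adjointOp_ne_zero x (P.biorthHat.degree_right k))
    ((P.biorth_bilin hD).coeff_right_ne_zero _)

theorem pencil_succ_ne_zero (hD : D.Convergent) (x : ℂ) (j : ℕ) : P.pencil x j (j + 1) ≠ 0 := by
  rw [P.pencil_eq_hat hD, ← Data.bilinHat_apply hD,
    (P.biorth_bilinHat hD).apply_right (P.degree_X_sub_C_mul x j).le]
  exact div_ne_zero (coeff_ne_zero_of_eq_degree (P.degree_X_sub_C_mul x j))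
    ((P.biorth_bilinHat hD).coeff_left_ne_zero _)

/-- The expansion of `p_j` in the `p̂_k` is lower triangular by degree, and its diagonal is `1`
because the leading coefficients agree. -/
theorem matL_eq_zero (hD : D.Convergent) {j k : ℕ} (h : j ≤ k) : P.matL j k = 0 := by
  have h1 := (P.biorth_bilinHat hD).apply_right (f := P.p j) (n := k)
    (by rw [P.biorth.degree_left]; exact_mod_cast h)
  rw [Data.bilinHat_apply, Data.Lhat] at h1
  rw [matL, h1]
  rcases h.eq_or_lt with rfl | h
  · rw [if_pos rfl, P.coeff_pHat, div_self ((P.biorth_bilin hD).coeff_left_ne_zero _), sub_self]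
  · rw [coeff_eq_zero_of_degree_lt (by rw [P.biorth.degree_left]; exact_mod_cast h), if_neg h.ne]
    simp

theorem matA_succ (hD : D.Convergent) (x : ℂ) (j : ℕ) : P.matA j (j + 1) = P.pencil x j (j + 1) := by
  rw [P.pencil_eq hD, if_neg (by omega), P.matL_eq_zero hD (by omega)]
  ring

theorem sum_pencil_smul_pHat (hD : D.Convergent) (x : ℂ) {j N : ℕ} (h : j + 1 < N) :
    ∑ k ∈ Finset.range N, P.pencil x j k • P.pHat k = (X - C x) * P.p j := by
  have h1 := (P.biorth_bilinHat hD).eq_sum_left (f := (X - C x) * P.p j) (N := N)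
    (by rw [P.degree_X_sub_C_mul]; exact_mod_cast h)
  conv_rhs => rw [h1]
  exact Finset.sum_congr rfl fun k _ => by rw [P.pencil_eq_hat hD, Data.bilinHat_apply]

theorem sum_pencil_smul_s (hD : D.Convergent) (x : ℂ) {k N : ℕ} (h : k + D.d₂ < N) :
    ∑ j ∈ Finset.range N, P.pencil x j k • P.s j = D.adjointOp x (P.sHat k) := by
  have h1 := (P.biorth_bilin hD).eq_sum_right (f := D.adjointOp x (P.sHat k)) (N := N)
    (D.degree_adjointOp_lt x (P.biorthHat.degree_right k) h)
  conv_rhs => rw [h1]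
  rfl

end BOPs

theorem sum_range_eq_sum_fin {M : Type*} [AddCommMonoid M] {f : ℕ → M} {m d N : ℕ} (hN : m + d < N)
    (h0 : ∀ k < N, k < m ∨ m + d < k → f k = 0) :
    ∑ k ∈ Finset.range N, f k = ∑ b : Fin (d + 1), f (m + b) := by
  obtain ⟨r, rfl⟩ : ∃ r, N = m + (d + 1) + r := ⟨N - (m + (d + 1)), by omega⟩
  rw [Finset.sum_range_add, Finset.sum_range_add, Finset.sum_eq_zero fun k hk =>
    h0 k (by have := Finset.mem_range.mp hk; omega) (Or.inl (Finset.mem_range.mp hk)), zero_add, Finset.sum_eq_zero (s := Finset.range r)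
      fun k hk => h0 _ (by have := Finset.mem_range.mp hk; omega) (Or.inr (by omega)), add_zero, Finset.sum_range]

/-! ### The column functional. -/

namespace Data

variable {D : Data}

variable (D) in
/-- The functional `p ↦ e p(x) - ∫∫_κ p(ξ) β(y) / (ξ - x) exp (-V₁(ξ) - V₂(y) + ξ y) dξ dy`, of which
all columns of the direct system are windows. -/
def colFun (x e : ℂ) (β p : ℂ[X]) : ℂ := e * p.eval x - D.pair (fun ξ => p.eval ξ / (ξ - x)) β

/-- `colFun` as a linear functional. -/
def colLM (hD : D.Convergent) {x : ℂ} (hx : D.OffContours x) (e : ℂ) (β : ℂ[X]) : ℂ[X] →ₗ[ℂ] ℂ where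
  toFun := D.colFun x e β
  map_add' p q := by
    have h := pair_add_left (pairable_eval_div hD p hx) (pairable_eval_div hD q hx) β
    simp only [← add_div] at h
    simp only [colFun, eval_add, h]
    ring
  map_smul' c p := by
    have h := D.pair_const_mul_left c (fun ξ => p.eval ξ / (ξ - x)) β
    simp only [← mul_div_assoc] at h
    simp only [colFun, eval_smul, smul_eq_mul, h, RingHom.id_apply]
    ring

/-- The factor `X - x` kills the evaluation at `x` and cancels the Cauchy denominator. -/
theorem colFun_X_sub_C_mul {x : ℂ} (hx : D.OffContours x) (e : ℂ) (β p : ℂ[X]) :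
    D.colFun x e β ((X - C x) * p) = -D.L p β := by
  rw [colFun, L_eq_pair, pair_congr (g := fun ξ => p.eval ξ) fun μ t ht => ?_]
  · simp
  · have h0 := hx.ne (μ := μ) ht
    rw [eval_mul, eval_sub, eval_X, eval_C]
    field_simp

end Data

/-! ### The ladder recurrence and the Christoffel–Darboux identity. -/

namespace BOPs

variable {D : Data} (P : BOPs D)

/-- The defect `-𝓛(p_j | β)` vanishes for `j ≥ d₂`, which gives the ladder; for small `j` it
collects the coefficients of `β` in the basis `s_j`, which gives the inhomogeneous term of
`sum_cdMatrix`. -/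
theorem sum_pencil_mul_colFun (hD : D.Convergent) {x : ℂ} (hx : D.OffContours x) (e : ℂ) (β : ℂ[X])
    {j N : ℕ} (h : j + 1 < N) :
    ∑ k ∈ Finset.range N, P.pencil x j k * D.colFun x e β (P.pHat k) = -D.L (P.p j) β := by
  have h1 := congrArg (Data.colLM hD hx e β) (P.sum_pencil_smul_pHat hD x h)
  rw [map_sum] at h1
  simp only [map_smul, smul_eq_mul] at h1
  rw [← Data.colFun_X_sub_C_mul hx e]
  exact h1

theorem ladder_last (hD : D.Convergent) {m : ℕ} (hm : D.d₂ ≤ m) (x : ℂ) (b : Fin (D.d₂ + 1)) :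
    P.ladder m x (Fin.last D.d₂) b = -P.pencil x m (m - D.d₂ + b) / P.pencil x m (m + 1) := by
  have hb : b = Fin.last D.d₂ ↔ m = m - D.d₂ + (b : ℕ) := by
    rw [Fin.ext_iff, Fin.val_last]
    omega
  rw [ladder, Matrix.of_apply, if_pos rfl, P.matA_succ hD x, P.pencil_eq hD x m (m - D.d₂ + b)]
  simp only [hb]
  ring

theorem ladder_of_ne_last {m : ℕ} (x : ℂ) {a : Fin (D.d₂ + 1)} (ha : a ≠ Fin.last D.d₂)
    (b : Fin (D.d₂ + 1)) : P.ladder m x a b = if (b : ℕ) = a + 1 then 1 else 0 := by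
  rw [ladder, Matrix.of_apply, if_neg ha]

theorem ladder_mulVec_of_ne_last {m : ℕ} (x : ℂ) {a : Fin (D.d₂ + 1)} (ha : a ≠ Fin.last D.d₂)
    (v : Fin (D.d₂ + 1) → ℂ) :
    (P.ladder m x).mulVec v a = v ⟨a + 1, by have := Fin.val_lt_last ha; omega⟩ := by
  rw [Matrix.mulVec, dotProduct, Finset.sum_eq_single ⟨a + 1, by have := Fin.val_lt_last ha; omega⟩]
  · rw [P.ladder_of_ne_last x ha, if_pos rfl, one_mul]
  · intro b _ hb
    rw [P.ladder_of_ne_last x ha, if_neg (fun h => hb (Fin.ext h)), zero_mul]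
  · simp

/-- The ladder matrix implements the recurrence for every column functional. -/
theorem ladder_mulVec_colFun (hD : D.Convergent) {m : ℕ} (hm : D.d₂ ≤ m) {x : ℂ}
    (hx : D.OffContours x) (e : ℂ) {β : ℂ[X]} (hβ : β.degree < D.d₂) :
    (P.ladder m x).mulVec (fun b => D.colFun x e β (P.pHat (m - D.d₂ + b))) =
      fun a : Fin (D.d₂ + 1) => D.colFun x e β (P.pHat (m + 1 - D.d₂ + a)) := by
  ext a
  by_cases ha : a = Fin.last D.d₂
  · subst ha
    have h1 := P.sum_pencil_mul_colFun hD hx e β (j := m) (N := m + 2) (by omega)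
    have h2 : D.L (P.p m) β = 0 := (P.biorth_bilin hD).apply_left_eq_zero
      (hβ.trans_le (by exact_mod_cast hm))
    rw [h2, neg_zero, Finset.sum_range_succ, sum_range_eq_sum_fin (m := m - D.d₂) (d := D.d₂)
      (by omega)] at h1
    · have h3 := P.pencil_succ_ne_zero hD x m
      rw [Matrix.mulVec, dotProduct]
      simp only [P.ladder_last hD hm]
      have h4 : ∀ b : Fin (D.d₂ + 1), -P.pencil x m (m - D.d₂ + b) / P.pencil x m (m + 1) *
          D.colFun x e β (P.pHat (m - D.d₂ + b)) = -(P.pencil x m (m + 1))⁻¹ *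
            (P.pencil x m (m - D.d₂ + b) * D.colFun x e β (P.pHat (m - D.d₂ + b))) := by
        intro b; ring
      rw [Finset.sum_congr rfl fun b _ => h4 b, ← Finset.mul_sum, eq_neg_of_add_eq_zero_left h1,
        Fin.val_last, show m + 1 - D.d₂ + D.d₂ = m + 1 by omega]
      field_simp
    · intro k hkN hk
      rw [P.pencil_eq_zero_of_gt hD x (by omega), zero_mul]
  · rw [P.ladder_mulVec_of_ne_last x ha]
    simp only
    congr 2
    omega

/-- A companion-type argument: the shift rows force a kernel vector to vanish except in entry `0`,
and there the last row has the ratio of the lowest to the highest diagonal of the pencil, which is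
nonzero. -/
theorem isUnit_det_ladder (hD : D.Convergent) {m : ℕ} (hm : D.d₂ ≤ m) (x : ℂ) :
    IsUnit (P.ladder m x).det := by
  rw [← Matrix.isUnit_iff_isUnit_det, ← Matrix.mulVec_injective_iff_isUnit]
  intro v w hvw
  rw [← sub_eq_zero]
  have hz : (P.ladder m x).mulVec (v - w) = 0 := by rw [Matrix.mulVec_sub, hvw, sub_self]
  set u := v - w with hu
  have hsucc : ∀ b : Fin (D.d₂ + 1), b ≠ 0 → u b = 0 := by
    intro b hb
    have hb0 : (b : ℕ) ≠ 0 := fun h => hb (Fin.ext h)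
    have hlt := b.2
    have ha : (⟨b - 1, by omega⟩ : Fin (D.d₂ + 1)) ≠ Fin.last D.d₂ := by
      rw [Ne, Fin.ext_iff, Fin.val_last]
      simp only
      omega
    have h1 := P.ladder_mulVec_of_ne_last (m := m) x ha u
    rw [hz] at h1
    rw [show b = ⟨(b : ℕ) - 1 + 1, by omega⟩ from Fin.ext (by simp only; omega)]
    exact h1.symm
  ext b
  by_cases hb : b = 0
  · subst hb
    have h1 := congrFun hz (Fin.last D.d₂)
    rw [Matrix.mulVec, dotProduct, Finset.sum_eq_single 0] at h1
    · rw [P.ladder_last hD hm] at h1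
      have h2 := P.pencil_add_ne_zero hD x (m - D.d₂)
      rw [Nat.sub_add_cancel hm] at h2
      simp only [Fin.val_zero, add_zero, Pi.zero_apply] at h1
      exact (mul_eq_zero.mp h1).resolve_left
        (div_ne_zero (neg_ne_zero.mpr h2) (P.pencil_succ_ne_zero hD x m))
    · intro b _ hb
      rw [hsucc b hb, mul_zero]
    · simp
  · exact hsucc b hb

/-- The identity commutes with `Π_n`, so `Â - x L̂` may be replaced by the pencil `Â - x (1 + L̂)`.
-/
theorem cdMatrix_eq (hD : D.Convergent) (n : ℕ) (x : ℂ) (a b : Fin (D.d₂ + 1)) :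
    P.cdMatrix n x a b = P.pencil x (n - 1 + a) (n - D.d₂ + b) *
      ((if n - D.d₂ + (b : ℕ) < n then 1 else 0) - (if n - 1 + (a : ℕ) < n then 1 else 0)) := by
  rw [cdMatrix, Matrix.of_apply, P.pencil_eq hD]
  by_cases h : n - 1 + (a : ℕ) = n - D.d₂ + (b : ℕ)
  · simp [h]
  · rw [if_neg h, zero_add]

/-- The Christoffel–Darboux identity for a column functional. -/
theorem sum_cdMatrix (hD : D.Convergent) {n : ℕ} (hn : D.d₂ + 1 ≤ n) {x : ℂ}
    (hx : D.OffContours x) (e : ℂ) {β : ℂ[X]} (hβ : β.degree < D.d₂) :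
    ∑ a : Fin (D.d₂ + 1), (P.cdMatrix n x).mulVec
        (fun b => D.colFun x e β (P.pHat (n - D.d₂ + b))) a • P.s (n - 1 + a) =
      D.adjointOp x (∑ k ∈ Finset.range n, D.colFun x e β (P.pHat k) • P.sHat k) + β := by
  have hd := D.one_le_d₂
  set T : ℕ → ℂ := fun k => D.colFun x e β (P.pHat k) with hT
  set N := n + D.d₂ + 1 with hN
  set M : ℕ → ℕ → ℂ := fun j k => P.pencil x j k *
    ((if k < n then 1 else 0) - (if j < n then 1 else 0)) with hM
  -- The commutator lives on `k < n ≤ j`, where the band allows `j ≤ k + d₂`, and on `j < n ≤ k`,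
  -- where it allows only `j = n - 1`, `k = n`. Both fit in the window.
  have hM0 : ∀ j k, j < n - 1 ∨ n - 1 + D.d₂ < j ∨ k < n - D.d₂ ∨ n - D.d₂ + D.d₂ < k →
      M j k = 0 := by
    intro j k h
    simp only [hM]
    by_cases h1 : k < n <;> by_cases h2 : j < n
    · simp [h1, h2]
    · rw [P.pencil_eq_zero_of_gt hD x (by omega), zero_mul]
    · rw [P.pencil_eq_zero_of_lt hD x (by omega), zero_mul]
    · simp [h1, h2]
  have hwin : ∑ a : Fin (D.d₂ + 1), (P.cdMatrix n x).mulVec (fun b => T (n - D.d₂ + b)) a •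
      P.s (n - 1 + a) = ∑ j ∈ Finset.range N, (∑ k ∈ Finset.range N, M j k * T k) • P.s j := by
    rw [sum_range_eq_sum_fin (m := n - 1) (d := D.d₂) (by omega)]
    · refine Finset.sum_congr rfl fun a _ => ?_
      rw [sum_range_eq_sum_fin (m := n - D.d₂) (d := D.d₂) (by omega)]
      · rw [Matrix.mulVec, dotProduct]
        congr 1
        exact Finset.sum_congr rfl fun b _ => by rw [P.cdMatrix_eq hD]
      · intro k _ hk
        rw [hM0 _ _ (Or.inr (Or.inr hk)), zero_mul]
    · intro j _ hj
      rw [Finset.sum_eq_zero, zero_smul]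
      intro k _
      rw [hM0 _ _ (hj.imp_right Or.inl), zero_mul]
  -- The half with the projector on the column index: summing over `j` first rebuilds `adjointOp x
  -- ŝ_k`, and `N` is large enough for every `k < n`.
  have hA : ∑ j ∈ Finset.range N, (∑ k ∈ Finset.range N,
      P.pencil x j k * (if k < n then 1 else 0) * T k) • P.s j =
      D.adjointOp x (∑ k ∈ Finset.range n, T k • P.sHat k) := by
    have hlin : D.adjointOp x (∑ k ∈ Finset.range n, T k • P.sHat k) =
        ∑ k ∈ Finset.range n, T k • D.adjointOp x (P.sHat k) := by
      simp only [Data.adjointOp, derivative_sum, derivative_smul, Finset.mul_sum,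
        ← Finset.sum_sub_distrib, smul_sub, mul_smul_comm]
    rw [hlin]
    simp only [Finset.sum_smul]
    rw [Finset.sum_comm]
    have hsub : Finset.range n ⊆ Finset.range N := Finset.range_subset_range.mpr (by omega)
    rw [← Finset.sum_subset hsub]
    · refine Finset.sum_congr rfl fun k hk => ?_
      have hk' := Finset.mem_range.mp hk
      rw [← P.sum_pencil_smul_s hD x (k := k) (N := N) (by omega), Finset.smul_sum]
      refine Finset.sum_congr rfl fun j _ => ?_
      rw [if_pos hk', mul_one, mul_comm, mul_smul]
    · intro k _ hk
      refine Finset.sum_eq_zero fun j _ => ?_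
      rw [if_neg (fun h => hk (Finset.mem_range.mpr h)), mul_zero, zero_mul, zero_smul]
  -- The half with the projector on the row index: each row gives `-𝓛(p_j | β)`, and since `deg β <
  -- d₂ ≤ n` these coefficients rebuild `-β`.
  have hB : ∑ j ∈ Finset.range N, (∑ k ∈ Finset.range N,
      P.pencil x j k * (if j < n then 1 else 0) * T k) • P.s j = -β := by
    have hsub : Finset.range n ⊆ Finset.range N := Finset.range_subset_range.mpr (by omega)
    rw [← Finset.sum_subset hsub]
    · conv_rhs => rw [(P.biorth_bilin hD).eq_sum_right (f := β) (N := n)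
        (hβ.trans_le (by exact_mod_cast (by omega : D.d₂ ≤ n))), ← Finset.sum_neg_distrib]
      refine Finset.sum_congr rfl fun j hj => ?_
      have hj' := Finset.mem_range.mp hj
      simp only [if_pos hj', mul_one]
      rw [P.sum_pencil_mul_colFun hD hx e β (by omega), neg_smul]
      rfl
    · intro j _ hj
      rw [Finset.sum_eq_zero, zero_smul]
      intro k _
      rw [if_neg (fun h => hj (Finset.mem_range.mpr h)), mul_zero, zero_mul]
  rw [hwin, ← hA, ← sub_neg_eq_add, ← hB, ← Finset.sum_sub_distrib]
  refine Finset.sum_congr rfl fun j _ => ?_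
  rw [← sub_smul, ← Finset.sum_sub_distrib]
  congr 1
  exact Finset.sum_congr rfl fun k _ => by simp only [hM]; ring

/-! ### The source functional and the action of the coefficient matrix. -/

/-- The sum of the boundary term and of the `W` term, as a linear functional of the polynomial in
`y`. -/
def sourceLM (hD : D.Convergent) (p : ℂ[X]) {x : ℂ} (hx : D.OffContours x) : ℂ[X] →ₗ[ℂ] ℂ :=
  Data.pairLM (Data.pairable_eval_div hD (derivative p) hx) -
    D.dV₁ x • Data.pairLM (Data.pairable_eval_div hD p hx) -
    Data.pairLM (Data.pairable_eval_div_sq hD p hx) +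
    Data.pairLM (Data.pairable_eval_div hD p hx) ∘ₗ LinearMap.mulLeft ℂ X

theorem sourceLM_apply (hD : D.Convergent) (p q : ℂ[X]) {x : ℂ} (hx : D.OffContours x) :
    sourceLM hD p hx q = D.pair (fun ξ => (derivative p).eval ξ / (ξ - x)) q -
      D.dV₁ x * D.pair (fun ξ => p.eval ξ / (ξ - x)) q -
      D.pair (fun ξ => p.eval ξ / (ξ - x) ^ 2) q +
      D.pair (fun ξ => p.eval ξ / (ξ - x)) (X * q) := rfl

/-- After integration by parts in `ξ`, the boundary term contains `-V₁'(ξ) p / (ξ - x)`, which `W`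
cancels, leaving only the value `V₁'(x)`. -/
theorem boundaryMatrix_add_matW (hD : D.Convergent) (n : ℕ) {x : ℂ} (hx : D.OffContours x)
    (a b : Fin (D.d₂ + 1)) :
    P.boundaryMatrix n x a b + P.matW n x a b =
      sourceLM hD (P.pHat (n - D.d₂ + a)) hx (P.s (n - 1 + b)) := by
  set p := P.pHat (n - D.d₂ + a) with hp
  set q := P.s (n - 1 + b) with hq
  have h1 : P.matW n x a b = D.pair (fun ξ => D.dV₁ ξ * (p.eval ξ / (ξ - x))) q -
      D.dV₁ x * D.pair (fun ξ => p.eval ξ / (ξ - x)) q := by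
    have h2 : P.matW n x a b =
        D.pair (fun ξ => D.dV₁ ξ * (p.eval ξ / (ξ - x)) + -D.dV₁ x * (p.eval ξ / (ξ - x))) q := by
      rw [matW, Matrix.of_apply, ← hp, ← hq]
      change D.pair (fun ξ => p.eval ξ * ((D.dV₁ ξ - D.dV₁ x) / (ξ - x))) q = _
      congr 1
      ext ξ
      ring
    rw [h2, Data.pair_add_left (Data.pairable_dV₁_mul_eval_div hD p hx)
      ((Data.pairable_eval_div hD p hx).const_mul _), Data.pair_const_mul_left]
    ring
  rw [h1, boundaryMatrix, Matrix.of_apply, ← hp, ← hq, Data.sum_boundary_eq hD p q hx,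
    sourceLM_apply]
  ring

/-- Each Cauchy denominator loses one power. The contribution of the double pole and that of the
commutator of `y` with the operator are opposite, so only polynomial pairings remain. -/
theorem sourceLM_adjointOp (hD : D.Convergent) (p q : ℂ[X]) {x : ℂ} (hx : D.OffContours x) :
    sourceLM hD p hx (D.adjointOp x q) =
      D.Lhat (derivative p) q - D.dV₁ x * D.Lhat p q + D.Lhat p (X * q) := by
  rw [sourceLM_apply, Data.pair_div_adjointOp hD _ _ hx, Data.pair_div_adjointOp hD _ _ hx,
    Data.pair_div_sq_adjointOp hD _ _ hx, Data.X_mul_adjointOp,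
    Data.pair_add_right (Data.pairable_eval_div hD p hx), Data.pair_div_adjointOp hD _ _ hx]
  simp only [Data.Lhat, Data.L_eq_pair]
  ring

theorem matP_eq_zero (hD : D.Convergent) {j k : ℕ} (h : k + 1 < j) : P.matP j k = 0 := by
  refine (P.biorth_bilinHat hD).apply_left_eq_zero ?_
  rw [degree_mul, degree_X, P.biorthHat.degree_right]
  exact_mod_cast (by omega : 1 + k < j)

/-- The sum of the terms with `P̂`, as a sum over the window. -/
theorem hessenberg_mulVec_add (hD : D.Convergent) {n : ℕ} (hn : D.d₂ + 1 ≤ n) (x : ℂ) (T : ℕ → ℂ)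
    (a : Fin (D.d₂ + 1)) :
    (P.hessenberg n x).mulVec (fun b => T (n - D.d₂ + b)) a +
      (P.cornerMatrix n).mulVec (fun b => T (n - 1 - D.d₂ + b)) a =
    ∑ k ∈ Finset.range n, P.matP (n - D.d₂ + a) k * T k +
      (if a = Fin.last D.d₂ then D.dV₁ x * T n else 0) := by
  have h1 : (P.hessenberg n x).mulVec (fun b => T (n - D.d₂ + b)) a =
      ∑ c ∈ Finset.range D.d₂, P.matP (n - D.d₂ + a) (n - D.d₂ + c) * T (n - D.d₂ + c) +
      (if a = Fin.last D.d₂ then D.dV₁ x * T n else 0) := by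
    rw [Matrix.mulVec, dotProduct, Fin.sum_univ_castSucc, Finset.sum_range]
    congr 1
    · refine Finset.sum_congr rfl fun c _ => ?_
      rw [hessenberg, Matrix.of_apply, if_neg (Fin.castSucc_lt_last c).ne, Fin.val_castSucc]
      split_ifs with h
      · rfl
      · rw [P.matP_eq_zero hD (by omega)]
    · rw [hessenberg, Matrix.of_apply, if_pos rfl, Fin.val_last,
        Nat.sub_add_cancel (by omega : D.d₂ ≤ n)]
      split_ifs <;> simp
  -- Below the window, `P̂` has a single nonzero entry that matters: row `n - d₂`, column `n - d₂ -
  -- 1`. That index is the first of the preceding window, which is why the inverse ladder enters the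
  -- coefficient matrix.
  have h2 : (P.cornerMatrix n).mulVec (fun b => T (n - 1 - D.d₂ + b)) a =
      P.matP (n - D.d₂ + a) (n - D.d₂ - 1) * T (n - D.d₂ - 1) := by
    rw [cornerMatrix, Matrix.mulVec_diagonal]
    split_ifs with h
    · subst h
      simp only [Fin.val_zero, add_zero]
      rw [show n - 1 - D.d₂ = n - D.d₂ - 1 by omega]
    · have : (a : ℕ) ≠ 0 := fun h' => h (Fin.ext h')
      rw [P.matP_eq_zero hD (by omega), zero_mul, zero_mul]
  have h3 : ∑ k ∈ Finset.range n, P.matP (n - D.d₂ + a) k * T k =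
      P.matP (n - D.d₂ + a) (n - D.d₂ - 1) * T (n - D.d₂ - 1) +
      ∑ c ∈ Finset.range D.d₂, P.matP (n - D.d₂ + a) (n - D.d₂ + c) * T (n - D.d₂ + c) := by
    obtain ⟨r, rfl⟩ : ∃ r, n = r + 1 + D.d₂ := ⟨n - D.d₂ - 1, by omega⟩
    simp only [Nat.add_sub_cancel]
    rw [Finset.sum_range_add, Finset.sum_range_succ, Finset.sum_eq_zero, zero_add]
    intro k hk
    rw [P.matP_eq_zero hD (by have := Finset.mem_range.mp hk; omega), zero_mul]
  rw [h1, h2, h3]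
  ring

/-- The action of the coefficient matrix of the differential equation on a column. -/
theorem odeMatrix_mulVec_colFun (hD : D.Convergent) {n : ℕ} (hn : D.d₂ + 1 ≤ n) {x : ℂ}
    (hx : D.OffContours x) (e : ℂ) {β : ℂ[X]} (hβ : β.degree < D.d₂) (a : Fin (D.d₂ + 1)) :
    (P.odeMatrix n x).mulVec (fun b => D.colFun x e β (P.pHat (n - D.d₂ + b))) a =
      e * ((derivative (P.pHat (n - D.d₂ + a))).eval x -
        D.dV₁ x * (P.pHat (n - D.d₂ + a)).eval x) -
      D.pair (fun ξ => (P.pHat (n - D.d₂ + a)).eval ξ / (ξ - x) ^ 2) β +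
      D.pair (fun ξ => (P.pHat (n - D.d₂ + a)).eval ξ / (ξ - x)) (X * β) := by
  set p := P.pHat (n - D.d₂ + a) with hp
  set T : ℕ → ℂ := fun k => D.colFun x e β (P.pHat k) with hT
  set v : Fin (D.d₂ + 1) → ℂ := fun b => T (n - D.d₂ + b) with hv
  set K := ∑ k ∈ Finset.range n, T k • P.sHat k with hK
  have hpdeg : p.degree = ((n - D.d₂ + a : ℕ) : WithBot ℕ) := P.biorthHat.degree_left _
  have hlad : (P.ladder (n - 1) x)⁻¹.mulVec v = fun b : Fin (D.d₂ + 1) => T (n - 1 - D.d₂ + b) := by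
    have h1 := P.ladder_mulVec_colFun hD (m := n - 1) (by omega) hx e hβ
    rw [show n - 1 + 1 - D.d₂ = n - D.d₂ by omega] at h1
    rw [hv, ← h1, Matrix.mulVec_mulVec, Matrix.nonsing_inv_mul _ (P.isUnit_det_ladder hD (by omega) x),
      Matrix.one_mulVec]
  have hsource : ((P.boundaryMatrix n x + P.matW n x) * P.cdMatrix n x).mulVec v a =
      sourceLM hD p hx (D.adjointOp x K + β) := by
    rw [← P.sum_cdMatrix hD hn hx e hβ, ← Matrix.mulVec_mulVec, map_sum, Matrix.mulVec, dotProduct]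
    refine Finset.sum_congr rfl fun b _ => ?_
    rw [map_smul, Matrix.add_apply, P.boundaryMatrix_add_matW hD n hx, smul_eq_mul, mul_comm]
  have hLK : ∀ f : ℂ[X], D.Lhat f K = ∑ k ∈ Finset.range n, T k * D.Lhat f (P.sHat k) := by
    intro f
    rw [← Data.bilinHat_apply hD, hK, map_sum]
    simp only [map_smul, smul_eq_mul, Data.bilinHat_apply]
  -- `K` is a reproducing element for the functional: below degree `n`, the expansion of `f` in the
  -- `p̂_k` uses only indices `k < n`.
  have hLlt : ∀ f : ℂ[X], f.degree < n → D.Lhat f K = D.colFun x e β f := by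
    intro f hf
    have h1 := congrArg (Data.colLM hD hx e β) ((P.biorth_bilinHat hD).eq_sum_left hf)
    rw [map_sum] at h1
    simp only [map_smul, smul_eq_mul] at h1
    rw [hLK]
    refine Eq.trans ?_ h1.symm
    exact Finset.sum_congr rfl fun k _ => mul_comm _ _
  have hder : D.Lhat (derivative p) K = D.colFun x e β (derivative p) := by
    refine hLlt _ ?_
    have hp0 : p ≠ 0 := by
      intro h0
      rw [h0, degree_zero] at hpdeg
      exact WithBot.bot_ne_coe hpdeg
    have h1 := degree_derivative_lt hp0
    rw [hpdeg] at h1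
    exact h1.trans_le (by exact_mod_cast (by have := a.2; omega : n - D.d₂ + (a : ℕ) ≤ n))
  -- In the last row `p = p̂_n` has degree `n` and is orthogonal to `K`; the missing `V₁'(x)` term
  -- is provided by the `(n, n)` entry of the Hessenberg matrix.
  have hself : D.Lhat p K = if a = Fin.last D.d₂ then 0 else D.colFun x e β p := by
    split_ifs with h
    · rw [hLK]
      refine Finset.sum_eq_zero fun k hk => ?_
      have hk' := Finset.mem_range.mp hk
      have : D.Lhat p (P.sHat k) = 0 := by
        rw [hp, P.biorthHat.pairing, if_neg]
        rw [h, Fin.val_last]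
        omega
      rw [this, mul_zero]
    · refine hLlt _ ?_
      rw [hpdeg]
      have := Fin.val_lt_last h
      exact_mod_cast (by omega : n - D.d₂ + (a : ℕ) < n)
  have hX : D.Lhat p (X * K) = ∑ k ∈ Finset.range n, P.matP (n - D.d₂ + a) k * T k := by
    rw [← Data.bilinHat_apply hD, hK, Finset.mul_sum, map_sum]
    refine Finset.sum_congr rfl fun k _ => ?_
    rw [mul_smul_comm, map_smul, smul_eq_mul, mul_comm]
    rfl
  have hlast : a = Fin.last D.d₂ → T n = D.colFun x e β p := by
    rintro rfl
    rw [hp, Fin.val_last, Nat.sub_add_cancel (by omega : D.d₂ ≤ n)]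
  have hhess := P.hessenberg_mulVec_add hD hn x T a
  rw [map_add, sourceLM_adjointOp, hder, hself, hX, sourceLM_apply] at hsource
  rw [odeMatrix, add_assoc, ← add_mul, Matrix.add_mulVec, Matrix.sub_mulVec, Matrix.neg_mulVec,
    ← Matrix.mulVec_mulVec, hlad]
  simp only [Pi.add_apply, Pi.sub_apply, Pi.neg_apply]
  rw [hsource]
  have hc1 : D.colFun x e β (derivative p) = e * (derivative p).eval x -
    D.pair (fun ξ => (derivative p).eval ξ / (ξ - x)) β := rfl
  have hc2 : D.colFun x e β p = e * p.eval x - D.pair (fun ξ => p.eval ξ / (ξ - x)) β := rfl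
  split_ifs at hhess ⊢ with h
  · rw [hlast h] at hhess
    linear_combination -hhess + hc1 - D.dV₁ x * hc2
  · linear_combination -hhess + hc1 - D.dV₁ x * hc2

end BOPs

/-! ### Polynomial form of the concomitant kernel. -/

theorem dslope_eq_of_sub_eq {f g : ℂ → ℂ} {s : ℂ} (h : ∀ y, f y - f s = (y - s) * g y)
    (hg : ContinuousAt g s) : dslope f s = g := by
  have hne : ∀ y, y ≠ s → slope f s y = g y := by
    intro y hy
    rw [slope_def_field, h, mul_div_cancel_left₀ _ (sub_ne_zero.mpr hy)]
  ext y
  by_cases hy : y = s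
  · subst hy
    rw [dslope_same]
    refine HasDerivAt.deriv (hasDerivAt_iff_tendsto_slope.mpr ?_)
    refine (hg.tendsto.mono_left nhdsWithin_le_nhds).congr' ?_
    filter_upwards [self_mem_nhdsWithin] with z hz
    exact (hne z hz).symm
  · rw [dslope_of_ne _ hy, hne y hy]

/-- The coefficients in `y` of the divided difference of `∑ a_n(s) y ^ n`. -/
def divDiffCoeff (N : ℕ) (a : ℕ → ℂ[X]) (j : ℕ) : ℂ[X] :=
  ∑ n ∈ Finset.range N, if j < n then a n * X ^ (n - 1 - j) else 0

/-- This is the factorisation of `y ^ n - s ^ n`. The coefficients may depend on `s`, so that it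
applies a second time to the divided difference of `B₂`. -/
theorem dslope_sum (N : ℕ) (a : ℕ → ℂ[X]) (s : ℂ) :
    dslope (fun y => ∑ n ∈ Finset.range N, (a n).eval s * y ^ n) s =
      fun y => ∑ j ∈ Finset.range N, (divDiffCoeff N a j).eval s * y ^ j := by
  refine dslope_eq_of_sub_eq (fun y => ?_) ?_
  · rw [← Finset.sum_sub_distrib]
    simp only [divDiffCoeff, eval_finsetSum, Finset.sum_mul, Finset.mul_sum]
    rw [Finset.sum_comm]
    refine Finset.sum_congr rfl fun n hn => ?_
    rw [← mul_sub, ← geom_sum₂_mul, Finset.sum_mul, Finset.mul_sum]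
    have hsub : Finset.range n ⊆ Finset.range N :=
      Finset.range_subset_range.mpr (Finset.mem_range.mp hn).le
    rw [← Finset.sum_subset hsub]
    · refine Finset.sum_congr rfl fun j hj => ?_
      rw [if_pos (Finset.mem_range.mp hj), eval_mul, eval_pow, eval_X]
      ring
    · intro j _ hj
      rw [if_neg (fun h => hj (Finset.mem_range.mpr h))]
      simp
  · exact Continuous.continuousAt (by fun_prop)

theorem coeff_divDiffCoeff (N : ℕ) (a : ℕ → ℂ[X]) (j m : ℕ) :
    (divDiffCoeff N a j).coeff m = ∑ n ∈ Finset.range N,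
      if j < n ∧ n - 1 - j ≤ m then (a n).coeff (m - (n - 1 - j)) else 0 := by
  rw [divDiffCoeff, finsetSum_coeff]
  refine Finset.sum_congr rfl fun n _ => ?_
  split_ifs with h1 h2 h2
  · rw [coeff_mul_X_pow', if_pos h2.2]
  · rw [coeff_mul_X_pow', if_neg (fun h => h2 ⟨h1, h⟩)]
  · exact absurd h2.1 h1
  · rw [coeff_zero]

/-- A bound `d` on the total degree in `y` and `s` drops by one under a divided difference. -/
theorem coeff_divDiffCoeff_eq_zero {N : ℕ} {a : ℕ → ℂ[X]} {d : ℕ}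
    (ha : ∀ n m, d < n + m → (a n).coeff m = 0) {j m : ℕ} (h : d < j + m + 1) :
    (divDiffCoeff N a j).coeff m = 0 := by
  rw [coeff_divDiffCoeff]
  refine Finset.sum_eq_zero fun n _ => ?_
  split_ifs with h1
  · exact ha _ _ (by omega)
  · rfl

namespace Data

variable (D : Data)

/-- The coefficients in `y` of the divided difference of `A₂`. -/
def divDiffA (j : ℕ) : ℂ[X] := divDiffCoeff (D.d₂ + 1) (fun n => C (D.A₂.coeff n)) j

/-- The coefficients in `y` of the divided difference of `B₂`. -/
def divDiffB (j : ℕ) : ℂ[X] := divDiffCoeff (D.d₂ + 1) (fun n => C (D.B₂.coeff n)) j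

/-- The coefficients in `y` of the second divided difference of `B₂`. -/
def divDiffB₂ (j : ℕ) : ℂ[X] := divDiffCoeff (D.d₂ + 1) D.divDiffB j

/-- The coefficients in `y` of the kernel of the bilinear concomitant. -/
def kernelCoeff (x : ℂ) (j : ℕ) : ℂ[X] := C x * D.divDiffB j - D.divDiffB₂ j - D.divDiffA j

theorem dslope_A₂ (s : ℂ) : dslope (fun z => D.A₂.eval z) s =
    fun y => ∑ j ∈ Finset.range (D.d₂ + 1), (D.divDiffA j).eval s * y ^ j := by
  simp only [divDiffA]
  rw [← dslope_sum]
  congr 1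
  ext y
  simp only [eval_C]
  exact eval_eq_sum_range y

theorem dslope_B₂ (s : ℂ) : dslope (fun z => D.B₂.eval z) s =
    fun y => ∑ j ∈ Finset.range (D.d₂ + 1), (D.divDiffB j).eval s * y ^ j := by
  simp only [divDiffB]
  rw [← dslope_sum]
  congr 1
  ext y
  simp only [eval_C]
  exact eval_eq_sum_range' (by have := D.deg₂; simp only [d₂]; omega) y

theorem divDiffCoeff_last (N : ℕ) (a : ℕ → ℂ[X]) : divDiffCoeff (N + 1) a N = 0 :=
  Finset.sum_eq_zero fun n hn => if_neg (by have := Finset.mem_range.mp hn; omega)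

theorem concomitantKernel_eq_sum (x y s : ℂ) :
    D.concomitantKernel x y s = ∑ j ∈ Finset.range D.d₂, (D.kernelCoeff x j).eval s * y ^ j := by
  have h : D.concomitantKernel x y s =
      ∑ j ∈ Finset.range (D.d₂ + 1), (D.kernelCoeff x j).eval s * y ^ j := by
    rw [concomitantKernel, D.dslope_A₂, D.dslope_B₂, dslope_sum]
    simp only [Finset.mul_sum, ← Finset.sum_sub_distrib]
    refine Finset.sum_congr rfl fun j _ => ?_
    rw [kernelCoeff, eval_sub, eval_sub, eval_mul, eval_C]
    simp only [divDiffB₂]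
    ring
  rw [h, Finset.sum_range_succ, kernelCoeff, divDiffA, divDiffB, divDiffB₂, divDiffCoeff_last,
    divDiffCoeff_last, divDiffCoeff_last]
  simp

theorem coeff_kernelCoeff_of_lt (x : ℂ) {j m : ℕ} (h : D.d₂ < j + m + 1) :
    (D.kernelCoeff x j).coeff m = 0 := by
  have hB : ∀ n m, D.d₂ < n + m + 1 → (C (D.B₂.coeff n)).coeff m = 0 := by
    intro n m h
    rcases m with _ | m
    · rw [coeff_C_zero, coeff_eq_zero_of_natDegree_lt]
      have := D.deg₂
      simp only [d₂] at h
      omega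
    · rw [coeff_C_succ]
  have hA : ∀ n m, D.d₂ < n + m → (C (D.A₂.coeff n)).coeff m = 0 := by
    intro n m h
    rcases m with _ | m
    · rw [coeff_C_zero, coeff_eq_zero_of_natDegree_lt (by simpa using h)]
    · rw [coeff_C_succ]
  have hB1 : ∀ n m, D.d₂ < n + m + 1 → (D.divDiffB n).coeff m = 0 := fun n m h =>
    coeff_divDiffCoeff_eq_zero (fun n m h => hB n m (by omega)) h
  rw [kernelCoeff, coeff_sub, coeff_sub, coeff_C_mul, hB1 _ _ h, divDiffA, divDiffB₂,
    coeff_divDiffCoeff_eq_zero hA h, coeff_divDiffCoeff_eq_zero (fun n m h => hB1 n m (by omega)) h]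
  simp

/-- In total degree `d₂ - 1` only the divided difference of `A₂` contributes, because `deg B₂ ≤ d₂ -
1`. -/
theorem coeff_kernelCoeff (x : ℂ) {j : ℕ} (hj : j < D.d₂) :
    (D.kernelCoeff x j).coeff (D.d₂ - 1 - j) = -D.A₂.leadingCoeff := by
  have hd := D.deg₂
  have hB : ∀ n m, D.d₂ - 1 < n + m → (C (D.B₂.coeff n)).coeff m = 0 := by
    intro n m h
    rcases m with _ | m
    · rw [coeff_C_zero, coeff_eq_zero_of_natDegree_lt]
      simp only [d₂] at h
      omega
    · rw [coeff_C_succ]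
  have hB1 : ∀ n m, D.d₂ - 1 < n + m + 1 → (D.divDiffB n).coeff m = 0 := fun n m h =>
    coeff_divDiffCoeff_eq_zero hB h
  have hA : (D.divDiffA j).coeff (D.d₂ - 1 - j) = D.A₂.leadingCoeff := by
    rw [divDiffA, coeff_divDiffCoeff, Finset.sum_eq_single D.d₂]
    · rw [if_pos ⟨hj, le_rfl⟩, Nat.sub_self, coeff_C_zero]
      rfl
    · intro n hn hne
      have := Finset.mem_range.mp hn
      split_ifs with h
      · rw [coeff_C, if_neg (by omega)]
      · rfl
    · intro h
      simp at h
  rw [kernelCoeff, coeff_sub, coeff_sub, coeff_C_mul, hA, hB1 _ _ (by omega), divDiffB₂,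
    coeff_divDiffCoeff_eq_zero (fun n m h => hB1 n m (by omega)) (by omega : D.d₂ - 1 < _)]
  simp

/-- Thus the coefficients of `y ^ j`, `j < d₂`, run through all degrees `0, …, d₂ - 1` in `s`; this
triangularity is what detects dependent dual contours. -/
theorem degree_kernelCoeff (x : ℂ) {j : ℕ} (hj : j < D.d₂) :
    (D.kernelCoeff x j).degree = ((D.d₂ - 1 - j : ℕ) : WithBot ℕ) := by
  refine le_antisymm ?_ (le_degree_of_ne_zero ?_)
  · rw [degree_le_iff_coeff_zero]
    intro m hm
    have hm' : D.d₂ - 1 - j < m := by exact_mod_cast hm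
    exact D.coeff_kernelCoeff_of_lt x (by omega)
  · rw [D.coeff_kernelCoeff x hj]
    exact neg_ne_zero.mpr (leadingCoeff_ne_zero.mpr D.A₂_ne_zero)

/-- The kernel as a polynomial in `s`: its expression through the formal adjoint operators. -/
theorem kernel_identity (x y : ℂ) :
    (C y - X) * (∑ j ∈ Finset.range D.d₂, C (y ^ j) * D.kernelCoeff x j) +
      (∑ j ∈ Finset.range D.d₂, C (y ^ j) * D.divDiffB j) =
    C (-(D.adjointOp x 1).eval y) * 1 + (D.A₂ + derivative D.B₂ - C x * D.B₂) := by
  refine Polynomial.funext fun s => ?_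
  have h1 : (∑ j ∈ Finset.range D.d₂, C (y ^ j) * D.kernelCoeff x j).eval s =
      D.concomitantKernel x y s := by
    rw [D.concomitantKernel_eq_sum, eval_finsetSum]
    refine Finset.sum_congr rfl fun j _ => ?_
    rw [eval_mul, eval_C, mul_comm]
  have h2 : (∑ j ∈ Finset.range D.d₂, C (y ^ j) * D.divDiffB j).eval s =
      dslope (fun z => D.B₂.eval z) s y := by
    have h3 : D.divDiffB D.d₂ = 0 := divDiffCoeff_last _ _
    simp only [D.dslope_B₂, eval_finsetSum]
    rw [Finset.sum_range_succ, h3, eval_zero, zero_mul, add_zero]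
    refine Finset.sum_congr rfl fun j _ => ?_
    rw [eval_mul, eval_C, mul_comm]
  -- Multiplication by `y - s` undoes each divided difference. The second one leaves the first
  -- divided difference of `B₂`, which is the `x`-derivative of the kernel and is compensated by the
  -- added sum.
  have e1 := sub_smul_dslope (fun z => D.B₂.eval z) s y
  have e2 := sub_smul_dslope (dslope (fun z => D.B₂.eval z) s) s y
  have e3 := sub_smul_dslope (fun z => D.A₂.eval z) s y
  rw [dslope_same, Polynomial.deriv] at e2
  simp only [smul_eq_mul] at e1 e2 e3
  rw [eval_add, eval_mul, h1, h2, concomitantKernel]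
  simp only [adjointOp, eval_add, eval_sub, eval_mul, eval_C, eval_X, eval_one, derivative_one,
    eval_zero]
  linear_combination x * e1 - e2 - e3

/-! ### Dual moments and the polynomials `betaPoly`. -/

theorem deg_dual : D.B₂.natDegree + 1 ≤ (-D.A₂ - derivative D.B₂).natDegree := by
  rw [show -D.A₂ - derivative D.B₂ = -(D.A₂ + derivative D.B₂) by ring, natDegree_neg,
    natDegree_add_derivative D.deg₂]
  exact D.deg₂

/-- The moment functional `q ↦ ∫ q(s) exp (V̂₂(s) - x s) ds` of a dual contour. -/
def dualMoment (ν : Fin D.d₂) (x : ℂ) : ℂ[X] →ₗ[ℂ] ℂ :=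
  (D.Γs ν).laplaceLM D.B₂_ne_zero D.deg_dual (-x)

theorem dualMoment_apply (ν : Fin D.d₂) (x : ℂ) (q : ℂ[X]) :
    D.dualMoment ν x q = (D.Γs ν).laplace q (-x) := rfl

theorem adjointSolution_eq (ν : Fin D.d₂) (x : ℂ) :
    D.adjointSolution ν x = D.dualMoment ν x 1 := by
  rw [dualMoment_apply, adjointSolution, Contour.laplace]
  simp

theorem hasDerivAt_dualMoment (ν : Fin D.d₂) (q : ℂ[X]) (x : ℂ) :
    HasDerivAt (fun z => D.dualMoment ν z q) (-D.dualMoment ν x (X * q)) x := by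
  have h := HasDerivAt.comp x
    ((D.Γs ν).hasDerivAt_laplace D.B₂_ne_zero D.deg_dual q (-x)) (hasDerivAt_neg x)
  rw [mul_neg_one] at h
  exact h

/-- Integration by parts in `s`. -/
theorem dualMoment_integration_by_parts (ν : Fin D.d₂) (x : ℂ) (q : ℂ[X]) :
    D.dualMoment ν x ((D.A₂ + derivative D.B₂ - C x * D.B₂) * q + D.B₂ * derivative q) = 0 := by
  have h := (D.Γs ν).laplace_integration_by_parts D.B₂_ne_zero D.deg_dual q (-x)
  simp only [← dualMoment_apply] at h
  have h1 : (D.A₂ + derivative D.B₂ - C x * D.B₂) * q + D.B₂ * derivative q =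
      -((-D.A₂ - derivative D.B₂) * q - D.B₂ * derivative q) - x • (D.B₂ * q) := by
    rw [smul_eq_C_mul]; ring
  rw [h1, map_sub, map_neg, h, map_smul, smul_eq_mul]
  ring

/-- The polynomial `(1 / 2πi) ∫ 𝓑₂(x; y, s) exp (V̂₂(s) - x s) ds` in `y`. -/
def betaPoly (ν : Fin D.d₂) (x : ℂ) : ℂ[X] :=
  ∑ j ∈ Finset.range D.d₂,
    (1 / (2 * Real.pi * Complex.I) * D.dualMoment ν x (D.kernelCoeff x j)) • X ^ j

/-- The derivative of `betaPoly` with respect to `x`. -/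
def betaPolyDeriv (ν : Fin D.d₂) (x : ℂ) : ℂ[X] :=
  ∑ j ∈ Finset.range D.d₂, (1 / (2 * Real.pi * Complex.I) *
    D.dualMoment ν x (D.divDiffB j - X * D.kernelCoeff x j)) • X ^ j

theorem degree_betaPoly_lt (ν : Fin D.d₂) (x : ℂ) : (D.betaPoly ν x).degree < D.d₂ := by
  refine (Polynomial.degree_sum_le _ _).trans_lt ?_
  rw [Finset.sup_lt_iff (WithBot.bot_lt_coe _)]
  intro j hj
  refine (degree_smul_le _ _).trans_lt ?_
  rw [degree_X_pow]
  exact_mod_cast Finset.mem_range.mp hj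

theorem hasDerivAt_dualMoment_kernelCoeff (ν : Fin D.d₂) (x : ℂ) (j : ℕ) :
    HasDerivAt (fun z => D.dualMoment ν z (D.kernelCoeff z j))
      (D.dualMoment ν x (D.divDiffB j - X * D.kernelCoeff x j)) x := by
  have h : ∀ z, D.dualMoment ν z (D.kernelCoeff z j) = z * D.dualMoment ν z (D.divDiffB j) -
      D.dualMoment ν z (D.divDiffB₂ j) - D.dualMoment ν z (D.divDiffA j) := by
    intro z
    rw [kernelCoeff, map_sub, map_sub, ← smul_eq_C_mul, map_smul, smul_eq_mul]
  rw [funext h]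
  refine ((((hasDerivAt_id x).mul (D.hasDerivAt_dualMoment ν (D.divDiffB j) x)).sub
    (D.hasDerivAt_dualMoment ν (D.divDiffB₂ j) x)).sub
    (D.hasDerivAt_dualMoment ν (D.divDiffA j) x)).congr_deriv ?_
  have h2 : D.divDiffB j - X * D.kernelCoeff x j = D.divDiffB j - x • (X * D.divDiffB j) +
      X * D.divDiffB₂ j + X * D.divDiffA j := by
    rw [kernelCoeff, smul_eq_C_mul]; ring
  rw [h2, map_add, map_add, map_sub, map_smul, smul_eq_mul, id]
  ring

/-- Integrate `kernel_identity` against the dual weight: the part depending on `s` alone is a total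
derivative and disappears, leaving the part in `y` times the zeroth moment. -/
theorem X_mul_betaPoly_add_deriv (ν : Fin D.d₂) (x : ℂ) :
    X * D.betaPoly ν x + D.betaPolyDeriv ν x =
      C (-(1 / (2 * Real.pi * Complex.I) * D.dualMoment ν x 1)) * D.adjointOp x 1 := by
  refine Polynomial.funext fun y => ?_
  have h := congrArg (D.dualMoment ν x) (D.kernel_identity x y)
  have hibp := D.dualMoment_integration_by_parts ν x 1
  rw [derivative_one, mul_zero, add_zero, mul_one] at hibp
  rw [map_add (D.dualMoment ν x) (C _ * 1), hibp, ← smul_eq_C_mul, map_smul, add_zero, smul_eq_mul,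
    Finset.mul_sum, ← Finset.sum_add_distrib, map_sum] at h
  have h2 : ∀ j, D.dualMoment ν x ((C y - X) * (C (y ^ j) * D.kernelCoeff x j) +
      C (y ^ j) * D.divDiffB j) = y ^ j * (y * D.dualMoment ν x (D.kernelCoeff x j) +
        D.dualMoment ν x (D.divDiffB j - X * D.kernelCoeff x j)) := by
    intro j
    rw [show (C y - X) * (C (y ^ j) * D.kernelCoeff x j) + C (y ^ j) * D.divDiffB j =
      y ^ j • (y • D.kernelCoeff x j + (D.divDiffB j - X * D.kernelCoeff x j)) by
        simp only [smul_eq_C_mul]; ring, map_smul, map_add, map_smul]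
    simp only [smul_eq_mul]
  rw [Finset.sum_congr rfl fun j _ => h2 j] at h
  simp only [eval_add, eval_mul, eval_X, eval_C, betaPoly, betaPolyDeriv, eval_finsetSum, eval_smul,
    eval_pow, smul_eq_mul]
  rw [Finset.mul_sum, ← Finset.sum_add_distrib]
  have h3 := congrArg (fun z => 1 / (2 * Real.pi * Complex.I) * z) h
  simp only [Finset.mul_sum] at h3
  refine Eq.trans (Finset.sum_congr rfl fun j _ => ?_) (h3.trans ?_)
  · ring
  · ring

end Data

/-! ### The auxiliary transforms and their derivatives. -/

namespace BOPs

variable {D : Data} (P : BOPs D)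

/-- The kernel is a finite sum of products of a polynomial in `s` and a power of `y`, so the `s`
integral separates algebraically. Replacing `x - ξ` by `ξ - x` produces the minus sign in `colFun`.
-/
theorem psiAux_eq_colFun (hD : D.Convergent) {x : ℂ} (hx : D.OffContours x) (ν : Fin D.d₂) (m : ℕ) :
    P.psiAux ν m x = D.colFun x 0 (D.betaPoly ν x) (P.pHat m) := by
  set h : ℂ → ℂ := fun ξ => (P.pHat m).eval ξ / (x - ξ) with hh
  have hneg : h = fun ξ => (-1 : ℂ) * ((P.pHat m).eval ξ / (ξ - x)) := by
    ext ξ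
    rw [hh]
    simp only
    rw [← neg_sub ξ x, div_neg]
    ring
  have hp : D.Pairable h := by
    rw [hneg]
    exact (Data.pairable_eval_div hD (P.pHat m) hx).const_mul _
  have hs : ∀ s : ℂ, (D.dblIntegral fun ξ y => D.concomitantKernel x y s * Complex.exp (-(x * s)) *
      ((P.pHat m).eval ξ / (x - ξ))) =
      (∑ j ∈ Finset.range D.d₂, D.pair h (X ^ j) • D.kernelCoeff x j).eval s *
        Complex.exp (-x * s) := by
    intro s
    have h1 : (D.dblIntegral fun ξ y => D.concomitantKernel x y s * Complex.exp (-(x * s)) *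
        ((P.pHat m).eval ξ / (x - ξ))) = Data.pairLM hp
          (∑ j ∈ Finset.range D.d₂, (Complex.exp (-x * s) * (D.kernelCoeff x j).eval s) • X ^ j) := by
      change _ = D.pair h _
      rw [Data.pair]
      congr 1
      ext ξ y
      rw [D.concomitantKernel_eq_sum, eval_finsetSum, hh]
      simp only [eval_smul, eval_pow, eval_X, smul_eq_mul, mul_assoc, ← Finset.mul_sum, neg_mul]
      ring
    rw [h1, map_sum, eval_finsetSum, Finset.sum_mul]
    refine Finset.sum_congr rfl fun j _ => ?_
    rw [map_smul, eval_smul, smul_eq_mul, smul_eq_mul]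
    change _ * D.pair h _ = _
    ring
  rw [psiAux, funext hs]
  change 1 / (2 * Real.pi * Complex.I) * D.dualMoment ν x
    (∑ j ∈ Finset.range D.d₂, D.pair h (X ^ j) • D.kernelCoeff x j) = _
  have h2 : D.colFun x 0 (D.betaPoly ν x) (P.pHat m) = Data.pairLM hp (D.betaPoly ν x) := by
    change _ = D.pair h _
    rw [Data.colFun, hneg, Data.pair_const_mul_left]
    ring
  rw [h2, Data.betaPoly, map_sum, map_sum, Finset.mul_sum]
  refine Finset.sum_congr rfl fun j _ => ?_
  rw [map_smul, map_smul, smul_eq_mul, smul_eq_mul]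
  change _ = _ * D.pair h _
  ring

/-- The derivative of the auxiliary transforms. -/
theorem hasDerivAt_psiAux (hD : D.Convergent) {U : Set ℂ} (hU : IsOpen U)
    (hUΓ : ∀ z ∈ U, D.OffContours z) {x : ℂ} (hxU : x ∈ U) (ν : Fin D.d₂) {m : ℕ} (hm : 1 ≤ m) :
    HasDerivAt (P.psiAux ν m)
      (-D.pair (fun ξ => (P.pHat m).eval ξ / (ξ - x) ^ 2) (D.betaPoly ν x) +
        D.pair (fun ξ => (P.pHat m).eval ξ / (ξ - x)) (X * D.betaPoly ν x)) x := by
  have hx := hUΓ x hxU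
  set p := P.pHat m with hp
  have h1 : P.psiAux ν m =ᶠ[𝓝 x] fun z => ∑ j ∈ Finset.range D.d₂,
      -(1 / (2 * Real.pi * Complex.I) * D.dualMoment ν z (D.kernelCoeff z j) *
        D.pair (fun ξ => p.eval ξ / (ξ - z)) (X ^ j)) := by
    filter_upwards [hU.mem_nhds hxU] with z hz
    have hpz := Data.pairable_eval_div hD p (hUΓ z hz)
    have h2 : D.pair (fun ξ => p.eval ξ / (ξ - z)) (D.betaPoly ν z) =
      Data.pairLM hpz (D.betaPoly ν z) := rfl
    rw [P.psiAux_eq_colFun hD (hUΓ z hz), Data.colFun, zero_mul, zero_sub, h2, Data.betaPoly, map_sum,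
      ← Finset.sum_neg_distrib]
    refine Finset.sum_congr rfl fun j _ => ?_
    rw [map_smul, smul_eq_mul]
    rfl
  refine HasDerivAt.congr_of_eventuallyEq ?_ h1
  have h3 := HasDerivAt.fun_sum (u := Finset.range D.d₂) fun j _ =>
    (((D.hasDerivAt_dualMoment_kernelCoeff ν x j).const_mul
      (1 / (2 * Real.pi * Complex.I))).mul (Data.hasDerivAt_pair hD p (X ^ j) hx)).neg
  refine h3.congr_deriv ?_
  have hp1 := Data.pairable_eval_div hD p hx
  have hp2 := Data.pairable_eval_div_sq hD p hx
  have e1 : D.pair (fun ξ => p.eval ξ / (ξ - x)) (D.betaPolyDeriv ν x) =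
      ∑ j ∈ Finset.range D.d₂, (1 / (2 * Real.pi * Complex.I) *
        D.dualMoment ν x (D.divDiffB j - X * D.kernelCoeff x j)) *
          D.pair (fun ξ => p.eval ξ / (ξ - x)) (X ^ j) := by
    change Data.pairLM hp1 _ = _
    rw [Data.betaPolyDeriv, map_sum]
    exact Finset.sum_congr rfl fun j _ => by rw [map_smul, smul_eq_mul]; rfl
  have e2 : D.pair (fun ξ => p.eval ξ / (ξ - x) ^ 2) (D.betaPoly ν x) =
      ∑ j ∈ Finset.range D.d₂, (1 / (2 * Real.pi * Complex.I) *
        D.dualMoment ν x (D.kernelCoeff x j)) *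
          D.pair (fun ξ => p.eval ξ / (ξ - x) ^ 2) (X ^ j) := by
    change Data.pairLM hp2 _ = _
    rw [Data.betaPoly, map_sum]
    exact Finset.sum_congr rfl fun j _ => by rw [map_smul, smul_eq_mul]; rfl
  -- Replacing `∂_x β` by `-y β` costs a multiple of `𝓛̂(p̂_m | 1)`, which vanishes because `m ≥ 1`.
  have e3 : D.pair (fun ξ => p.eval ξ / (ξ - x)) (X * D.betaPoly ν x) +
      D.pair (fun ξ => p.eval ξ / (ξ - x)) (D.betaPolyDeriv ν x) = 0 := by
    rw [← Data.pair_add_right hp1, D.X_mul_betaPoly_add_deriv, Data.pair_C_mul_right,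
      Data.pair_div_adjointOp hD _ _ hx]
    have h4 : D.Lhat p 1 = 0 := (P.biorth_bilinHat hD).apply_left_eq_zero
      (by rw [degree_one]; exact_mod_cast (by omega : 0 < m))
    rw [Data.Lhat, Data.L_eq_pair] at h4
    rw [h4, mul_zero]
  rw [eq_neg_of_add_eq_zero_left e3, e1, e2, ← Finset.sum_neg_distrib, ← Finset.sum_neg_distrib,
    ← Finset.sum_add_distrib]
  refine Finset.sum_congr rfl fun j _ => ?_
  ring

end BOPs

/-! ### Independence of the dual contours. -/

/-- A linear functional vanishing on polynomials of all degrees vanishes. -/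
theorem linearMap_eq_zero_of_degree {M : ℂ[X] →ₗ[ℂ] ℂ} {f : ℕ → ℂ[X]} (hf : ∀ n, (f n).degree = n)
    (h : ∀ n, M (f n) = 0) : M = 0 := by
  refine LinearMap.ext fun g => ?_
  have hg : g.degree < ((g.natDegree + 1 : ℕ) : WithBot ℕ) :=
    degree_le_natDegree.trans_lt (by exact_mod_cast g.natDegree.lt_succ_self)
  obtain ⟨c, hc⟩ := exists_eq_sum_smul hf hg
  rw [hc, map_sum, LinearMap.zero_apply]
  exact Finset.sum_eq_zero fun k _ => by rw [map_smul, h, smul_zero]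

theorem eq_zero_of_iteratedDeriv_eq_zero {f : ℂ → ℂ} (hf : Differentiable ℂ f) {x : ℂ}
    (h : ∀ n, iteratedDeriv n f x = 0) : f = 0 := by
  ext z
  rw [← Complex.taylorSeries_eq_of_entire hf x z]
  simp [h]

namespace Data

variable (D : Data)

/-- The moment functional of a combination of dual contours. -/
def dualMomentComb (c : Fin D.d₂ → ℂ) (x : ℂ) : ℂ[X] →ₗ[ℂ] ℂ := ∑ ν, c ν • D.dualMoment ν x

theorem dualMomentComb_apply (c : Fin D.d₂ → ℂ) (x : ℂ) (q : ℂ[X]) :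
    D.dualMomentComb c x q = ∑ ν, c ν * D.dualMoment ν x q := by
  simp [dualMomentComb]

theorem hasDerivAt_dualMomentComb (c : Fin D.d₂ → ℂ) (q : ℂ[X]) (x : ℂ) :
    HasDerivAt (fun z => D.dualMomentComb c z q) (-D.dualMomentComb c x (X * q)) x := by
  simp only [dualMomentComb_apply]
  refine (HasDerivAt.fun_sum fun ν _ => (D.hasDerivAt_dualMoment ν q x).const_mul (c ν)).congr_deriv ?_
  simp

theorem iteratedDeriv_dualMomentComb (c : Fin D.d₂ → ℂ) (n : ℕ) (q : ℂ[X]) :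
    iteratedDeriv n (fun z => D.dualMomentComb c z q) =
      fun z => (-1) ^ n * D.dualMomentComb c z (X ^ n * q) := by
  induction n generalizing q with
  | zero => simp
  | succ n ih =>
    rw [iteratedDeriv_succ', funext fun z => (D.hasDerivAt_dualMomentComb c q z).deriv]
    have h : (fun z => -D.dualMomentComb c z (X * q)) =
        fun z => D.dualMomentComb c z (-(X * q)) := by
      ext z
      rw [map_neg]
    rw [h, ih]
    ext z
    rw [show X ^ n * -(X * q) = -(X ^ (n + 1) * q) by ring, map_neg]
    ring

theorem sum_smul_adjointSolution (c : Fin D.d₂ → ℂ) :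
    ∑ ν, c ν • D.adjointSolution ν = fun z => D.dualMomentComb c z 1 := by
  ext z
  rw [dualMomentComb_apply, Finset.sum_apply]
  simp only [Pi.smul_apply, smul_eq_mul, adjointSolution_eq]

/-- A combination of the solutions of the adjoint equation vanishes if and only if all its moments
at one point do. -/
theorem sum_smul_adjointSolution_eq_zero_iff (c : Fin D.d₂ → ℂ) (x : ℂ) :
    ∑ ν, c ν • D.adjointSolution ν = 0 ↔ D.dualMomentComb c x = 0 := by
  rw [sum_smul_adjointSolution]
  constructor
  · intro h
    refine linearMap_eq_zero_of_degree (f := fun n => X ^ n) (fun n => degree_X_pow n) fun n => ?_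
    have h1 := congrFun (D.iteratedDeriv_dualMomentComb c n 1) x
    rw [h, mul_one] at h1
    have h2 : iteratedDeriv n (0 : ℂ → ℂ) x = 0 := by
      have : (0 : ℂ → ℂ) = fun _ => 0 := rfl
      rw [this, iteratedDeriv_const]
      split_ifs <;> rfl
    rw [h2] at h1
    exact (mul_eq_zero.mp h1.symm).resolve_left (pow_ne_zero _ (by norm_num))
  · intro h
    refine eq_zero_of_iteratedDeriv_eq_zero (x := x)
      (fun z => (D.hasDerivAt_dualMomentComb c 1 z).differentiableAt) fun n => ?_
    simp [D.iteratedDeriv_dualMomentComb, h]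

theorem sum_smul_betaPoly (c : Fin D.d₂ → ℂ) (x : ℂ) :
    ∑ ν, c ν • D.betaPoly ν x = ∑ j ∈ Finset.range D.d₂,
      (1 / (2 * Real.pi * Complex.I) * D.dualMomentComb c x (D.kernelCoeff x j)) • X ^ j := by
  simp only [betaPoly, Finset.smul_sum, dualMomentComb_apply]
  rw [Finset.sum_comm]
  refine Finset.sum_congr rfl fun j _ => ?_
  rw [Finset.mul_sum, Finset.sum_smul]
  refine Finset.sum_congr rfl fun ν _ => ?_
  rw [smul_smul]
  congr 1
  ring

/-- These are the polynomials annihilated through integration by parts; having every degree from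
`d₂` on, they complete the kernel coefficients to a basis. -/
theorem degree_dual_ibp (x : ℂ) (r : ℕ) :
    ((D.A₂ + derivative D.B₂ - C x * D.B₂) * X ^ r + D.B₂ * derivative (X ^ r)).degree =
      ((D.d₂ + r : ℕ) : WithBot ℕ) := by
  have hd := D.deg₂
  have h1 : ((derivative D.B₂ - C x * D.B₂) * X ^ r + D.B₂ * derivative (X ^ r)).natDegree ≤
      D.B₂.natDegree + r := by
    refine natDegree_add_le_of_degree_le ?_ ?_
    · refine natDegree_mul_le.trans ?_
      rw [natDegree_X_pow]
      gcongr
      refine (natDegree_sub_le _ _).trans (max_le ?_ (natDegree_C_mul_le _ _))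
      have := natDegree_derivative_le D.B₂
      omega
    · refine natDegree_mul_le.trans ?_
      have := natDegree_derivative_le (X ^ r : ℂ[X])
      rw [natDegree_X_pow] at this
      omega
  have h2 : (D.A₂ * X ^ r).degree = ((D.d₂ + r : ℕ) : WithBot ℕ) := by
    rw [degree_mul, degree_X_pow, degree_eq_natDegree D.A₂_ne_zero]
    rfl
  rw [show (D.A₂ + derivative D.B₂ - C x * D.B₂) * X ^ r + D.B₂ * derivative (X ^ r) =
    D.A₂ * X ^ r + ((derivative D.B₂ - C x * D.B₂) * X ^ r + D.B₂ * derivative (X ^ r)) by ring,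
    degree_add_eq_left_of_degree_lt, h2]
  rw [h2]
  refine degree_le_natDegree.trans_lt ?_
  exact_mod_cast (by simp only [d₂]; omega)

/-- The combination of the polynomials `betaPoly` detects the combination of dual contours. -/
theorem sum_smul_betaPoly_eq_zero_iff (c : Fin D.d₂ → ℂ) (x : ℂ) :
    ∑ ν, c ν • D.betaPoly ν x = 0 ↔ D.dualMomentComb c x = 0 := by
  constructor
  · intro h
    rw [sum_smul_betaPoly] at h
    have hj : ∀ j < D.d₂, D.dualMomentComb c x (D.kernelCoeff x j) = 0 := by
      intro j hj
      have h1 := congrArg (fun q => coeff q j) h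
      simp only [finsetSum_coeff, coeff_smul, coeff_X_pow, smul_eq_mul, coeff_zero, mul_ite, mul_one,
        mul_zero, Finset.sum_ite_eq, Finset.mem_range, if_pos hj] at h1
      refine (mul_eq_zero.mp h1).resolve_left (one_div_ne_zero ?_)
      exact mul_ne_zero (mul_ne_zero two_ne_zero (by exact_mod_cast Real.pi_ne_zero))
        Complex.I_ne_zero
    -- One polynomial in each degree: kernel coefficients in reversed order below `d₂`, total
    -- derivatives from `d₂` on.
    refine linearMap_eq_zero_of_degree (f := fun n => if n < D.d₂ then D.kernelCoeff x (D.d₂ - 1 - n)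
      else (D.A₂ + derivative D.B₂ - C x * D.B₂) * X ^ (n - D.d₂) +
        D.B₂ * derivative (X ^ (n - D.d₂))) (fun n => ?_) fun n => ?_
    · split_ifs with hn
      · rw [D.degree_kernelCoeff x (by omega)]
        congr 1
        omega
      · rw [D.degree_dual_ibp]
        congr 1
        omega
    · split_ifs with hn
      · exact hj _ (by omega)
      · rw [dualMomentComb_apply]
        exact Finset.sum_eq_zero fun ν _ => by rw [D.dualMoment_integration_by_parts, mul_zero]
  · intro h
    rw [sum_smul_betaPoly, h]
    simp

end Data

/-! ### The direct system: recurrence, differential equation, determinant. -/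

namespace BOPs

variable {D : Data} (P : BOPs D)

/-- A column functional which vanishes on one window is trivial. -/
theorem colFun_eq_zero_of_window (hD : D.Convergent) {n : ℕ} (hn : D.d₂ ≤ n) {x : ℂ}
    (hx : D.OffContours x) {e : ℂ} {β : ℂ[X]} (hβ : β.degree < D.d₂)
    (h : ∀ a : Fin (D.d₂ + 1), D.colFun x e β (P.pHat (n - D.d₂ + a)) = 0) : e = 0 ∧ β = 0 := by
  -- Invertibility of the ladders carries the zeros down to the lowest window; applying the ladders
  -- then carries them up to all indices.
  have hdown : ∀ m, D.d₂ ≤ m → m ≤ n →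
      ∀ a : Fin (D.d₂ + 1), D.colFun x e β (P.pHat (m - D.d₂ + a)) = 0 := by
    intro m hm hmn
    obtain ⟨k, rfl⟩ := Nat.exists_eq_add_of_le hmn
    induction k generalizing m with
    | zero => exact h
    | succ k ih =>
      have h1 := P.ladder_mulVec_colFun hD hm hx e hβ
      have h3 : ∀ a : Fin (D.d₂ + 1), D.colFun x e β (P.pHat (m + 1 - D.d₂ + a)) = 0 :=
        ih (m + 1) (by omega) (by omega) (by simpa [add_assoc, add_comm 1 k] using h) (by omega)
      rw [funext h3] at h1
      have h2 := (Matrix.mulVec_injective_iff_isUnit.mpr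
        ((Matrix.isUnit_iff_isUnit_det _).mpr (P.isUnit_det_ladder hD hm x)))
          (h1.trans (Matrix.mulVec_zero _).symm)
      exact congrFun h2
  have hup : ∀ m, D.d₂ ≤ m → ∀ a : Fin (D.d₂ + 1), D.colFun x e β (P.pHat (m - D.d₂ + a)) = 0 := by
    intro m hm
    induction m, hm using Nat.le_induction with
    | base => exact hdown _ le_rfl hn
    | succ m hm ih =>
      have h1 := P.ladder_mulVec_colFun hD hm hx e hβ
      rw [funext ih] at h1
      have h2 := h1.symm.trans (Matrix.mulVec_zero _)
      exact congrFun h2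
  have hall : ∀ k, D.colFun x e β (P.pHat k) = 0 := by
    intro k
    have h1 := hup (k + D.d₂) (by omega) 0
    simpa using h1
  have hzero : Data.colLM hD hx e β = 0 :=
    linearMap_eq_zero_of_degree P.biorthHat.degree_left hall
  -- Once the functional is zero, its values on `(X - x) p_k` show `𝓛(p_k | β) = 0`, and these are
  -- the coefficients of `β`.
  have hβ0 : β = 0 := by
    rw [(P.biorth_bilin hD).eq_sum_right hβ]
    refine Finset.sum_eq_zero fun k _ => ?_
    have h1 := Data.colFun_X_sub_C_mul hx e β (P.p k)
    have h2 : D.colFun x e β ((X - C x) * P.p k) = 0 := LinearMap.congr_fun hzero _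
    rw [h2, eq_comm, neg_eq_zero] at h1
    rw [Data.bilin_apply, h1, zero_smul]
  refine ⟨?_, hβ0⟩
  have h3 : D.colFun x e β 1 = 0 := LinearMap.congr_fun hzero _
  have h4 : D.pair (fun ξ => (1 : ℂ[X]).eval ξ / (ξ - x)) 0 = 0 :=
    (Data.pairLM (Data.pairable_eval_div hD 1 hx)).map_zero
  rw [hβ0, Data.colFun, h4] at h3
  simpa using h3

/-- The scalar attached to a column of the direct system. -/
def columnScalar (D : Data) (E : ℂ → ℂ) (x : ℂ) (r : Fin (D.d₂ + 1)) : ℂ :=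
  Fin.cases (E x) (fun _ => 0) r

/-- The polynomial attached to a column of the direct system. -/
def columnPoly (D : Data) (x : ℂ) (r : Fin (D.d₂ + 1)) : ℂ[X] :=
  Fin.cases 0 (fun ν => D.betaPoly ν x) r

theorem degree_columnPoly_lt (x : ℂ) (r : Fin (D.d₂ + 1)) : (columnPoly D x r).degree < D.d₂ := by
  refine Fin.cases ?_ (fun ν => D.degree_betaPoly_lt ν x) r
  change (0 : ℂ[X]).degree < _
  rw [degree_zero]
  exact WithBot.bot_lt_coe _

theorem direct_eq_colFun (hD : D.Convergent) (E : ℂ → ℂ) (n : ℕ) {x : ℂ} (hx : D.OffContours x)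
    (a r : Fin (D.d₂ + 1)) :
    P.direct E n x a r =
      D.colFun x (columnScalar D E x r) (columnPoly D x r) (P.pHat (n - D.d₂ + a)) := by
  refine Fin.cases ?_ (fun ν => ?_) r
  · change (P.pHat (n - D.d₂ + a)).eval x * E x = E x * _ - D.pair _ 0
    have h4 : D.pair (fun ξ => (P.pHat (n - D.d₂ + a)).eval ξ / (ξ - x)) 0 = 0 :=
      (Data.pairLM (Data.pairable_eval_div hD _ hx)).map_zero
    rw [h4]
    ring
  · exact P.psiAux_eq_colFun hD hx ν _

theorem direct_mulVec (hD : D.Convergent) (E : ℂ → ℂ) (n : ℕ) {x : ℂ} (hx : D.OffContours x)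
    (c : Fin (D.d₂ + 1) → ℂ) (a : Fin (D.d₂ + 1)) :
    (P.direct E n x).mulVec c a = D.colFun x (c 0 * E x) (∑ ν : Fin D.d₂, c ν.succ • D.betaPoly ν x)
      (P.pHat (n - D.d₂ + a)) := by
  set p := P.pHat (n - D.d₂ + a) with hp
  have h1 : D.pair (fun ξ => p.eval ξ / (ξ - x)) (∑ ν : Fin D.d₂, c ν.succ • D.betaPoly ν x) =
      ∑ ν : Fin D.d₂, c ν.succ * D.pair (fun ξ => p.eval ξ / (ξ - x)) (D.betaPoly ν x) := by
    change Data.pairLM (Data.pairable_eval_div hD p hx) _ = _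
    rw [map_sum]
    exact Finset.sum_congr rfl fun ν _ => by rw [map_smul, smul_eq_mul]; rfl
  rw [Matrix.mulVec, dotProduct, Fin.sum_univ_succ, Data.colFun, h1]
  have h2 : P.direct E n x a 0 = p.eval x * E x := rfl
  have h3 : ∀ ν : Fin D.d₂, P.direct E n x a ν.succ =
      -D.pair (fun ξ => p.eval ξ / (ξ - x)) (D.betaPoly ν x) := by
    intro ν
    have := P.psiAux_eq_colFun hD hx ν (n - D.d₂ + a)
    rw [Data.colFun, zero_mul, zero_sub] at this
    exact this
  rw [h2, sub_eq_add_neg, ← Finset.sum_neg_distrib]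
  congr 1
  · ring
  · refine Finset.sum_congr rfl fun ν _ => ?_
    rw [h3]
    ring

theorem direct_eq_ladder_mul (hD : D.Convergent) (E : ℂ → ℂ) {n : ℕ} (hn : D.d₂ + 1 ≤ n) {x : ℂ}
    (hx : D.OffContours x) : P.direct E n x = P.ladder (n - 1) x * P.direct E (n - 1) x := by
  ext a r
  have h1 := congrFun (P.ladder_mulVec_colFun hD (m := n - 1) (by omega) hx (columnScalar D E x r)
    (degree_columnPoly_lt x r)) a
  rw [show n - 1 + 1 - D.d₂ = n - D.d₂ by omega] at h1
  rw [P.direct_eq_colFun hD E n hx, ← h1, Matrix.mul_apply, Matrix.mulVec, dotProduct]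
  exact Finset.sum_congr rfl fun b _ => by rw [P.direct_eq_colFun hD E _ hx]

theorem hasDerivAt_direct (hD : D.Convergent) {n : ℕ} (hn : D.d₂ + 1 ≤ n) {U : Set ℂ}
    (hU : IsOpen U) (hUΓ : ∀ z ∈ U, D.OffContours z) {E : ℂ → ℂ} {x : ℂ} (hxU : x ∈ U)
    (hE : HasDerivAt E (-(D.dV₁ x) * E x) x) (a r : Fin (D.d₂ + 1)) :
    HasDerivAt (fun z => P.direct E n z a r) ((P.odeMatrix n x * P.direct E n x) a r) x := by
  have hx := hUΓ x hxU
  have h1 : (P.odeMatrix n x * P.direct E n x) a r = (P.odeMatrix n x).mulVec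
      (fun b => D.colFun x (columnScalar D E x r) (columnPoly D x r) (P.pHat (n - D.d₂ + b))) a := by
    rw [Matrix.mul_apply, Matrix.mulVec, dotProduct]
    exact Finset.sum_congr rfl fun b _ => by rw [P.direct_eq_colFun hD E _ hx]
  rw [h1, P.odeMatrix_mulVec_colFun hD hn hx _ (degree_columnPoly_lt x r)]
  set p := P.pHat (n - D.d₂ + a) with hp
  refine Fin.cases ?_ (fun ν => ?_) r
  · change HasDerivAt (fun z => p.eval z * E z) (E x * _ - D.pair _ 0 + D.pair _ (X * 0)) x
    rw [mul_zero, show D.pair (fun ξ => p.eval ξ / (ξ - x) ^ 2) 0 = 0 from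
      (Data.pairLM (Data.pairable_eval_div_sq hD p hx)).map_zero,
      show D.pair (fun ξ => p.eval ξ / (ξ - x)) 0 = 0 from
      (Data.pairLM (Data.pairable_eval_div hD p hx)).map_zero]
    refine ((p.hasDerivAt x).mul hE).congr_deriv ?_
    ring
  · refine (P.hasDerivAt_psiAux hD hU hUΓ hxU ν (m := n - D.d₂ + a) (by omega)).congr_deriv ?_
    change _ = 0 * _ - D.pair _ (D.betaPoly ν x) + D.pair _ (X * D.betaPoly ν x)
    ring

/-- A kernel vector is a column functional vanishing on a window, so its scalar `c 0 * E x` and its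
polynomial are zero; the polynomial part is exactly a dependence among the `g_ν`. In particular the
criterion does not depend on `x` or `n`. -/
theorem isUnit_det_direct_iff (hD : D.Convergent) {E : ℂ → ℂ} {n : ℕ} (hn : D.d₂ ≤ n) {x : ℂ}
    (hx : D.OffContours x) (hE : E x ≠ 0) :
    IsUnit (P.direct E n x).det ↔ LinearIndependent ℂ D.adjointSolution := by
  rw [← Matrix.isUnit_iff_isUnit_det, ← Matrix.mulVec_injective_iff_isUnit,
    Fintype.linearIndependent_iff]
  have hiff : ∀ c : Fin D.d₂ → ℂ,
      ∑ ν, c ν • D.adjointSolution ν = 0 ↔ ∑ ν, c ν • D.betaPoly ν x = 0 := fun c => by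
    rw [D.sum_smul_adjointSolution_eq_zero_iff c x, D.sum_smul_betaPoly_eq_zero_iff]
  constructor
  · intro hinj c hc ν
    rw [hiff] at hc
    have h1 : (P.direct E n x).mulVec (Fin.cons 0 c) = (P.direct E n x).mulVec 0 := by
      rw [Matrix.mulVec_zero]
      ext a
      rw [P.direct_mulVec hD E n hx]
      simp only [Fin.cons_zero, Fin.cons_succ, hc, Pi.zero_apply, Data.colFun, zero_mul, zero_sub,
        neg_eq_zero]
      exact (Data.pairLM (Data.pairable_eval_div hD _ hx)).map_zero
    have h2 := congrFun (hinj h1) ν.succ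
    simpa using h2
  · intro hli v w hvw
    rw [← sub_eq_zero]
    have hz : (P.direct E n x).mulVec (v - w) = 0 := by rw [Matrix.mulVec_sub, hvw, sub_self]
    set u := v - w with hu
    have hdeg : (∑ ν : Fin D.d₂, u ν.succ • D.betaPoly ν x).degree < (D.d₂ : WithBot ℕ) := by
      refine (Polynomial.degree_sum_le _ _).trans_lt ?_
      rw [Finset.sup_lt_iff (WithBot.bot_lt_coe _)]
      exact fun ν _ => (degree_smul_le _ _).trans_lt (D.degree_betaPoly_lt ν x)
    obtain ⟨h0, hβ⟩ := P.colFun_eq_zero_of_window hD hn hx (e := u 0 * E x) hdeg fun a => by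
      rw [← P.direct_mulVec hD E n hx, hz, Pi.zero_apply]
    have hc := hli (fun ν => u ν.succ) ((hiff _).mpr hβ)
    ext r
    refine Fin.cases ?_ (fun ν => hc ν) r
    exact (mul_eq_zero.mp h0).resolve_right hE

end BOPs

end TwoMatrix

end

/-! ### Assembly of the theorem. -/

theorem theorem4p4 (D : TwoMatrix.Data)
    (hconv : D.A₁.natDegree = D.B₁.natDegree + 1 → D.A₂.natDegree = D.B₂.natDegree + 1 →
      D.MomentsConverge)
    (P : TwoMatrix.BOPs D) (n : ℕ) (hn : D.d₂ + 1 ≤ n)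
    (U : Set ℂ) (hU : IsOpen U)
    (hUB : ∀ z ∈ U, D.B₁.eval z ≠ 0)
    (hUΓ : ∀ z ∈ U, ∀ μ, z ∉ closure (D.Γx μ).carrier)
    (E : ℂ → ℂ) (hE : ∀ z ∈ U, E z ≠ 0 ∧ HasDerivAt E (-(D.dV₁ z) * E z) z)
    (x : ℂ) (hx : x ∈ U) :
    -- the hat ladder matrix is invertible and implements the recurrence
    (IsUnit (P.ladder (n - 1) x).det ∧
      P.direct E n x = P.ladder (n - 1) x * P.direct E (n - 1) x) ∧
    -- the differential equation `Ψ̂' = C Ψ̂`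
    (∀ a r, HasDerivAt (fun z => P.direct E n z a r)
      ((P.odeMatrix n x * P.direct E n x) a r) x) ∧
    -- the system is fundamental exactly for independent dual contours
    (IsUnit (P.direct E n x).det ↔ LinearIndependent ℂ D.adjointSolution) ∧
    -- the form `Ψ̂' Ψ̂⁻¹ = C`
    (LinearIndependent ℂ D.adjointSolution →
      Matrix.of (fun a r => deriv (fun z => P.direct E n z a r) x) * (P.direct E n x)⁻¹ =
        P.odeMatrix n x) := by
  have hD : D.Convergent := hconv
  have hode := P.hasDerivAt_direct hD hn hU hUΓ hx (hE x hx).2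
  have hdet := P.isUnit_det_direct_iff hD (n := n) (by omega) (hUΓ x hx) (hE x hx).1
  refine ⟨⟨P.isUnit_det_ladder hD (by omega) x, P.direct_eq_ladder_mul hD E hn (hUΓ x hx)⟩, hode,
    hdet, fun hli => ?_⟩
  have h1 : Matrix.of (fun a r => deriv (fun z => P.direct E n z a r) x) =
      P.odeMatrix n x * P.direct E n x := by
    ext a r
    exact (hode a r).deriv
  rw [h1, Matrix.mul_assoc, Matrix.mul_nonsing_inv _ (hdet.mpr hli), mul_one]
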